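/- **Setting.** Let $U_2$ be a real orthogonal matrix, acting on a finite-dimensional complex space $\mathcal H=\mathbb C^n$, whose $1$-eigenspace is spanned by one real unit vector $|\phi_0\rangle$, and which has no eigenvalue $-1$. Let $|\mu\rangle$ be a real unit vector with $a_0=\langle\mu|\phi_0\rangle\ne 0$, and put $U_1=I-2|\mu\rangle\langle\mu|$ and $|\tilde\phi_0\rangle=|\phi_0\rangle-a_0|\mu\rangle$ (not normalized). For a positive eigenphase $\alpha\in(0,\pi]$ of $U=U_2U_1$ (i.e. $e^{i\alpha}$ is an eigenvalue of $U$), let $E_\alpha$ be the sum of the eigenspaces of $U$ for $e^{i\alpha}$ and $e^{-i\alpha}$, and let $p_\alpha$ be the squared length of the projection of $|\tilde\phi_0\rangle$ onto $E_\alpha$. Let $\alpha_1$ be the smallest positive eigenphase; $E_{\alpha_1}$ is the principal eigenspace. Let $QH$ take the value $1/\alpha$ with probability $p_\alpha$ for each positive eigenphase $\alpha$, and $0$ otherwise, and let $$\mathsf{QHT}_\varepsilon(U_2,|\mu\rangle)=\min\{y\ge 0:\Pr[QH>y]\le\varepsilon\},\qquad \Pr[QH>y]=\sum_{\alpha:\,1/\alpha>y}p_\alpha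 .$$ For $\theta\in[0,\pi/2)$ let $|\theta\rangle=\cos\theta\,|0\rangle-\sin\theta\,|1\rangle$, $|\theta^\perp\rangle=\sin\theta\,|0\rangle+\cos\theta\,|1\rangle$ in $\mathbb C^2$, and, on $\mathbb C^2\otimes\mathcal H$, $$\mathbf T(U_1,U_2,\theta)=\big(|\theta\rangle\langle\theta|\otimes(-I)+|\theta^\perp\rangle\langle\theta^\perp|\otimes U_2\big)\big(|0\rangle\langle0|\otimes I+|1\rangle\langle1|\otimes U_1\big).$$ The procedure $\mathbf{Rotate}(V,\Delta,\delta)$, for a unitary $V$, is the following unitary circuit. Let $t$ be the least natural number with $2\pi/2^t\le\Delta$, and let $K=\lceil C\log(1/\delta)\rceil$, where $C>0$ is an absolute constant (the one implied by "$\Theta(\log(1/\delta))$ repetitions"). (1) Apply the phase estimation circuit for $V$ $K$ times to the same state, each time with a fresh $t$-qubit register initialized to $|0\rangle$: prepare the uniform superposition of the register, apply $\sum_x V^x\otimes|x\rangle\langle x|$, and apply the inverse quantum Fourier transform to the register; the estimated phase is the representative in $(-\pi,\pi]$ of $2\pi k/2^t$ modulo $2\pi$, when the register reads $k$. (2) Multiply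 by $-1$ if more than half of the $K$ estimated phases are negative. (3) Undo step (1). **Theorem.** Let $C>0$ and $\varepsilon>0$ be any constants. There is a constant $c>0$, depending only on $\varepsilon$ and $C$, such that the following holds for all $n,U_2,|\phi_0\rangle,|\mu\rangle$ as above. Suppose that the squared length $p_{\alpha_1}$ of the projection of $|\tilde\phi_0\rangle$ onto the principal eigenspace of $U_2U_1$ is at least $1-\varepsilon$ and is larger than $\varepsilon$ (the second condition follows from the first if $\varepsilon<1/2$). Let $\theta\in[0,\pi/2)$ with $\tan\theta=a_0\cot(\alpha_1/2)/10$. Then for every real $T\ge \mathsf{QHT}_\varepsilon(U_2,|\mu\rangle)/0.78$, the procedure $\mathbf{Rotate}(\mathbf T(U_1,U_2,\theta),1/T,1/4)$ maps $|\theta^\perp\rangle|\tilde\phi_0\rangle$ (with all registers in state $|0\rangle$) to a state whose inner product with the target state $|1\rangle|\mu\rangle$ (with all registers in state $|0\rangle$) has absolute value at least $c$. -/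

import Mathlib

open scoped Matrix Kronecker

namespace QWalk

noncomputable section

/-! ### States and operators

A state of a system with basis `n` is a coordinate vector `n → ℂ`, and an operator is a square
matrix over `ℂ`.  Vectors and matrices with real entries are embedded by `cvec` and `cmat`. -/

/-- A vector with real entries, seen as a complex vector. -/
def cvec {n : Type*} (v : n → ℝ) : n → ℂ := fun i => (v i : ℂ)

/-- A matrix with real entries, seen as a complex matrix. -/
def cmat {n : Type*} (A : Matrix n n ℝ) : Matrix n n ℂ := A.map (fun x : ℝ => (x : ℂ))

/-- The inner product `⟨u|v⟩`. -/
def braket {n : Type*} [Fintype n] (u v : n → ℂ) : ℂ := star u ⬝ᵥ v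

/-- The operator `|u⟩⟨u|`. -/
def ketbra {n : Type*} (u : n → ℂ) : Matrix n n ℂ := Matrix.vecMulVec u (star u)

/-- The product state `|u⟩|v⟩`. -/
def tensor {m n : Type*} (u : m → ℂ) (v : n → ℂ) : m × n → ℂ := fun p => u p.1 * v p.2

/-- The basis state `|i⟩`. -/
def ket {n : Type*} [DecidableEq n] (i : n) : n → ℂ := Pi.single i 1

/-! ### The abstract search algorithm and its quantum hitting time -/

section Search

variable {n : Type*} [Fintype n] [DecidableEq n]

/-- `U₁ = I - 2 |μ⟩⟨μ|`. -/
def markedReflection (μ : n → ℝ) : Matrix n n ℂ := 1 - (2 : ℂ) • ketbra (cvec μ)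

/-- The abstract search operator `U = U₂ U₁`. -/
def searchOp (U₂ : Matrix n n ℝ) (μ : n → ℝ) : Matrix n n ℂ := cmat U₂ * markedReflection μ

/-- The (unnormalized) start state `φ₀ - ⟨μ|φ₀⟩ μ`. -/
def startState (φ₀ μ : n → ℝ) : n → ℝ := φ₀ - (μ ⬝ᵥ φ₀) • μ

/-- The eigenspace of the matrix `U` for the complex number `z`. -/
def eigSpace (U : Matrix n n ℂ) (z : ℂ) : Submodule ℂ (EuclideanSpace ℂ n) :=
  Module.End.eigenspace (Matrix.toEuclideanLin U) z

/-- The positive eigenphases of `U`: the `α ∈ (0, π]` such that `e^{iα}` is an eigenvalue of `U`.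
(When `U` has real entries, `e^{-iα}` is then an eigenvalue too.) -/
def eigenphases (U : Matrix n n ℂ) : Set ℝ :=
  {α | 0 < α ∧ α ≤ Real.pi ∧ eigSpace U (Complex.exp (α * Complex.I)) ≠ ⊥}

/-- The sum of the eigenspaces of `U` for `e^{iα}` and `e^{-iα}`.  For the smallest positive
eigenphase `α` this is the principal eigenspace of `U`. -/
def phaseSpace (U : Matrix n n ℂ) (α : ℝ) : Submodule ℂ (EuclideanSpace ℂ n) :=
  eigSpace U (Complex.exp (α * Complex.I)) ⊔ eigSpace U (Complex.exp (-(α * Complex.I)))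

/-- The squared length of the projection of `ψ` onto `phaseSpace U α`.  In the decomposition
`ψ = δ₀ w₀ + ∑ⱼ δⱼ (wⱼ⁺ + wⱼ⁻) + δ₋₁ w₋₁` of a real vector along the eigenspaces of a real unitary
`U`, this is `2 δⱼ²` for `α = αⱼ ∈ (0, π)`, and `δ₋₁²` for `α = π`. -/
def phaseWeight (U : Matrix n n ℂ) (ψ : n → ℂ) (α : ℝ) : ℝ :=
  ‖(phaseSpace U α).starProjection (WithLp.toLp 2 ψ)‖ ^ 2

/-- A matrix has finitely many eigenphases, so the sums over them below are finite sums. -/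
theorem eigenphases_finite (U : Matrix n n ℂ) : (eigenphases U).Finite := by
  have hfin : {z : ℂ | Module.End.HasEigenvalue (Matrix.toEuclideanLin U) z}.Finite :=
    Module.End.finite_hasEigenvalue _
  refine Set.Finite.of_finite_image (f := fun α : ℝ => Complex.exp (α * Complex.I))
    (hfin.subset ?_) ?_
  · rintro _ ⟨α, ⟨_, _, h⟩, rfl⟩
    exact h
  · intro α hα β hβ h
    have h1 : Complex.arg (Complex.exp (α * Complex.I)) = α :=
      Complex.arg_exp_mul_I α ▸ (toIocMod_eq_self _).2
        ⟨by linarith [hα.1, Real.pi_pos], by linarith [hα.2.1]⟩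
    have h2 : Complex.arg (Complex.exp (β * Complex.I)) = β :=
      Complex.arg_exp_mul_I β ▸ (toIocMod_eq_self _).2
        ⟨by linarith [hβ.1, Real.pi_pos], by linarith [hβ.2.1]⟩
    rw [← h1, ← h2]
    exact congrArg Complex.arg h

/-- `Pr[QH > y]` for `y ≥ 0`, where the random variable `QH` takes the value `1 / α` with
probability `phaseWeight U ψ α` for each positive eigenphase `α` of `U`, and `0` otherwise. -/
def qhTail (U : Matrix n n ℂ) (ψ : n → ℂ) (y : ℝ) : ℝ :=
  ∑ᶠ α ∈ {α ∈ eigenphases U | y < 1 / α}, phaseWeight U ψ α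

/-- The quantum `ε`-error `μ`-hitting time of `U₂`: the least `y ≥ 0` with `Pr[QH > y] ≤ ε`, where
`QH` is taken for the operator `U₂ U₁` and the state `φ₀ - ⟨μ|φ₀⟩ μ`. -/
def quantumHittingTime (U₂ : Matrix n n ℝ) (φ₀ μ : n → ℝ) (ε : ℝ) : ℝ :=
  sInf {y : ℝ | 0 ≤ y ∧ qhTail (searchOp U₂ μ) (cvec (startState φ₀ μ)) y ≤ ε}

/-! ### The modified abstract search algorithm -/

/-- The rotation of `ℂ²` by the angle `θ`. -/
def rotMatrix (θ : ℝ) : Matrix (Fin 2) (Fin 2) ℂ :=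
  cmat !![Real.cos θ, -Real.sin θ; Real.sin θ, Real.cos θ]

/-- `|θ⟩ = R_θ† |0⟩`. -/
def ketTheta (θ : ℝ) : Fin 2 → ℂ := (rotMatrix θ)ᴴ *ᵥ ket 0

/-- `|θ^⊥⟩ = R_θ† |1⟩`. -/
def ketThetaPerp (θ : ℝ) : Fin 2 → ℂ := (rotMatrix θ)ᴴ *ᵥ ket 1

/-- `T(U₁, U₂, θ) = (|θ⟩⟨θ| ⊗ (-I) + |θ^⊥⟩⟨θ^⊥| ⊗ U₂) (|0⟩⟨0| ⊗ I + |1⟩⟨1| ⊗ U₁)`. -/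
def modifiedSearchOp (U₁ U₂ : Matrix n n ℂ) (θ : ℝ) : Matrix (Fin 2 × n) (Fin 2 × n) ℂ :=
  (ketbra (ketTheta θ) ⊗ₖ (-1 : Matrix n n ℂ) + ketbra (ketThetaPerp θ) ⊗ₖ U₂) *
    (ketbra (ket 0) ⊗ₖ (1 : Matrix n n ℂ) + ketbra (ket 1) ⊗ₖ U₁)

end Search

/-! ### Phase estimation and the procedure `Rotate` -/

section Circuits

variable {n : Type*} [Fintype n] [DecidableEq n]

/-- The quantum Fourier transform on a `t`-qubit register. -/
def fourier (t : ℕ) : Matrix (Fin (2 ^ t)) (Fin (2 ^ t)) ℂ :=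
  Matrix.of fun x y =>
    Complex.exp (2 * Real.pi * Complex.I * (x : ℕ) * (y : ℕ) / (2 ^ t : ℕ)) /
      (Real.sqrt ((2 ^ t : ℕ) : ℝ) : ℂ)

/-- The controlled powers `∑ₓ Uˣ ⊗ |x⟩⟨x|` of `U`, with a `t`-qubit control register. -/
def controlledPower (U : Matrix n n ℂ) (t : ℕ) :
    Matrix (n × Fin (2 ^ t)) (n × Fin (2 ^ t)) ℂ :=
  Matrix.of fun p q => if p.2 = q.2 then (U ^ (q.2 : ℕ)) p.1 q.1 else 0

/-- The phase estimation circuit for `U` with a `t`-qubit register, before measurement: prepare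
the uniform superposition (the Fourier transform of the initial state `|0⟩` of the register), apply
the controlled powers of `U`, and apply the inverse Fourier transform to the register. -/
def estimate (U : Matrix n n ℂ) (t : ℕ) : Matrix (n × Fin (2 ^ t)) (n × Fin (2 ^ t)) ℂ :=
  ((1 : Matrix n n ℂ) ⊗ₖ (fourier t)ᴴ) * controlledPower U t * ((1 : Matrix n n ℂ) ⊗ₖ fourier t)

/-- The phase in `(-π, π]` estimated when the register reads `k`. -/
def estimatedPhase (t : ℕ) (k : Fin (2 ^ t)) : ℝ :=
  if 2 * (k : ℕ) ≤ 2 ^ t then 2 * Real.pi * (k : ℕ) / 2 ^ t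
  else 2 * Real.pi * (k : ℕ) / 2 ^ t - 2 * Real.pi

/-- The number of register qubits for estimates of precision `Δ`: the least `t` for which the
spacing `2π / 2^t` of the estimates is at most `Δ`.  The estimate is then within `Δ` of the phase
(modulo `2π`) with probability at least `8 / π² > 2 / 3`, and the circuit uses `O(1 / Δ)` controlled
applications of `U`. -/
def precisionQubits (Δ : ℝ) : ℕ := Nat.clog 2 ⌈2 * Real.pi / Δ⌉₊

/-- An operator on the system and one register, applied to the system and the `j`-th of `K`
registers. -/
def onRegister {R : Type*} [DecidableEq R] {K : ℕ} (j : Fin K) (A : Matrix (n × R) (n × R) ℂ) :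
    Matrix (n × (Fin K → R)) (n × (Fin K → R)) ℂ :=
  Matrix.of fun p q =>
    if ∀ l, l ≠ j → p.2 l = q.2 l then A (p.1, p.2 j) (q.1, q.2 j) else 0

/-- Phase estimation applied `K` times to the same state, with `K` separate registers. -/
def estimates (U : Matrix n n ℂ) (t K : ℕ) :
    Matrix (n × (Fin K → Fin (2 ^ t))) (n × (Fin K → Fin (2 ^ t))) ℂ :=
  (List.ofFn fun j : Fin K => onRegister j (estimate U t)).prod

/-- The phase flip: multiply by `-1` when more than half of the estimated phases are negative. -/
def majorityFlip (n : Type*) [DecidableEq n] (t K : ℕ) :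
    Matrix (n × (Fin K → Fin (2 ^ t))) (n × (Fin K → Fin (2 ^ t))) ℂ :=
  Matrix.diagonal fun p =>
    if K < 2 * Set.ncard {j : Fin K | estimatedPhase t (p.2 j) < 0} then -1 else 1

/-- The number of repetitions `⌈C log (1 / ε)⌉`, where `C` is the constant implied by
`Θ(log (1 / ε))`. -/
def repetitions (C ε : ℝ) : ℕ := ⌈C * Real.log (1 / ε)⌉₊

/-- The procedure `Rotate(U, Δ, ε)`: apply phase estimation with precision `Δ` repeatedly, flip the
phase if the majority of the estimates is negative, and undo the phase estimations. -/
def rotate (C : ℝ) (U : Matrix n n ℂ) (Δ ε : ℝ) :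
    Matrix (n × (Fin (repetitions C ε) → Fin (2 ^ precisionQubits Δ)))
      (n × (Fin (repetitions C ε) → Fin (2 ^ precisionQubits Δ))) ℂ :=
  (estimates U (precisionQubits Δ) (repetitions C ε))ᴴ *
    majorityFlip n (precisionQubits Δ) (repetitions C ε) *
    estimates U (precisionQubits Δ) (repetitions C ε)

/-- The state `ψ` of the system, together with all registers in the state `|0⟩`. -/
def withRegisters {t K : ℕ} (ψ : n → ℂ) : n × (Fin K → Fin (2 ^ t)) → ℂ :=
  tensor ψ (ket fun _ => 0)

end Circuits

end

end QWalk

namespace QWalk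

set_option linter.unusedSectionVars false

/-! ### Algebra of brackets, projectors and product states. -/

section Braket

variable {ι κ : Type*} [Fintype ι] [Fintype κ]

/-! Everything is expressed through spectral measures. `Rotate` acts on an eigenvector of phase `β`
through the factor `1 - 2 q(β)`, where `q = flipProb` is the probability of a flip
(`braket_rotate`). The operator `T` is a unitary `extendedOp` times the reflection about the target
`|1⟩|μ⟩`, so its spectrum is that of a rank-one perturbation. If `A` has eigenvectors `c k` of
phases `γ k`, then an eigenvector `w` of `A (1 - 2|m⟩⟨m|)` of phase `β` satisfies `⟨c k|w⟩ = (1 + i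
cot((β - γ k)/2)) ⟨c k|m⟩⟨m|w⟩` (`braket_of_eig`). The eigenphases seen by `m` are thus the zeros of
`cotSum`, and the weight of `m` there is `1 / (1 + cotSqSum)`.

The same formula writes the overlap of the start state with an eigenvector as `i a₀ cos θ (cot(β/2)
- τ² tan(β/2))` times that of the target, where `τ = tan θ`. Since `T` is real, phases `±β` carry
equal weight. Folding them together, the output overlap is `a₀ cos θ |∑ w (cot(x/2) - τ² tan(x/2))
D(x)|`, where `x` runs over absolute phases, `w` is the spectral measure of the target and `D(x) =
q(-x) - q(x)` lies in `[0, 1]` (`norm_braket_rotate_modified`).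

With `r = τ tan(x/2)` the factor is `τ (1/r - r)`. Two moments are known: `∑ w = 1`, and `∑ w r² =
1`, which is the normalization of `|θ⟩|μ⟩`. A multiple of `1 - r²` can therefore be subtracted
freely, and the sum becomes `∑ w (1 - r²)(D/r - c)`. For a suitable `c` the summand is bounded below
by a small negative number (`defect_le_of_small_angle`, `defect_le_of_large_angle`). At the first
phase `β₁` it is about `10 D/a₀`, and this gain wins (`weighted_sum_ge`, `overlap_ge`).

The data at `β₁` come from the unmodified search. The principal weight is at least `1/2`, which
bounds `cotSqSum` at `α₁` by `4 a₀² cot²(α₁/2)` (`principal_eigenphase`). By monotonicity of the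
secular functions, `β₁` is at most `α₁`, within one percent of it, and carries enough weight
(`exists_modified_spectrum`). The condition on `T` makes the grid of phase estimation finer than
`0.78 α₁`, and Fejér kernel estimates then bound `D` from below (`flipProb_gap_ge`). Markov's
inequality suffices for the majority vote, so one repetition is already enough. -/

theorem braket_add_right (u v w : ι → ℂ) : braket u (v + w) = braket u v + braket u w :=
  dotProduct_add _ _ _

theorem braket_sub_right (u v w : ι → ℂ) : braket u (v - w) = braket u v - braket u w :=
  dotProduct_sub _ _ _

theorem braket_smul_right (c : ℂ) (u v : ι → ℂ) : braket u (c • v) = c * braket u v :=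
  dotProduct_smul _ _ _

theorem braket_sum_right (u : ι → ℂ) (v : κ → ι → ℂ) :
    braket u (∑ i, v i) = ∑ i, braket u (v i) :=
  dotProduct_sum _ _ _

theorem braket_zero_right (u : ι → ℂ) : braket u 0 = 0 := dotProduct_zero _

theorem braket_add_left (u v w : ι → ℂ) : braket (u + v) w = braket u w + braket v w := by
  simp [braket, add_dotProduct]

theorem braket_sub_left (u v w : ι → ℂ) : braket (u - v) w = braket u w - braket v w := by
  simp [braket, sub_dotProduct]

theorem braket_smul_left (c : ℂ) (u v : ι → ℂ) : braket (c • u) v = star c * braket u v := by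
  simp [braket, smul_dotProduct]

theorem braket_sum_left (u : κ → ι → ℂ) (v : ι → ℂ) :
    braket (∑ i, u i) v = ∑ i, braket (u i) v := by
  simp [braket, sum_dotProduct]

theorem star_braket (u v : ι → ℂ) : star (braket u v) = braket v u := by
  rw [braket, ← Matrix.star_dotProduct_star, star_star, braket, dotProduct_comm]

theorem braket_mul_comm_eq_norm_sq (u v : ι → ℂ) :
    braket u v * braket v u = ((‖braket v u‖ ^ 2 : ℝ) : ℂ) := by
  rw [← star_braket v u, Complex.star_def, Complex.conj_mul']
  push_cast; rfl

theorem norm_braket_comm (u v : ι → ℂ) : ‖braket u v‖ = ‖braket v u‖ := by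
  rw [← star_braket v u, norm_star]

theorem braket_mulVec (A : Matrix ι ι ℂ) (u v : ι → ℂ) :
    braket u (A *ᵥ v) = braket (Aᴴ *ᵥ u) v := by
  simp [braket, Matrix.star_mulVec, Matrix.dotProduct_mulVec]

theorem braket_self (v : ι → ℂ) : braket v v = ((∑ i, ‖v i‖ ^ 2 : ℝ) : ℂ) := by
  simp [braket, dotProduct, Complex.conj_mul']

theorem braket_cvec (u v : ι → ℝ) : braket (cvec u) (cvec v) = ((u ⬝ᵥ v : ℝ) : ℂ) := by
  simp [braket, dotProduct, cvec]

theorem braket_star_star (u v : ι → ℂ) : braket (star u) (star v) = star (braket u v) := by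
  simp [braket, dotProduct, mul_comm]

theorem star_cvec (v : ι → ℝ) : star (cvec v) = cvec v := by
  ext i; simp [cvec]

theorem braket_tensor (u u' : ι → ℂ) (v v' : κ → ℂ) :
    braket (tensor u v) (tensor u' v') = braket u u' * braket v v' := by
  simp only [braket, dotProduct, Pi.star_apply, tensor, Fintype.sum_prod_type, Finset.sum_mul_sum,
    star_mul']
  exact Finset.sum_congr rfl fun i _ => Finset.sum_congr rfl fun j _ => by ring

theorem ketbra_mulVec (u v : ι → ℂ) : ketbra u *ᵥ v = braket u v • u := by
  ext i
  simp [ketbra, Matrix.vecMulVec, Matrix.mulVec, braket, dotProduct, Finset.sum_mul]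
  exact Finset.sum_congr rfl fun j _ => by ring

theorem kronecker_mulVec_tensor (A : Matrix ι ι ℂ) (B : Matrix κ κ ℂ) (u : ι → ℂ) (v : κ → ℂ) :
    (A ⊗ₖ B) *ᵥ tensor u v = tensor (A *ᵥ u) (B *ᵥ v) := by
  ext ⟨i, j⟩
  simp only [Matrix.mulVec, dotProduct, Fintype.sum_prod_type, tensor, Finset.sum_mul_sum,
    Matrix.kroneckerMap_apply]
  exact Finset.sum_congr rfl fun i _ => Finset.sum_congr rfl fun j _ => by ring

theorem tensor_smul_right (c : ℂ) (u : ι → ℂ) (v : κ → ℂ) :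
    tensor u (c • v) = c • tensor u v := by
  ext ⟨i, j⟩; simp [tensor]; ring

theorem tensor_smul_left (c : ℂ) (u : ι → ℂ) (v : κ → ℂ) :
    tensor (c • u) v = c • tensor u v := by
  ext ⟨i, j⟩; simp [tensor]; ring

theorem tensor_sub_right (u : ι → ℂ) (v w : κ → ℂ) :
    tensor u (v - w) = tensor u v - tensor u w := by
  ext ⟨i, j⟩; simp [tensor]; ring

theorem tensor_add_left (u v : ι → ℂ) (w : κ → ℂ) :
    tensor (u + v) w = tensor u w + tensor v w := by
  ext ⟨i, j⟩; simp [tensor]; ring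

end Braket

/-- The `b i` are an orthonormal basis of eigenvectors of `W`, for the eigenvalues
`exp (i β i)` with `-π < β i ≤ π`. -/
structure IsEigenbasis {ι κ : Type*} [Fintype ι] [Fintype κ] [DecidableEq κ] (W : Matrix ι ι ℂ)
    (b : κ → ι → ℂ) (β : κ → ℝ) : Prop where
  ortho : ∀ i j, braket (b i) (b j) = if i = j then 1 else 0
  complete : ∀ u v, ∑ i, braket u (b i) * braket (b i) v = braket u v
  eig : ∀ i, W *ᵥ b i = Complex.exp (β i * Complex.I) • b i
  neg_pi_lt : ∀ i, -Real.pi < β i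
  le_pi : ∀ i, β i ≤ Real.pi

/-! ### Eigenbases of unitary matrices and spectral measures of vectors. -/

section Eigenbasis

variable {ι κ κ' : Type*} [Fintype ι] [DecidableEq ι] [Fintype κ] [DecidableEq κ]
  [Fintype κ'] [DecidableEq κ']

theorem braket_mulVec_mulVec_of_mem_unitaryGroup {W : Matrix ι ι ℂ}
    (hW : W ∈ Matrix.unitaryGroup ι ℂ) (u v : ι → ℂ) :
    braket (W *ᵥ u) (W *ᵥ v) = braket u v := by
  rw [braket_mulVec, Matrix.mulVec_mulVec, ← Matrix.star_eq_conjTranspose,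
    Matrix.mem_unitaryGroup_iff'.1 hW, Matrix.one_mulVec]

theorem inner_eq_braket (u v : EuclideanSpace ℂ ι) : inner ℂ u v = braket u.ofLp v.ofLp := by
  rw [EuclideanSpace.inner_eq_star_dotProduct, braket, dotProduct_comm]

/-- The orthogonal complement of an invariant subspace `p` is invariant: an isometry is injective,
so in finite dimension it maps `p` onto `p`, and inner products are preserved. -/
theorem isSemisimple_toEuclideanLin {W : Matrix ι ι ℂ} (hW : W ∈ Matrix.unitaryGroup ι ℂ) :
    Module.End.IsSemisimple (Matrix.toEuclideanLin W : Module.End ℂ (EuclideanSpace ℂ ι)) := by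
  set T : Module.End ℂ (EuclideanSpace ℂ ι) := Matrix.toEuclideanLin W with hT
  have hinner : ∀ u v, inner ℂ (T u) (T v) = inner ℂ u v := fun u v => by
    rw [inner_eq_braket, inner_eq_braket]
    exact braket_mulVec_mulVec_of_mem_unitaryGroup hW _ _
  have hinj : Function.Injective T := fun u v huv => by
    have : inner ℂ (u - v) (u - v) = (0 : ℂ) := by
      rw [← hinner, map_sub, huv, sub_self, inner_zero_left]
    exact sub_eq_zero.1 (inner_self_eq_zero.1 this)
  rw [Module.End.isSemisimple_iff]
  intro p hp
  refine ⟨pᗮ, ?_, Submodule.isCompl_orthogonal p⟩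
  intro x hx
  rw [Submodule.mem_comap, Submodule.mem_orthogonal]
  intro y hy
  have hmap : p.map T = p := by
    refine Submodule.eq_of_le_of_finrank_eq (Submodule.map_le_iff_le_comap.2 hp) ?_
    exact LinearEquiv.finrank_eq (Submodule.equivMapOfInjective T hinj p).symm
  rw [← hmap] at hy
  obtain ⟨z, hz, rfl⟩ := hy
  rw [hinner]
  exact (Submodule.mem_orthogonal _ _).1 hx z hz

theorem norm_eq_one_of_hasEigenvector {W : Matrix ι ι ℂ} (hW : W ∈ Matrix.unitaryGroup ι ℂ)
    {v : ι → ℂ} {z : ℂ} (hv : braket v v = 1) (h : W *ᵥ v = z • v) : ‖z‖ = 1 := by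
  have h1 := braket_mulVec_mulVec_of_mem_unitaryGroup hW v v
  rw [h, braket_smul_left, braket_smul_right, hv, mul_one, Complex.star_def,
    Complex.conj_mul'] at h1
  have h2 : ‖z‖ ^ 2 = 1 := by exact_mod_cast h1
  nlinarith [norm_nonneg z]

theorem orthogonalFamily_eigenspaces_of_mem_unitaryGroup {W : Matrix ι ι ℂ}
    (hW : W ∈ Matrix.unitaryGroup ι ℂ) :
    OrthogonalFamily ℂ
      (fun z : Module.End.Eigenvalues (Matrix.toEuclideanLin W : Module.End ℂ _) =>
        Module.End.eigenspace (Matrix.toEuclideanLin W) (z : ℂ))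
      fun z => (Module.End.eigenspace (Matrix.toEuclideanLin W) (z : ℂ)).subtypeₗᵢ := by
  rintro z z' hzz' ⟨u, hu⟩ ⟨v, hv⟩
  have hz : ‖(z : ℂ)‖ = 1 := by
    obtain ⟨w, hw⟩ := Module.End.HasEigenvalue.exists_hasEigenvector z.2
    have hw1 := hw.apply_eq_smul
    have h1 := braket_mulVec_mulVec_of_mem_unitaryGroup hW w.ofLp w.ofLp
    have h2 : W *ᵥ w.ofLp = (z : ℂ) • w.ofLp := congrArg WithLp.ofLp hw1
    rw [h2, braket_smul_left, braket_smul_right, ← inner_eq_braket, ← mul_assoc, Complex.star_def,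
      Complex.conj_mul'] at h1
    have h3 : inner ℂ w w ≠ (0 : ℂ) := fun h => hw.2 (inner_self_eq_zero.1 h)
    have h4 : (‖(z : ℂ)‖ : ℂ) ^ 2 = 1 := mul_right_cancel₀ h3 (by rw [h1, one_mul])
    have h5 : ‖(z : ℂ)‖ ^ 2 = 1 := by exact_mod_cast h4
    nlinarith [norm_nonneg (z : ℂ)]
  rw [Module.End.mem_eigenspace_iff] at hu hv
  have hu' : W *ᵥ u.ofLp = (z : ℂ) • u.ofLp := congrArg WithLp.ofLp hu
  have hv' : W *ᵥ v.ofLp = (z' : ℂ) • v.ofLp := congrArg WithLp.ofLp hv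
  have h1 := braket_mulVec_mulVec_of_mem_unitaryGroup hW u.ofLp v.ofLp
  rw [hu', hv', braket_smul_left, braket_smul_right] at h1
  change inner ℂ u v = 0
  rw [inner_eq_braket]
  by_contra h0
  have h2 : star (z : ℂ) * z' = 1 := mul_right_cancel₀ h0 (by rw [mul_assoc, h1, one_mul])
  apply hzz'
  apply Subtype.ext
  change (z : ℂ) = z'
  have h3 : (z : ℂ) * star (z : ℂ) = 1 := by
    rw [Complex.star_def, Complex.mul_conj', hz]; simp
  calc (z : ℂ) = z * (star (z : ℂ) * z') := by rw [h2, mul_one]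
    _ = z' := by rw [← mul_assoc, h3, one_mul]

/-- The eigenspaces are pairwise orthogonal and, by semisimplicity, span the space. Orthonormal
bases of them are put together, and `Complex.arg` of the eigenvalues provides the phases. -/
theorem exists_isEigenbasis {W : Matrix ι ι ℂ} (hW : W ∈ Matrix.unitaryGroup ι ℂ) :
    ∃ (b : Fin (Fintype.card ι) → ι → ℂ) (β : Fin (Fintype.card ι) → ℝ), IsEigenbasis W b β := by
  classical
  have hO := orthogonalFamily_eigenspaces_of_mem_unitaryGroup hW
  have hss := isSemisimple_toEuclideanLin hW
  set T : Module.End ℂ (EuclideanSpace ℂ ι) := Matrix.toEuclideanLin W with hT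
  have hint : DirectSum.IsInternal
      fun z : Module.End.Eigenvalues T => Module.End.eigenspace T (z : ℂ) := by
    refine hO.isInternal_iff.2 ?_
    have htop : ⨆ z : Module.End.Eigenvalues T, Module.End.eigenspace T (z : ℂ) = ⊤ := by
      rw [eq_top_iff, ← hss.iSup_eigenspace_eq_top]
      refine iSup_le fun z => ?_
      by_cases hz : Module.End.eigenspace T z = ⊥
      · rw [hz]; exact bot_le
      · exact le_iSup (fun z : Module.End.Eigenvalues T => Module.End.eigenspace T (z : ℂ))
          ⟨z, hz⟩
    rw [htop, Submodule.top_orthogonal_eq_bot]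
  have hn : Module.finrank ℂ (EuclideanSpace ℂ ι) = Fintype.card ι := by simp
  set B := hint.subordinateOrthonormalBasis hn hO with hB
  set e : Fin (Fintype.card ι) → Module.End.Eigenvalues T :=
    fun i => hint.subordinateOrthonormalBasisIndex hn i hO
  set z : Fin (Fintype.card ι) → ℂ := fun i => (e i : ℂ)
  have heig : ∀ i, W *ᵥ (B i).ofLp = z i • (B i).ofLp := fun i =>
    congrArg WithLp.ofLp
      (Module.End.mem_eigenspace_iff.1 (hint.subordinateOrthonormalBasis_subordinate hn i hO))
  have hortho : ∀ i j, braket (B i).ofLp (B j).ofLp = if i = j then 1 else 0 := fun i j => by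
    rw [← inner_eq_braket]
    exact orthonormal_iff_ite.1 B.orthonormal i j
  refine ⟨fun i => (B i).ofLp, fun i => (z i).arg, hortho, fun u v => ?_, fun i => ?_,
    fun i => Complex.neg_pi_lt_arg _, fun i => Complex.arg_le_pi _⟩
  · have := B.sum_inner_mul_inner (WithLp.toLp 2 u) (WithLp.toLp 2 v)
    simpa only [inner_eq_braket] using this
  · rw [heig]
    have h1 : ‖z i‖ = 1 := norm_eq_one_of_hasEigenvector hW (by simp [hortho]) (heig i)
    congr 1
    have := Complex.norm_mul_exp_arg_mul_I (z i)
    rw [h1] at this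
    simpa using this.symm

namespace IsEigenbasis

variable {W : Matrix ι ι ℂ} {b : κ → ι → ℂ} {β : κ → ℝ}

theorem sum_smul (h : IsEigenbasis W b β) (v : ι → ℂ) : ∑ i, braket (b i) v • b i = v := by
  ext j
  have h1 := h.complete (ket j) v
  have h2 : ∀ w : ι → ℂ, braket (ket j) w = w j := fun w => by simp [braket, ket]
  simp only [h2] at h1
  rw [← h1, Finset.sum_apply]
  exact Finset.sum_congr rfl fun i _ => by simp [mul_comm]

theorem sum_norm_sq (h : IsEigenbasis W b β) (v : ι → ℂ) :
    ((∑ i, ‖braket (b i) v‖ ^ 2 : ℝ) : ℂ) = braket v v := by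
  rw [← h.complete v v]
  push_cast
  exact Finset.sum_congr rfl fun i _ => by rw [braket_mul_comm_eq_norm_sq]; push_cast; rfl

theorem exp_inj (h : IsEigenbasis W b β) {b' : κ' → ι → ℂ} {β' : κ' → ℝ}
    (h' : IsEigenbasis W b' β') {i : κ} {j : κ'}
    (hij : Complex.exp (β i * Complex.I) = Complex.exp (β' j * Complex.I)) : β i = β' j := by
  have h1 : Complex.arg (Complex.exp (β i * Complex.I)) = β i :=
    Complex.arg_exp_mul_I (β i) ▸ (toIocMod_eq_self _).2
      ⟨h.neg_pi_lt i, by linarith [h.le_pi i]⟩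
  have h2 : Complex.arg (Complex.exp (β' j * Complex.I)) = β' j :=
    Complex.arg_exp_mul_I (β' j) ▸ (toIocMod_eq_self _).2
      ⟨h'.neg_pi_lt j, by linarith [h'.le_pi j]⟩
  rw [← h1, ← h2, hij]

end IsEigenbasis

theorem star_exp_mul_I (x : ℝ) :
    star (Complex.exp (x * Complex.I)) * Complex.exp (x * Complex.I) = 1 := by
  rw [Complex.star_def, Complex.conj_mul', Complex.norm_exp_ofReal_mul_I]; simp

/-- Eigenvectors of a unitary matrix for different eigenvalues are orthogonal. -/
theorem braket_eq_zero_of_eig {W : Matrix ι ι ℂ} (hW : W ∈ Matrix.unitaryGroup ι ℂ)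
    {u v : ι → ℂ} {x y : ℝ} (hu : W *ᵥ u = Complex.exp (x * Complex.I) • u)
    (hv : W *ᵥ v = Complex.exp (y * Complex.I) • v)
    (hxy : Complex.exp (x * Complex.I) ≠ Complex.exp (y * Complex.I)) : braket u v = 0 := by
  have h1 := braket_mulVec_mulVec_of_mem_unitaryGroup hW u v
  rw [hu, hv, braket_smul_left, braket_smul_right] at h1
  by_contra h0
  have h2 : star (Complex.exp (x * Complex.I)) * Complex.exp (y * Complex.I) = 1 :=
    mul_right_cancel₀ h0 (by rw [mul_assoc, h1, one_mul])
  apply hxy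
  have h3 := star_exp_mul_I x
  have h4 : star (Complex.exp (x * Complex.I)) ≠ 0 := left_ne_zero_of_mul_eq_one h3
  exact mul_left_cancel₀ h4 (h3.trans h2.symm)

namespace IsEigenbasis

variable {W : Matrix ι ι ℂ} {b : κ → ι → ℂ} {β : κ → ℝ}

/-- The spectral measure of `m` does not depend on the eigenbasis. Both resolutions of the identity
are inserted; since `⟨b i|b' j⟩` vanishes unless the phases agree, `f (β i)` may be replaced by `f
(β' j)` in each term. -/
theorem sum_weight_eq (hW : W ∈ Matrix.unitaryGroup ι ℂ) (h : IsEigenbasis W b β)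
    {b' : κ' → ι → ℂ} {β' : κ' → ℝ} (h' : IsEigenbasis W b' β') (m : ι → ℂ) (f : ℝ → ℝ) :
    ∑ i, ‖braket (b i) m‖ ^ 2 * f (β i) = ∑ j, ‖braket (b' j) m‖ ^ 2 * f (β' j) := by
  have key : ∀ i j, braket m (b i) * braket (b i) (b' j) * braket (b' j) m * (f (β i) : ℂ)
      = braket m (b i) * braket (b i) (b' j) * braket (b' j) m * (f (β' j) : ℂ) := fun i j => by
    by_cases hij : Complex.exp (β i * Complex.I) = Complex.exp (β' j * Complex.I)
    · rw [h.exp_inj h' hij]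
    · rw [braket_eq_zero_of_eig hW (h.eig i) (h'.eig j) hij]; ring
  have h1 : ((∑ i, ‖braket (b i) m‖ ^ 2 * f (β i) : ℝ) : ℂ)
      = ∑ i, ∑ j, braket m (b i) * braket (b i) (b' j) * braket (b' j) m * (f (β i) : ℂ) := by
    push_cast
    refine Finset.sum_congr rfl fun i _ => ?_
    rw [← Finset.sum_mul]
    congr 1
    simp_rw [mul_assoc]
    rw [← Finset.mul_sum, h'.complete, braket_mul_comm_eq_norm_sq]
    push_cast; rfl
  have h2 : ((∑ j, ‖braket (b' j) m‖ ^ 2 * f (β' j) : ℝ) : ℂ)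
      = ∑ i, ∑ j, braket m (b i) * braket (b i) (b' j) * braket (b' j) m * (f (β' j) : ℂ) := by
    rw [Finset.sum_comm]
    push_cast
    refine Finset.sum_congr rfl fun j _ => ?_
    rw [← Finset.sum_mul, ← Finset.sum_mul, h.complete, braket_mul_comm_eq_norm_sq]
    push_cast; rfl
  have h3 : ((∑ i, ‖braket (b i) m‖ ^ 2 * f (β i) : ℝ) : ℂ)
      = ((∑ j, ‖braket (b' j) m‖ ^ 2 * f (β' j) : ℝ) : ℂ) := by
    rw [h1, h2]
    exact Finset.sum_congr rfl fun i _ => Finset.sum_congr rfl fun j _ => key i j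
  exact_mod_cast h3

/-- For a real unitary matrix, the spectral measure of a real vector is invariant under complex
conjugation. -/
theorem sum_weight_neg (hW : W ∈ Matrix.unitaryGroup ι ℂ) (hreal : W.map star = W)
    (h : IsEigenbasis W b β) {m : ι → ℂ} (hm : star m = m)
    (f : ℝ → ℝ) (hpi : ∀ i, braket (b i) m ≠ 0 → β i = Real.pi → f (-Real.pi) = f Real.pi) :
    ∑ i, ‖braket (b i) m‖ ^ 2 * f (-β i) = ∑ i, ‖braket (b i) m‖ ^ 2 * f (β i) := by
  -- Conjugation negates the phase of an eigenvector of a real matrix. The phase `π` stays put,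
  -- because phases are taken in `(-π, π]`; this is what `hpi` accounts for.
  have hstar : IsEigenbasis W (fun i => star (b i))
      (fun i => if β i = Real.pi then Real.pi else -β i) := by
    refine ⟨fun i j => ?_, fun u v => ?_, fun i => ?_, fun i => ?_, fun i => ?_⟩
    · rw [braket_star_star, h.ortho]; split_ifs <;> simp
    · have := congrArg star (h.complete (star u) (star v))
      rw [star_sum, braket_star_star, star_star] at this
      rw [← this]
      refine Finset.sum_congr rfl fun i _ => ?_
      rw [star_mul', ← braket_star_star, ← braket_star_star, star_star, star_star]
    · have h1 := congrArg star (h.eig i)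
      have h2 : star (W *ᵥ b i) = W *ᵥ star (b i) := by
        nth_rewrite 2 [← hreal]
        ext j
        simp [Matrix.mulVec, dotProduct]
      rw [← h2, h1, star_smul]
      congr 1
      rw [Complex.star_def, ← Complex.exp_conj]
      split_ifs with hp
      · simp [hp, Complex.exp_neg]
      · simp
    · split_ifs with hp
      · linarith [Real.pi_pos]
      · have := lt_of_le_of_ne (h.le_pi i) hp
        linarith
    · split_ifs with hp
      · exact le_rfl
      · linarith [h.neg_pi_lt i]
  rw [h.sum_weight_eq hW hstar m f]
  refine Finset.sum_congr rfl fun i _ => ?_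
  have hb : ‖braket (star (b i)) m‖ = ‖braket (b i) m‖ := by
    conv_lhs => rw [← hm, braket_star_star, norm_star]
  rw [hb]
  by_cases h0 : braket (b i) m = 0
  · simp [h0]
  · by_cases hp : β i = Real.pi
    · rw [if_pos hp, hp, hpi i h0 hp]
    · rw [if_neg hp]

end IsEigenbasis

end Eigenbasis

/-! ### Phase estimation, majority vote and the matrix elements of `Rotate`. -/

section PhaseEstimation

variable {n : Type*} [Fintype n] [DecidableEq n]

/-- The state of the register after phase estimation of an eigenvector of phase `β`. -/
noncomputable def phaseState (t : ℕ) (β : ℝ) : Fin (2 ^ t) → ℂ :=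
  (fourier t)ᴴ *ᵥ fun x => Complex.exp (β * Complex.I) ^ (x : ℕ) / (Real.sqrt ((2 ^ t : ℕ) : ℝ) : ℂ)

theorem fourier_mulVec_ket_zero (t : ℕ) :
    fourier t *ᵥ ket 0 = fun _ => 1 / (Real.sqrt ((2 ^ t : ℕ) : ℝ) : ℂ) := by
  ext x
  simp [ket, fourier]

theorem sqrt_two_pow_mul_self (t : ℕ) :
    (Real.sqrt ((2 ^ t : ℕ) : ℝ) : ℂ) * (Real.sqrt ((2 ^ t : ℕ) : ℝ) : ℂ) = (2 ^ t : ℕ) := by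
  rw [← Complex.ofReal_mul, Real.mul_self_sqrt (Nat.cast_nonneg _), Complex.ofReal_natCast]

/-- The product of two rows is a geometric sum of a `2 ^ t`-th root of unity, which vanishes when
the rows differ because `|x - x'| < 2 ^ t` keeps the root from being `1`. -/
theorem fourier_mem_unitaryGroup (t : ℕ) : fourier t ∈ Matrix.unitaryGroup (Fin (2 ^ t)) ℂ := by
  rw [Matrix.mem_unitaryGroup_iff]
  ext x x'
  have hN : ((2 ^ t : ℕ) : ℂ) ≠ 0 := by exact_mod_cast (pow_pos two_pos t).ne'
  set ω : ℂ := Complex.exp (2 * Real.pi * Complex.I * (((x : ℕ) : ℂ) - (x' : ℕ)) / (2 ^ t : ℕ))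
    with hω
  have h1 : ∀ y : Fin (2 ^ t), fourier t x y * star (fourier t x' y)
      = ω ^ (y : ℕ) / (2 ^ t : ℕ) := fun y => by
    rw [fourier, Matrix.of_apply, Matrix.of_apply, star_div₀, div_mul_div_comm, Complex.star_def,
      Complex.conj_ofReal, sqrt_two_pow_mul_self, ← Complex.exp_conj,
      ← Complex.exp_add, hω, ← Complex.exp_nat_mul]
    congr 2
    simp only [map_div₀, map_mul, Complex.conj_I, Complex.conj_ofReal, map_natCast, map_ofNat]
    field_simp
    ring
  rw [Matrix.mul_apply]
  simp only [Matrix.star_apply, h1]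
  rw [← Finset.sum_div, Fin.sum_univ_eq_sum_range (fun y => ω ^ y)]
  by_cases hxx : x = x'
  · rw [hxx] at hω
    rw [hxx, Matrix.one_apply_eq, hω, sub_self, mul_zero, zero_div, Complex.exp_zero]
    simp
  · rw [Matrix.one_apply_ne hxx]
    have h2 : ω ≠ 1 := by
      rw [hω, Ne, Complex.exp_eq_one_iff]
      rintro ⟨k, hk⟩
      have h3 : (((x : ℕ) : ℂ) - (x' : ℕ)) = k * (2 ^ t : ℕ) := by
        have h2pi : (2 * Real.pi * Complex.I : ℂ) ≠ 0 := Complex.two_pi_I_ne_zero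
        rw [div_eq_iff hN] at hk
        apply mul_left_cancel₀ h2pi
        linear_combination hk
      have h4 : ((x : ℕ) : ℤ) - (x' : ℕ) = k * (2 ^ t : ℕ) := by exact_mod_cast h3
      have hx := x.2
      have hx' := x'.2
      have hk0 : k = 0 := by
        by_contra hk0
        have : (1 : ℤ) ≤ |k| := Int.one_le_abs hk0
        have h5 : |((x : ℕ) : ℤ) - (x' : ℕ)| = |k| * (2 ^ t : ℕ) := by
          rw [h4, abs_mul, Nat.abs_cast]
        have h6 : |((x : ℕ) : ℤ) - (x' : ℕ)| < (2 ^ t : ℕ) := by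
          rw [abs_lt]; constructor <;> omega
        nlinarith
      apply hxx
      apply Fin.ext
      rw [hk0, zero_mul] at h4
      omega
    have h3 : ω ^ (2 ^ t) = 1 := by
      rw [hω, ← Complex.exp_nat_mul, Complex.exp_eq_one_iff]
      exact ⟨((x : ℕ) : ℤ) - (x' : ℕ), by push_cast; push_cast at hN; field_simp⟩
    rw [geom_sum_eq h2, h3]; simp

theorem braket_phaseState_self (t : ℕ) (β : ℝ) :
    braket (phaseState t β) (phaseState t β) = 1 := by
  have h : (fourier t)ᴴ ∈ Matrix.unitaryGroup (Fin (2 ^ t)) ℂ :=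
    Unitary.star_mem (fourier_mem_unitaryGroup t)
  rw [phaseState, braket_mulVec_mulVec_of_mem_unitaryGroup h, braket_self]
  have : ∀ x : Fin (2 ^ t), ‖Complex.exp (β * Complex.I) ^ (x : ℕ)
      / (Real.sqrt ((2 ^ t : ℕ) : ℝ) : ℂ)‖ ^ 2 = 1 / (2 ^ t : ℕ) := fun x => by
    rw [norm_div, norm_pow, Complex.norm_exp_ofReal_mul_I, one_pow, Complex.norm_real, div_pow,
      Real.norm_eq_abs, sq_abs, Real.sq_sqrt (Nat.cast_nonneg _), one_pow]
  simp only [this]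
  simp

theorem pow_mulVec_of_eig {W : Matrix n n ℂ} {w : n → ℂ} {z : ℂ} (h : W *ᵥ w = z • w) (k : ℕ) :
    (W ^ k) *ᵥ w = z ^ k • w := by
  induction k with
  | zero => simp
  | succ k ih => rw [pow_succ, ← Matrix.mulVec_mulVec, h, Matrix.mulVec_smul, ih, smul_smul,
      pow_succ, mul_comm]

theorem controlledPower_mulVec_tensor {W : Matrix n n ℂ} {w : n → ℂ} {z : ℂ} (h : W *ᵥ w = z • w)
    (t : ℕ) (g : Fin (2 ^ t) → ℂ) :
    controlledPower W t *ᵥ tensor w g = tensor w fun x : Fin (2 ^ t) => z ^ (x : ℕ) * g x := by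
  ext ⟨i, x⟩
  have h1 := congrFun (pow_mulVec_of_eig h x) i
  simp only [Matrix.mulVec, dotProduct, Pi.smul_apply, smul_eq_mul] at h1
  simp only [Matrix.mulVec, dotProduct, controlledPower, Matrix.of_apply, tensor,
    Fintype.sum_prod_type, ite_mul, zero_mul, Finset.sum_ite_eq, Finset.mem_univ, if_true]
  simp_rw [← mul_assoc]
  rw [← Finset.sum_mul, h1]
  ring

theorem estimate_mulVec_tensor {W : Matrix n n ℂ} {w : n → ℂ} {β : ℝ}
    (h : W *ᵥ w = Complex.exp (β * Complex.I) • w) (t : ℕ) :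
    estimate W t *ᵥ tensor w (ket 0) = tensor w (phaseState t β) := by
  rw [estimate, ← Matrix.mulVec_mulVec, ← Matrix.mulVec_mulVec, kronecker_mulVec_tensor,
    fourier_mulVec_ket_zero, Matrix.one_mulVec, controlledPower_mulVec_tensor h,
    kronecker_mulVec_tensor, Matrix.one_mulVec, phaseState]
  congr 2
  ext x
  ring

theorem onRegister_mulVec_tensor {R : Type*} [Fintype R] [DecidableEq R] {K : ℕ} (j : Fin K)
    {A : Matrix (n × R) (n × R) ℂ} {w : n → ℂ} (g : Fin K → R → ℂ) {g' : R → ℂ}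
    (h : A *ᵥ tensor w (g j) = tensor w g') :
    onRegister j A *ᵥ tensor w (fun v => ∏ l, g l (v l))
      = tensor w (fun v => ∏ l, Function.update g j g' l (v l)) := by
  ext ⟨i, v⟩
  have h1 := congrFun h (i, v j)
  simp only [Matrix.mulVec, dotProduct, tensor, Fintype.sum_prod_type] at h1
  simp only [Matrix.mulVec, dotProduct, tensor, Fintype.sum_prod_type, onRegister, Matrix.of_apply]
  have h2 : ∏ l, Function.update g j g' l (v l) = g' (v j) * ∏ l ∈ {j}ᶜ, g l (v l) := by
    rw [Fintype.prod_eq_mul_prod_compl j, Function.update_self]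
    congr 1
    refine Finset.prod_congr rfl fun l hl => ?_
    rw [Function.update_of_ne (by simpa using hl)]
  rw [h2, ← mul_assoc, ← h1, Finset.sum_mul]
  refine Finset.sum_congr rfl fun i' _ => ?_
  rw [Finset.sum_mul]
  symm
  -- Only the register states that agree with `v` away from `j` contribute; they are parametrized by
  -- their `j`-th entry.
  refine Fintype.sum_of_injective (fun r => Function.update v j r)
    (Function.update_injective v j) _ _ ?_ ?_
  · intro v' hv'
    rw [if_neg, zero_mul]
    intro hall
    apply hv'
    refine ⟨v' j, ?_⟩
    ext1 l
    by_cases hl : l = j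
    · subst hl; simp
    · simp only [Function.update_of_ne hl, hall l hl]
  · intro r
    rw [if_pos fun l hl => (Function.update_of_ne hl _ _).symm, Function.update_self,
      Fintype.prod_eq_mul_prod_compl j, Function.update_self]
    have : ∏ l ∈ {j}ᶜ, g l (Function.update v j r l) = ∏ l ∈ {j}ᶜ, g l (v l) :=
      Finset.prod_congr rfl fun l hl => by rw [Function.update_of_ne (by simpa using hl)]
    rw [this]
    ring

theorem ket_const_zero_eq_prod (t K : ℕ) :
    (ket (fun _ => 0) : (Fin K → Fin (2 ^ t)) → ℂ) = fun v => ∏ l, ket 0 (v l) := by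
  ext v
  simp only [ket, Pi.single_apply]
  rw [Finset.prod_ite_zero]
  simp [funext_iff]

theorem estimates_mulVec_withRegisters {W : Matrix n n ℂ} {w : n → ℂ} {β : ℝ}
    (h : W *ᵥ w = Complex.exp (β * Complex.I) • w) (t K : ℕ) :
    estimates W t K *ᵥ withRegisters w = tensor w fun v => ∏ l, phaseState t β (v l) := by
  -- The induction runs over duplicate-free lists of registers, so that each register is still in
  -- the state `|0⟩` when its own estimation is applied.
  have key : ∀ l : List (Fin K), l.Nodup →
      (l.map fun j => onRegister j (estimate W t)).prod *ᵥ withRegisters w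
        = tensor w fun v => ∏ i, (if i ∈ l then phaseState t β else ket 0) (v i) := by
    intro l hl
    induction l with
    | nil => simp [withRegisters, ket_const_zero_eq_prod]
    | cons j l ih =>
      rw [List.nodup_cons] at hl
      rw [List.map_cons, List.prod_cons, ← Matrix.mulVec_mulVec, ih hl.2,
        onRegister_mulVec_tensor j (fun i => if i ∈ l then phaseState t β else ket 0)
          (g' := phaseState t β) (by rw [if_neg hl.1]; exact estimate_mulVec_tensor h t)]
      congr 1
      ext v
      refine Finset.prod_congr rfl fun i _ => ?_
      by_cases hij : i = j
      · subst hij; simp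
      · rw [Function.update_of_ne hij]; simp [hij]
  have := key (List.finRange K) (List.nodup_finRange K)
  rw [estimates, List.ofFn_eq_map, this]
  simp

/-- `binomTail p K J` is the probability of at least `J` successes in `K` independent trials of
success probability `p`. -/
noncomputable def binomTail (p : ℝ) : ℕ → ℕ → ℝ
  | _, 0 => 1
  | 0, _ + 1 => 0
  | K + 1, J + 1 => p * binomTail p K J + (1 - p) * binomTail p K (J + 1)

/-- Splitting off the first trial reproduces the recursion of `binomTail`. -/
theorem sum_prod_count_eq_binomTail {R : Type*} [Fintype R] (P : R → ℝ) (hP : ∑ r, P r = 1)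
    (S : R → Prop) [DecidablePred S] (K J : ℕ) :
    ∑ v : Fin K → R, (∏ j, P (v j)) * (if J ≤ ∑ j, (if S (v j) then 1 else 0) then 1 else 0)
      = binomTail (∑ r with S r, P r) K J := by
  induction K generalizing J with
  | zero => cases J <;> simp [binomTail]
  | succ K ih =>
    rw [← (Fin.consEquiv fun _ => R).sum_comp, Fintype.sum_prod_type]
    simp only [Fin.consEquiv, Equiv.coe_fn_mk, Fin.prod_univ_succ, Fin.sum_univ_succ, Fin.cons_zero,
      Fin.cons_succ]
    have hnS : ∑ r with ¬ S r, P r = 1 - ∑ r with S r, P r := by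
      rw [← hP, ← Finset.sum_filter_add_sum_filter_not Finset.univ S]; ring
    cases J with
    | zero =>
      have := ih 0
      simp only [Nat.zero_le, if_true, mul_one, binomTail] at this ⊢
      simp_rw [← Finset.mul_sum, this]
      simpa using hP
    | succ J =>
      rw [binomTail, ← Finset.sum_filter_add_sum_filter_not Finset.univ S, ← hnS, Finset.sum_mul,
        Finset.sum_mul]
      congr 1
      · refine Finset.sum_congr rfl fun r hr => ?_
        rw [← ih J, Finset.mul_sum]
        refine Finset.sum_congr rfl fun v _ => ?_
        simp only [if_pos (Finset.mem_filter.1 hr).2, add_comm 1, Nat.add_le_add_iff_right,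
          mul_assoc]
      · refine Finset.sum_congr rfl fun r hr => ?_
        rw [← ih (J + 1), Finset.mul_sum]
        refine Finset.sum_congr rfl fun v _ => ?_
        rw [if_neg (Finset.mem_filter.1 hr).2, zero_add, mul_assoc]

theorem binomTail_succ_le (p : ℝ) (hp0 : 0 ≤ p) (hp1 : p ≤ 1) (K J : ℕ) :
    0 ≤ binomTail p K J ∧ binomTail p K J ≤ 1 ∧ binomTail p K (J + 1) ≤ binomTail p K J := by
  induction K generalizing J with
  | zero => cases J <;> simp [binomTail]
  | succ K ih =>
    have key : ∀ J, binomTail p (K + 1) (J + 1) ≤ binomTail p K J := fun J => by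
      rw [binomTail]; nlinarith [(ih J).2.2]
    have key2 : ∀ J, binomTail p K J ≤ binomTail p (K + 1) J := fun J => by
      cases J with
      | zero => simp [binomTail]
      | succ J => rw [binomTail]; nlinarith [(ih J).2.2]
    refine ⟨(ih J).1.trans (key2 J), ?_, (key J).trans (key2 J)⟩
    cases J with
    | zero => simp [binomTail]
    | succ J => exact (key J).trans (ih J).2.1

theorem binomTail_mono {p p' : ℝ} (hp0 : 0 ≤ p) (hpp : p ≤ p') (hp1 : p' ≤ 1) (K J : ℕ) :
    binomTail p K J ≤ binomTail p' K J := by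
  induction K generalizing J with
  | zero => cases J <;> simp [binomTail]
  | succ K ih =>
    cases J with
    | zero => simp [binomTail]
    | succ J =>
      rw [binomTail, binomTail]
      have h1 := (binomTail_succ_le p hp0 (hpp.trans hp1) K J).2.2
      have h2 := ih J
      have h3 := ih (J + 1)
      have h4 : p' * binomTail p K J + (1 - p') * binomTail p K (J + 1)
          ≤ p' * binomTail p' K J + (1 - p') * binomTail p' K (J + 1) :=
        add_le_add (mul_le_mul_of_nonneg_left h2 (hp0.trans hpp))
          (mul_le_mul_of_nonneg_left h3 (by linarith))
      nlinarith

/-- Markov's inequality for the number of successes, whose mean is `K p`. -/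
theorem mul_binomTail_le {p : ℝ} (hp0 : 0 ≤ p) (hp1 : p ≤ 1) (K J : ℕ) :
    J * binomTail p K J ≤ K * p := by
  induction K generalizing J with
  | zero => cases J <;> simp [binomTail]
  | succ K ih =>
    cases J with
    | zero => simp only [Nat.cast_zero, zero_mul]; positivity
    | succ J =>
      rw [binomTail]
      have h1 := ih J
      have h2 := ih (J + 1)
      have h3 := (binomTail_succ_le p hp0 hp1 K J).2.1
      push_cast at h2 ⊢
      have h4 : (1 - p) * ((J + 1) * binomTail p K (J + 1)) ≤ (1 - p) * (K * p) :=
        mul_le_mul_of_nonneg_left h2 (by linarith)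
      have h5 : p * (J * binomTail p K J + binomTail p K J) ≤ p * (K * p + 1) :=
        mul_le_mul_of_nonneg_left (by linarith) hp0
      nlinarith

/-- Markov's inequality for the number of failures: fewer than `J` successes means at least `K + 1 -
J` failures, and their mean is `K (1 - p)`. -/
theorem mul_one_sub_binomTail_le {p : ℝ} (hp0 : 0 ≤ p) (hp1 : p ≤ 1) (K J : ℕ) (hJ : J ≤ K + 1) :
    (K + 1 - J) * (1 - binomTail p K J) ≤ K * (1 - p) := by
  induction K generalizing J with
  | zero =>
    cases J with
    | zero => simp [binomTail]
    | succ J =>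
      have : J = 0 := by omega
      subst this; simp [binomTail]
  | succ K ih =>
    cases J with
    | zero => 
      simp only [binomTail, sub_self, mul_zero]
      have : 0 ≤ 1 - p := by linarith
      positivity
    | succ J =>
      rw [binomTail]
      have h1 := ih J (by omega)
      have h3 := (binomTail_succ_le p hp0 hp1 K (J + 1)).1
      have h4 : p * ((K + 1 - J) * (1 - binomTail p K J)) ≤ p * (K * (1 - p)) :=
        mul_le_mul_of_nonneg_left h1 hp0
      have h6 : (K - J : ℝ) * (1 - binomTail p K (J + 1)) ≤ K * (1 - p) := by
        rcases Nat.lt_or_ge K J with hKJ | hKJ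
        · have : (K : ℝ) + 1 ≤ J := by exact_mod_cast hKJ
          have h7 := (binomTail_succ_le p hp0 hp1 K (J + 1)).2.1
          have h8 : 0 ≤ (K : ℝ) * (1 - p) := mul_nonneg (Nat.cast_nonneg _) (by linarith)
          nlinarith
        · have := ih (J + 1) (by omega)
          push_cast at this
          convert this using 2; ring
      have h5 : (1 - p) * ((K - J + 1) * (1 - binomTail p K (J + 1)))
          ≤ (1 - p) * (K * (1 - p) + 1) :=
        mul_le_mul_of_nonneg_left (by linarith) (by linarith)
      push_cast
      nlinarith

/-- The probability that phase estimation of an eigenvector of phase `β` yields a negative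
estimate. -/
noncomputable def negProb (t : ℕ) (β : ℝ) : ℝ :=
  ∑ k ∈ Finset.univ.filter fun k : Fin (2 ^ t) => 2 ^ t < 2 * (k : ℕ), ‖phaseState t β k‖ ^ 2

/-- The probability that more than half of `K` phase estimates are negative. -/
noncomputable def flipProb (t K : ℕ) (β : ℝ) : ℝ := binomTail (negProb t β) K (K / 2 + 1)

theorem estimatedPhase_neg_iff (t : ℕ) (k : Fin (2 ^ t)) :
    estimatedPhase t k < 0 ↔ 2 ^ t < 2 * (k : ℕ) := by
  rw [estimatedPhase]
  have hpi := Real.pi_pos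
  split_ifs with h
  · refine ⟨fun h1 => absurd h1 (not_lt.2 (by positivity)), fun h1 => by omega⟩
  · refine ⟨fun _ => not_le.1 h, fun _ => ?_⟩
    have hk : ((k : ℕ) : ℝ) < 2 ^ t := by exact_mod_cast k.2
    have hN : (0 : ℝ) < 2 ^ t := by positivity
    rw [sub_neg, div_lt_iff₀ hN]
    exact mul_lt_mul_of_pos_left hk (by positivity)

theorem sum_norm_phaseState (t : ℕ) (β : ℝ) : ∑ k, ‖phaseState t β k‖ ^ 2 = 1 := by
  have := braket_phaseState_self t β
  rw [braket_self] at this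
  exact_mod_cast this

/-- The flip is diagonal with entries `±1`, and the squared amplitudes of the registers form a
product measure. The matrix element is therefore the probability of no flip minus that of a flip. -/
theorem braket_majorityFlip (t K : ℕ) (β : ℝ) (w w' : n → ℂ) :
    braket (tensor w' fun v => ∏ l, phaseState t β (v l))
        (majorityFlip n t K *ᵥ tensor w fun v => ∏ l, phaseState t β (v l))
      = braket w' w * ((1 - 2 * flipProb t K β : ℝ) : ℂ) := by
  have hcount : ∀ v : Fin K → Fin (2 ^ t),
      Set.ncard {j : Fin K | estimatedPhase t (v j) < 0}
        = ∑ j, (if 2 ^ t < 2 * (v j : ℕ) then 1 else 0) := fun v => by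
    rw [Set.ncard_eq_toFinset_card', Finset.sum_boole, Nat.cast_id]
    congr 1
    ext j
    simp [estimatedPhase_neg_iff]
  have hflip : majorityFlip n t K *ᵥ (tensor w fun v => ∏ l, phaseState t β (v l))
      = tensor w fun v => (1 - 2 * (if K / 2 + 1 ≤ ∑ j, (if 2 ^ t < 2 * (v j : ℕ) then 1 else 0)
          then 1 else 0) : ℂ) * ∏ l, phaseState t β (v l) := by
    ext ⟨i, v⟩
    rw [majorityFlip, Matrix.mulVec_diagonal]
    simp only [hcount, tensor]
    have hiff : K < 2 * ∑ j, (if 2 ^ t < 2 * (v j : ℕ) then 1 else 0)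
        ↔ K / 2 + 1 ≤ ∑ j, (if 2 ^ t < 2 * (v j : ℕ) then 1 else 0) := by omega
    by_cases hc : K / 2 + 1 ≤ ∑ j, (if 2 ^ t < 2 * (v j : ℕ) then 1 else 0)
    · rw [if_pos (hiff.2 hc), if_pos hc]; ring
    · rw [if_neg (fun h => hc (hiff.1 h)), if_neg hc]; ring
  rw [hflip, braket_tensor]
  congr 1
  have h1 := sum_prod_count_eq_binomTail (fun k => ‖phaseState t β k‖ ^ 2)
    (sum_norm_phaseState t β) (fun k : Fin (2 ^ t) => 2 ^ t < 2 * (k : ℕ)) K (K / 2 + 1)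
  have h2 := sum_prod_count_eq_binomTail (fun k => ‖phaseState t β k‖ ^ 2)
    (sum_norm_phaseState t β) (fun k : Fin (2 ^ t) => 2 ^ t < 2 * (k : ℕ)) K 0
  rw [flipProb, negProb, ← h1]
  have h3 : (1 : ℝ) = ∑ v : Fin K → Fin (2 ^ t), ∏ j, ‖phaseState t β (v j)‖ ^ 2 := by
    simpa [binomTail] using h2.symm
  have h5 : ∀ X : ℝ, 1 - 2 * X = (∑ v : Fin K → Fin (2 ^ t), ∏ j, ‖phaseState t β (v j)‖ ^ 2)
      - 2 * X := fun X => by rw [← h3]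
  rw [h5, Finset.mul_sum, ← Finset.sum_sub_distrib, braket, dotProduct]
  push_cast
  refine Finset.sum_congr rfl fun v _ => ?_
  have h4 : star (∏ l, phaseState t β (v l)) * ∏ l, phaseState t β (v l)
      = ∏ j, (‖phaseState t β (v j)‖ : ℂ) ^ 2 := by
    rw [star_prod, ← Finset.prod_mul_distrib]
    exact Finset.prod_congr rfl fun l _ => Complex.conj_mul' _
  rw [← h4, Pi.star_apply]
  split_ifs <;> push_cast <;> ring

theorem withRegisters_sum {κ : Type*} [Fintype κ] {t K : ℕ} (c : κ → ℂ) (b : κ → n → ℂ) :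
    (withRegisters (∑ i, c i • b i) : n × (Fin K → Fin (2 ^ t)) → ℂ)
      = ∑ i, c i • withRegisters (b i) := by
  ext ⟨i, v⟩
  simp [withRegisters, tensor, Finset.sum_mul, Finset.sum_apply, mul_assoc]

theorem majorityFlip_mulVec_tensor (t K : ℕ) (w : n → ℂ) (g : (Fin K → Fin (2 ^ t)) → ℂ) :
    ∃ g', majorityFlip n t K *ᵥ tensor w g = tensor w g' := by
  refine ⟨fun v => (if K < 2 * Set.ncard {j : Fin K | estimatedPhase t (v j) < 0} then -1 else 1)
    * g v, ?_⟩
  ext ⟨i, v⟩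
  rw [majorityFlip, Matrix.mulVec_diagonal]
  simp only [tensor]
  ring

/-- The undoing step moves to the left side of the bracket. The flip acts on the registers alone, so
different eigenvectors of the system remain orthogonal and no cross terms survive. -/
theorem braket_rotate {κ : Type*} [Fintype κ] [DecidableEq κ] {W : Matrix n n ℂ} {b : κ → n → ℂ}
    {β : κ → ℝ} (h : IsEigenbasis W b β) (C Δ ε : ℝ) (u s : n → ℂ) :
    braket (withRegisters u) (rotate C W Δ ε *ᵥ withRegisters s)
      = ∑ i, braket u (b i) * braket (b i) s *
          ((1 - 2 * flipProb (precisionQubits Δ) (repetitions C ε) (β i) : ℝ) : ℂ) := by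
  set t := precisionQubits Δ
  set K := repetitions C ε
  have hE : ∀ v : n → ℂ, estimates W t K *ᵥ withRegisters v
      = ∑ i, braket (b i) v • tensor (b i) fun v => ∏ l, phaseState t (β i) (v l) := fun v => by
    conv_lhs => rw [← h.sum_smul v]
    rw [withRegisters_sum, Matrix.mulVec_sum]
    refine Finset.sum_congr rfl fun i _ => ?_
    rw [Matrix.mulVec_smul, estimates_mulVec_withRegisters (h.eig i)]
  rw [rotate, ← Matrix.mulVec_mulVec, ← Matrix.mulVec_mulVec, braket_mulVec,
    Matrix.conjTranspose_conjTranspose, hE, hE, Matrix.mulVec_sum, braket_sum_left]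
  refine Finset.sum_congr rfl fun i _ => ?_
  rw [braket_sum_right, Finset.sum_eq_single i]
  · rw [Matrix.mulVec_smul, braket_smul_left, braket_smul_right, braket_majorityFlip, h.ortho,
      if_pos rfl, star_braket]
    ring
  · intro j _ hj
    obtain ⟨g', hg'⟩ := majorityFlip_mulVec_tensor t K (b j) fun v => ∏ l, phaseState t (β j) (v l)
    rw [Matrix.mulVec_smul, braket_smul_left, braket_smul_right, hg', braket_tensor, h.ortho,
      if_neg hj.symm]
    ring
  · simp

end PhaseEstimation

/-! ### Fejér kernel estimates for the sign of the estimated phase. -/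

section FejerBounds

/-- The amplitude is a geometric sum, so its square is a Fejér kernel. The identity is kept free of
division, hence holds also where the sine vanishes. -/
theorem norm_sq_phaseState (t : ℕ) (β : ℝ) (k : Fin (2 ^ t)) :
    ((2 : ℝ) ^ t) ^ 2 * Real.sin (β / 2 - Real.pi * (k : ℕ) / 2 ^ t) ^ 2 * ‖phaseState t β k‖ ^ 2
      = Real.sin (2 ^ t * β / 2) ^ 2 := by
  have hN : (2 : ℝ) ^ t ≠ 0 := by positivity
  have hNc : (2 : ℂ) ^ t ≠ 0 := pow_ne_zero _ two_ne_zero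
  set φ : ℝ := β - 2 * Real.pi * (k : ℕ) / 2 ^ t with hφ
  set ω : ℂ := Complex.exp (Complex.I * φ) with hω
  have h1 : phaseState t β k = (∑ x ∈ Finset.range (2 ^ t), ω ^ x) / (2 ^ t : ℂ) := by
    rw [phaseState, Matrix.mulVec, dotProduct, ← Fin.sum_univ_eq_sum_range (fun x => ω ^ x),
      Finset.sum_div]
    refine Finset.sum_congr rfl fun x _ => ?_
    rw [Matrix.conjTranspose_apply, fourier, Matrix.of_apply, star_div₀, div_mul_div_comm,
      Complex.star_def, Complex.conj_ofReal, sqrt_two_pow_mul_self, ← Complex.exp_conj,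
      ← Complex.exp_nat_mul, ← Complex.exp_add, hω, ← Complex.exp_nat_mul]
    push_cast
    congr 2
    simp only [map_div₀, map_mul, Complex.conj_I, Complex.conj_ofReal, map_natCast, map_ofNat,
      map_pow, hφ]
    push_cast
    field_simp
    ring
  have h2 : (ω - 1) * (2 ^ t * phaseState t β k) = ω ^ (2 ^ t) - 1 := by
    rw [h1, mul_div_cancel₀ _ hNc, mul_comm, geom_sum_mul]
  have h3 : ω ^ (2 ^ t) = Complex.exp (Complex.I * ((2 ^ t * φ : ℝ) : ℂ)) := by
    rw [hω, ← Complex.exp_nat_mul]; congr 1; push_cast; ring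
  have h4 := congrArg norm h2
  rw [norm_mul, norm_mul, h3, hω, Complex.norm_exp_I_mul_ofReal_sub_one,
    Complex.norm_exp_I_mul_ofReal_sub_one, norm_mul, norm_mul, norm_pow] at h4
  simp only [Real.norm_eq_abs, Complex.norm_ofNat, abs_two] at h4
  have h5 : |Real.sin (φ / 2)| * (2 ^ t * ‖phaseState t β k‖) = |Real.sin (2 ^ t * φ / 2)| := by
    linarith
  have h6 := congrArg (· ^ 2) h5
  simp only [mul_pow, sq_abs] at h6
  have h7 : Real.sin (2 ^ t * φ / 2) ^ 2 = Real.sin (2 ^ t * β / 2) ^ 2 := by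
    have : 2 ^ t * φ / 2 = 2 ^ t * β / 2 - (k : ℕ) * Real.pi := by rw [hφ]; field_simp
    rw [this, Real.sin_sub_nat_mul_pi, mul_pow, ← pow_mul, mul_comm _ 2, pow_mul]
    simp
  have h8 : φ / 2 = β / 2 - Real.pi * (k : ℕ) / 2 ^ t := by rw [hφ]; ring
  rw [h7, h8] at h6
  linarith

theorem norm_sq_phaseState_le (t : ℕ) (β : ℝ) (k : Fin (2 ^ t))
    (h : Real.sin (β / 2 - Real.pi * (k : ℕ) / 2 ^ t) ≠ 0) :
    ‖phaseState t β k‖ ^ 2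
      ≤ 1 / (((2 : ℝ) ^ t) ^ 2 * Real.sin (β / 2 - Real.pi * (k : ℕ) / 2 ^ t) ^ 2) := by
  have h1 := norm_sq_phaseState t β k
  rw [le_div_iff₀ (by positivity), mul_comm, h1]
  exact Real.sin_sq_le_one _

theorem negProb_nonneg (t : ℕ) (β : ℝ) : 0 ≤ negProb t β :=
  Finset.sum_nonneg fun _ _ => by positivity

theorem one_sub_negProb (t : ℕ) (β : ℝ) :
    1 - negProb t β
      = ∑ k ∈ Finset.univ.filter fun k : Fin (2 ^ t) => ¬ 2 ^ t < 2 * (k : ℕ),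
          ‖phaseState t β k‖ ^ 2 := by
  rw [negProb, ← sum_norm_phaseState t β,
    ← Finset.sum_filter_add_sum_filter_not Finset.univ
      (fun k : Fin (2 ^ t) => 2 ^ t < 2 * (k : ℕ)), add_sub_cancel_left]

theorem negProb_le_one (t : ℕ) (β : ℝ) : negProb t β ≤ 1 := by
  have h : 0 ≤ 1 - negProb t β := by
    rw [one_sub_negProb]; exact Finset.sum_nonneg fun _ _ => by positivity
  linarith

/-- The numerator of the Fejér kernel is even in `β`. A reading `k` in the upper half of the circle
is nearer to `-β` than to `β`, so the denominator is smaller at `-β`. This is the identity `sin²(y -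
β/2) - sin²(y + β/2) = -sin(2y) sin β` with `π/2 ≤ y ≤ π`. -/
theorem negProb_le_negProb_neg (t : ℕ) {β : ℝ} (h0 : 0 < β) (hpi : β < Real.pi) :
    negProb t β ≤ negProb t (-β) := by
  refine Finset.sum_le_sum fun k hk => ?_
  have hk' : 2 ^ t < 2 * (k : ℕ) := (Finset.mem_filter.1 hk).2
  have hN : (0 : ℝ) < 2 ^ t := by positivity
  set y : ℝ := Real.pi * (k : ℕ) / 2 ^ t with hy
  have hy1 : Real.pi / 2 ≤ y := by
    rw [hy, div_le_div_iff₀ two_pos hN]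
    have : (2 : ℝ) ^ t ≤ 2 * (k : ℕ) := by exact_mod_cast hk'.le
    nlinarith [Real.pi_pos]
  have hy2 : y ≤ Real.pi := by
    rw [hy, div_le_iff₀ hN]
    have : ((k : ℕ) : ℝ) ≤ 2 ^ t := by exact_mod_cast k.2.le
    exact mul_le_mul_of_nonneg_left this Real.pi_pos.le
  have e1 := norm_sq_phaseState t β k
  have e2 := norm_sq_phaseState t (-β) k
  rw [show (2 : ℝ) ^ t * -β / 2 = -(2 ^ t * β / 2) by ring, Real.sin_neg, neg_sq, ← e1, ← hy,
    show -β / 2 - y = -(y + β / 2) by ring, Real.sin_neg, neg_sq,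
    show β / 2 - y = -(y - β / 2) by ring, Real.sin_neg, neg_sq] at e2
  have hs : Real.sin (y + β / 2) ^ 2 ≤ Real.sin (y - β / 2) ^ 2 := by
    have h1 : Real.sin (y - β / 2) ^ 2 - Real.sin (y + β / 2) ^ 2
        = -(Real.sin (2 * y) * Real.sin β) := by
      have h2 : Real.sin (2 * y) = 2 * Real.sin y * Real.cos y := Real.sin_two_mul y
      have h3 : Real.sin β = 2 * Real.sin (β / 2) * Real.cos (β / 2) := by
        rw [← Real.sin_two_mul]; congr 1; ring
      rw [Real.sin_sub, Real.sin_add, h2, h3]; ring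
    have h2 : Real.sin (2 * y) ≤ 0 := by
      have : 0 ≤ Real.sin (2 * y - Real.pi) :=
        Real.sin_nonneg_of_nonneg_of_le_pi (by linarith) (by linarith)
      rw [Real.sin_sub_pi] at this
      linarith
    have h3 : 0 ≤ Real.sin β := (Real.sin_pos_of_pos_of_lt_pi h0 hpi).le
    nlinarith
  have hpos : 0 < Real.sin (y - β / 2) ^ 2 := by
    have : 0 < Real.sin (y - β / 2) :=
      Real.sin_pos_of_pos_of_lt_pi (by linarith) (by linarith)
    positivity
  have hA : 0 < ((2 : ℝ) ^ t) ^ 2 := by positivity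
  have hp := sq_nonneg ‖phaseState t (-β) k‖
  have h1 : ((2 : ℝ) ^ t) ^ 2 * Real.sin (y - β / 2) ^ 2 * ‖phaseState t β k‖ ^ 2
      ≤ ((2 : ℝ) ^ t) ^ 2 * Real.sin (y - β / 2) ^ 2 * ‖phaseState t (-β) k‖ ^ 2 := by
    rw [← e2]
    exact mul_le_mul_of_nonneg_right (mul_le_mul_of_nonneg_left hs hA.le) hp
  exact le_of_mul_le_mul_left h1 (by positivity)

theorem flipProb_le_flipProb_neg (t K : ℕ) {β : ℝ} (h0 : 0 < β) (hpi : β < Real.pi) :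
    flipProb t K β ≤ flipProb t K (-β) :=
  binomTail_mono (negProb_nonneg _ _) (negProb_le_negProb_neg t h0 hpi) (negProb_le_one _ _) _ _

theorem flipProb_nonneg (t K : ℕ) (β : ℝ) : 0 ≤ flipProb t K β :=
  (binomTail_succ_le _ (negProb_nonneg _ _) (negProb_le_one _ _) _ _).1

theorem flipProb_le_one (t K : ℕ) (β : ℝ) : flipProb t K β ≤ 1 :=
  (binomTail_succ_le _ (negProb_nonneg _ _) (negProb_le_one _ _) _ _).2.1

/-- Markov's inequality at the threshold `K / 2 + 1`, which is at least `(K + 1)/2`. The factor `2`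
is uniform in `K`, so no amplification by repetition is used. -/
theorem flipProb_le (t K : ℕ) (β : ℝ) : flipProb t K β ≤ 2 * negProb t β := by
  have h1 := mul_binomTail_le (negProb_nonneg t β) (negProb_le_one t β) K (K / 2 + 1)
  have h2 : ((K : ℝ) + 1) / 2 ≤ ((K / 2 + 1 : ℕ) : ℝ) := by
    have : K + 1 ≤ 2 * (K / 2 + 1) := by omega
    have : (K : ℝ) + 1 ≤ 2 * ((K / 2 + 1 : ℕ) : ℝ) := by exact_mod_cast this
    linarith
  have h3 := flipProb_nonneg t K β
  rw [flipProb] at h3 ⊢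
  have h4 := negProb_nonneg t β
  have h5 : ((K : ℝ) + 1) / 2 * binomTail (negProb t β) K (K / 2 + 1) ≤ K * negProb t β :=
    (mul_le_mul_of_nonneg_right h2 h3).trans h1
  have hK : (0 : ℝ) ≤ K := Nat.cast_nonneg _
  by_contra hc
  push Not at hc
  nlinarith

/-- Without a flip at least half of the estimates are nonnegative, and Markov's inequality applies
to their number. For `K = 0` there is never a flip, so `K` must be positive. -/
theorem one_sub_flipProb_le (t : ℕ) {K : ℕ} (hK : 0 < K) (β : ℝ) :
    1 - flipProb t K β ≤ 2 * (1 - negProb t β) := by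
  have h1 := mul_one_sub_binomTail_le (negProb_nonneg t β) (negProb_le_one t β) K (K / 2 + 1)
    (by omega)
  have h2 : (K : ℝ) / 2 ≤ K + 1 - ((K / 2 + 1 : ℕ) : ℝ) := by
    have : 2 * (K / 2 + 1) ≤ K + 2 := by omega
    have : 2 * ((K / 2 + 1 : ℕ) : ℝ) ≤ K + 2 := by exact_mod_cast this
    linarith
  have h3 := flipProb_le_one t K β
  rw [flipProb] at h3 ⊢
  have hK' : (0 : ℝ) < K := by exact_mod_cast hK
  have h5 := (mul_le_mul_of_nonneg_right h2 (sub_nonneg.2 h3)).trans h1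
  by_contra hc
  push Not at hc
  nlinarith

theorem mul_cos_le_sin {z : ℝ} (h0 : 0 ≤ z) (hpi : z ≤ Real.pi) : z * Real.cos z ≤ Real.sin z := by
  rcases lt_or_ge z (Real.pi / 2) with h | h
  · have hc := Real.cos_pos_of_mem_Ioo ⟨by linarith [Real.pi_pos], h⟩
    have := Real.le_tan h0 h
    rwa [Real.tan_eq_sin_div_cos, le_div_iff₀ hc] at this
  · have hc : Real.cos z ≤ 0 := Real.cos_nonpos_of_pi_div_two_le_of_le h (by linarith)
    have hs := Real.sin_nonneg_of_nonneg_of_le_pi h0 hpi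
    nlinarith

theorem cot_le_one_div {z : ℝ} (h0 : 0 < z) (hpi : z < Real.pi) : Real.cot z ≤ 1 / z := by
  have hs := Real.sin_pos_of_pos_of_lt_pi h0 hpi
  rw [Real.cot_eq_cos_div_sin, div_le_div_iff₀ hs h0]
  linarith [mul_cos_le_sin h0.le hpi.le]

/-- Telescoping: `sin h / sin² z ≤ cot(z - h/2) - cot(z + h/2)`, because `sin(z - h/2) sin(z + h/2)
= sin² z - sin²(h/2)`. Centring each cell at its grid point gives the half-cell offsets `± 1/2` of
all later bounds. -/
theorem sum_one_div_sin_sq_le {h : ℝ} (hh : 0 < h) (y : ℝ) (n : ℕ) (hy : 0 < y - h / 2)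
    (hyn : y + (n - 1 / 2) * h < Real.pi) :
    Real.sin h * ∑ i ∈ Finset.range n, 1 / Real.sin (y + i * h) ^ 2
      ≤ Real.cot (y - h / 2) - Real.cot (y + (n - 1 / 2) * h) := by
  induction n with
  | zero => rw [show y + (((0 : ℕ) : ℝ) - 1 / 2) * h = y - h / 2 by push_cast; ring]; simp
  | succ n ih =>
    have hn : (0 : ℝ) ≤ n := Nat.cast_nonneg _
    push_cast at hyn
    have hnh : 0 ≤ n * h := by positivity
    rw [Finset.sum_range_succ, mul_add]
    have ih' := ih (by nlinarith)
    set z : ℝ := y + n * h with hz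
    have e1 : y + ((n : ℝ) - 1 / 2) * h = z - h / 2 := by rw [hz]; ring
    have e2 : y + (((n + 1 : ℕ) : ℝ) - 1 / 2) * h = z + h / 2 := by rw [hz]; push_cast; ring
    rw [e1] at ih'
    rw [e2]
    have hp1 : 0 < Real.sin (z - h / 2) :=
      Real.sin_pos_of_pos_of_lt_pi (by rw [hz]; linarith) (by rw [hz]; linarith)
    have hp2 : 0 < Real.sin (z + h / 2) :=
      Real.sin_pos_of_pos_of_lt_pi (by rw [hz]; linarith) (by rw [hz]; linarith)
    have hp0 : 0 < Real.sin z :=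
      Real.sin_pos_of_pos_of_lt_pi (by rw [hz]; linarith) (by rw [hz]; linarith)
    have hsh : 0 ≤ Real.sin h :=
      Real.sin_nonneg_of_nonneg_of_le_pi hh.le (by linarith)
    have h1 : Real.cot (z - h / 2) - Real.cot (z + h / 2)
        = Real.sin h / (Real.sin (z - h / 2) * Real.sin (z + h / 2)) := by
      rw [Real.cot_eq_cos_div_sin, Real.cot_eq_cos_div_sin, div_sub_div _ _ hp1.ne' hp2.ne']
      congr 1
      rw [show Real.sin h = Real.sin ((z + h / 2) - (z - h / 2)) by congr 1; ring,
        Real.sin_sub (z + h / 2)]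
      ring
    have h2 : Real.sin (z - h / 2) * Real.sin (z + h / 2) ≤ Real.sin z ^ 2 := by
      have e3 : Real.sin (z - h / 2) * Real.sin (z + h / 2)
          = Real.sin z ^ 2 - Real.sin (h / 2) ^ 2 := by
        rw [Real.sin_sub z, Real.sin_add z]
        linear_combination Real.sin z ^ 2 * Real.cos_sq' (h / 2)
          - Real.sin (h / 2) ^ 2 * Real.cos_sq' z
      rw [e3]
      linarith [sq_nonneg (Real.sin (h / 2))]
    have h3 : Real.sin h * (1 / Real.sin z ^ 2)
        ≤ Real.cot (z - h / 2) - Real.cot (z + h / 2) := by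
      rw [h1, mul_one_div]
      exact div_le_div_of_nonneg_left hsh (mul_pos hp1 hp2) h2
    linarith

theorem cot_pi_sub (x : ℝ) : Real.cot (Real.pi - x) = -Real.cot x := by
  rw [Real.cot_eq_cos_div_sin, Real.cot_eq_cos_div_sin, Real.cos_pi_sub, Real.sin_pi_sub, neg_div]

/-- The `n` consecutive grid points form an arc, and `y` and `z` are the distances from its two ends
to the zeros of the sine; arc and gaps fill one period `N`. The two boundary cotangents are bounded
by `cot x ≤ 1/x`. -/
theorem sum_one_div_sin_sq_le_add {N y z : ℝ} (hN : 0 < N) (n : ℕ) (hy : 1 / 2 < y)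
    (hz : 1 / 2 < z) (hyz : y + z + (n - 1) = N) :
    Real.sin (Real.pi / N) * ∑ i ∈ Finset.range n, 1 / Real.sin (Real.pi * (y + i) / N) ^ 2
      ≤ N / Real.pi * (1 / (y - 1 / 2) + 1 / (z - 1 / 2)) := by
  have hpi := Real.pi_pos
  have e2 : Real.pi * y / N + (n - 1 / 2) * (Real.pi / N)
      = Real.pi - Real.pi * (z - 1 / 2) / N := by
    rw [← hyz] at hN ⊢; field_simp; ring
  have e1 : Real.pi * y / N - Real.pi / N / 2 = Real.pi * (y - 1 / 2) / N := by ring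
  have hz0 : 0 < Real.pi * (z - 1 / 2) / N := div_pos (mul_pos hpi (by linarith)) hN
  have hy0 : 0 < Real.pi * (y - 1 / 2) / N := div_pos (mul_pos hpi (by linarith)) hN
  have hn : (0 : ℝ) ≤ n := Nat.cast_nonneg _
  have hlt : ∀ w : ℝ, w < N → Real.pi * w / N < Real.pi := fun w hw => by
    rw [div_lt_iff₀ hN]; exact mul_lt_mul_of_pos_left hw hpi
  have h1 := sum_one_div_sin_sq_le (h := Real.pi / N) (by positivity) (Real.pi * y / N) n
    (by rw [e1]; exact hy0) (by rw [e2]; linarith)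
  rw [e1, e2, cot_pi_sub] at h1
  have h2 : ∀ i : ℕ, Real.pi * y / N + i * (Real.pi / N) = Real.pi * (y + i) / N := fun i => by ring
  simp only [h2] at h1
  have h3 := cot_le_one_div hy0 (hlt _ (by linarith))
  have h4 := cot_le_one_div hz0 (hlt _ (by linarith))
  refine h1.trans ?_
  have e3 : 1 / (Real.pi * (y - 1 / 2) / N) = N / Real.pi * (1 / (y - 1 / 2)) := by
    have : y - 1 / 2 ≠ 0 := by linarith
    field_simp
  have e4 : 1 / (Real.pi * (z - 1 / 2) / N) = N / Real.pi * (1 / (z - 1 / 2)) := by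
    have : z - 1 / 2 ≠ 0 := by linarith
    field_simp
  rw [e3] at h3
  rw [e4] at h4
  linarith

/-- The error bound of phase estimation at `u` grid cells from `0` and `v` grid cells from `π`. -/
noncomputable def tailBound (u v : ℝ) : ℝ :=
  1 / (u - 1 / 2) + 1 / (u + 1 / 2) + (1 / (v - 1 / 2) + 1 / (v + 1 / 2))

theorem sum_fin_filter_eq (N : ℕ) (f : ℕ → ℝ) (p : ℕ → Prop) [DecidablePred p] :
    ∑ k ∈ Finset.univ.filter (fun k : Fin N => p k), f k
      = ∑ k ∈ (Finset.range N).filter p, f k := by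
  rw [Finset.sum_filter, Finset.sum_filter, Fin.sum_univ_eq_sum_range (fun k => if p k then f k else 0)]

/-- For the phase `-β` the wrong readings are `k = 0, ..., M`; both ends, the estimates `0` and `π`,
count as nonnegative. The nearest wrong readings are `u` and `v` cells away. -/
theorem one_sub_negProb_neg_le {t M : ℕ} (hM : 2 ^ t = 2 * M) (hM1 : 2 ≤ M) {β u v : ℝ}
    (hu : β = 2 * Real.pi * u / 2 ^ t) (huv : u + v = M) (hu2 : 1 / 2 < u) (hv2 : 1 / 2 < v) :
    Real.pi * 2 ^ t * Real.sin (Real.pi / 2 ^ t) * (1 - negProb t (-β))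
      ≤ 1 / (u - 1 / 2) + 1 / (v - 1 / 2) := by
  have hpi := Real.pi_pos
  have hN : (0 : ℝ) < 2 ^ t := by positivity
  have hNM : (2 : ℝ) ^ t = 2 * M := by exact_mod_cast hM
  have hM1' : (2 : ℝ) ≤ M := by exact_mod_cast hM1
  have hsin : 0 < Real.sin (Real.pi / 2 ^ t) :=
    Real.sin_pos_of_pos_of_lt_pi (by positivity) (by
      rw [div_lt_iff₀ hN, hNM]; nlinarith)
  have h1 : 1 - negProb t (-β) ≤ ∑ k ∈ Finset.range (M + 1),
      1 / (((2 : ℝ) ^ t) ^ 2 * Real.sin (Real.pi * (u + k) / 2 ^ t) ^ 2) := by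
    rw [one_sub_negProb]
    have hfil : (Finset.range (2 ^ t)).filter (fun k => ¬ 2 ^ t < 2 * k) = Finset.range (M + 1) := by
      ext k; simp only [Finset.mem_filter, Finset.mem_range]; omega
    rw [← hfil, ← sum_fin_filter_eq]
    refine Finset.sum_le_sum fun k hk => ?_
    have hk' : (k : ℕ) ≤ M := by have := (Finset.mem_filter.1 hk).2; omega
    have hk'' : ((k : ℕ) : ℝ) ≤ M := by exact_mod_cast hk'
    have hk0 : (0 : ℝ) ≤ (k : ℕ) := Nat.cast_nonneg _
    have e : -β / 2 - Real.pi * (k : ℕ) / 2 ^ t = -(Real.pi * (u + (k : ℕ)) / 2 ^ t) := by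
      rw [hu]; field_simp; ring
    have hpos : 0 < Real.sin (Real.pi * (u + (k : ℕ)) / 2 ^ t) := by
      refine Real.sin_pos_of_pos_of_lt_pi (div_pos (mul_pos hpi (by linarith)) hN) ?_
      rw [div_lt_iff₀ hN]
      exact mul_lt_mul_of_pos_left (by rw [hNM]; linarith) hpi
    have := norm_sq_phaseState_le t (-β) k (by rw [e, Real.sin_neg]; exact neg_ne_zero.2 hpos.ne')
    rwa [e, Real.sin_neg, neg_sq] at this
  have h2 := sum_one_div_sin_sq_le_add hN (M + 1) hu2 hv2 (by push_cast; rw [hNM]; linarith)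
  have h3 : ∑ k ∈ Finset.range (M + 1),
      1 / (((2 : ℝ) ^ t) ^ 2 * Real.sin (Real.pi * (u + k) / 2 ^ t) ^ 2)
      = 1 / ((2 : ℝ) ^ t) ^ 2
        * ∑ k ∈ Finset.range (M + 1), 1 / Real.sin (Real.pi * (u + k) / 2 ^ t) ^ 2 := by
    rw [Finset.mul_sum]
    exact Finset.sum_congr rfl fun k _ => by rw [one_div_mul_one_div]
  rw [h3] at h1
  calc Real.pi * 2 ^ t * Real.sin (Real.pi / 2 ^ t) * (1 - negProb t (-β))
      ≤ Real.pi * 2 ^ t * Real.sin (Real.pi / 2 ^ t) * (1 / ((2 : ℝ) ^ t) ^ 2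
        * ∑ k ∈ Finset.range (M + 1), 1 / Real.sin (Real.pi * (u + k) / 2 ^ t) ^ 2) :=
        mul_le_mul_of_nonneg_left h1 (by positivity)
    _ = Real.pi / 2 ^ t * (Real.sin (Real.pi / 2 ^ t)
        * ∑ k ∈ Finset.range (M + 1), 1 / Real.sin (Real.pi * (u + k) / 2 ^ t) ^ 2) := by
        field_simp
    _ ≤ Real.pi / 2 ^ t * (2 ^ t / Real.pi * (1 / (u - 1 / 2) + 1 / (v - 1 / 2))) :=
        mul_le_mul_of_nonneg_left h2 (by positivity)
    _ = 1 / (u - 1 / 2) + 1 / (v - 1 / 2) := by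
        rw [← mul_assoc, div_mul_div_cancel₀ hN.ne', div_self hpi.ne', one_mul]

/-- For the phase `β` the wrong readings are `k = M + 1, ..., 2M - 1`. They exclude the estimates
`0` and `π`, so the nearest are `u + 1` and `v + 1` cells away. Hence `u + 1/2` and `v + 1/2` here,
against `u - 1/2` and `v - 1/2` for `-β`. -/
theorem negProb_le {t M : ℕ} (hM : 2 ^ t = 2 * M) (hM1 : 2 ≤ M) {β u v : ℝ}
    (hu : β = 2 * Real.pi * u / 2 ^ t) (huv : u + v = M) (hu2 : 1 / 2 < u) (hv2 : 1 / 2 < v) :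
    Real.pi * 2 ^ t * Real.sin (Real.pi / 2 ^ t) * negProb t β
      ≤ 1 / (u + 1 / 2) + 1 / (v + 1 / 2) := by
  have hpi := Real.pi_pos
  have hN : (0 : ℝ) < 2 ^ t := by positivity
  have hNM : (2 : ℝ) ^ t = 2 * M := by exact_mod_cast hM
  have hM1' : (2 : ℝ) ≤ M := by exact_mod_cast hM1
  have hsin : 0 < Real.sin (Real.pi / 2 ^ t) :=
    Real.sin_pos_of_pos_of_lt_pi (by positivity) (by
      rw [div_lt_iff₀ hN, hNM]; nlinarith)
  have h1 : negProb t β ≤ ∑ k ∈ Finset.range (M - 1),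
      1 / (((2 : ℝ) ^ t) ^ 2 * Real.sin (Real.pi * (v + 1 + k) / 2 ^ t) ^ 2) := by
    have hfil : (Finset.range (2 ^ t)).filter (fun k => 2 ^ t < 2 * k)
        = Finset.Ico (M + 1) (2 * M) := by
      ext k; simp only [Finset.mem_filter, Finset.mem_range, Finset.mem_Ico]; omega
    have hrange : ∑ k ∈ Finset.range (M - 1),
        1 / (((2 : ℝ) ^ t) ^ 2 * Real.sin (Real.pi * (v + 1 + k) / 2 ^ t) ^ 2)
        = ∑ k ∈ Finset.Ico (M + 1) (2 * M),
          1 / (((2 : ℝ) ^ t) ^ 2 * Real.sin (Real.pi * (v - M + k) / 2 ^ t) ^ 2) := by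
      rw [Finset.sum_Ico_eq_sum_range, show 2 * M - (M + 1) = M - 1 by omega]
      refine Finset.sum_congr rfl fun k _ => ?_
      congr 5
      push_cast; ring
    rw [hrange, ← hfil, ← sum_fin_filter_eq, negProb]
    refine Finset.sum_le_sum fun k hk => ?_
    have hk1 : M + 1 ≤ (k : ℕ) := by have := (Finset.mem_filter.1 hk).2; omega
    have hk1' : (M : ℝ) + 1 ≤ (k : ℕ) := by exact_mod_cast hk1
    have hk2 : ((k : ℕ) : ℝ) < 2 * M := by rw [← hNM]; exact_mod_cast k.2
    have e : β / 2 - Real.pi * (k : ℕ) / 2 ^ t = -(Real.pi * (v - M + (k : ℕ)) / 2 ^ t) := by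
      rw [hu, ← huv]; field_simp; ring
    have hpos : 0 < Real.sin (Real.pi * (v - M + (k : ℕ)) / 2 ^ t) := by
      refine Real.sin_pos_of_pos_of_lt_pi (div_pos (mul_pos hpi (by linarith)) hN) ?_
      rw [div_lt_iff₀ hN]
      exact mul_lt_mul_of_pos_left (by rw [hNM]; linarith) hpi
    have := norm_sq_phaseState_le t β k (by rw [e, Real.sin_neg]; exact neg_ne_zero.2 hpos.ne')
    rwa [e, Real.sin_neg, neg_sq] at this
  have h2 := sum_one_div_sin_sq_le_add hN (M - 1) (y := v + 1) (z := u + 1) (by linarith)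
    (by linarith) (by rw [Nat.cast_sub (by omega), hNM]; push_cast; linarith)
  have h3 : ∑ k ∈ Finset.range (M - 1),
      1 / (((2 : ℝ) ^ t) ^ 2 * Real.sin (Real.pi * (v + 1 + k) / 2 ^ t) ^ 2)
      = 1 / ((2 : ℝ) ^ t) ^ 2
        * ∑ k ∈ Finset.range (M - 1), 1 / Real.sin (Real.pi * (v + 1 + k) / 2 ^ t) ^ 2 := by
    rw [Finset.mul_sum]
    exact Finset.sum_congr rfl fun k _ => by rw [one_div_mul_one_div]
  rw [h3] at h1
  calc Real.pi * 2 ^ t * Real.sin (Real.pi / 2 ^ t) * negProb t β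
      ≤ Real.pi * 2 ^ t * Real.sin (Real.pi / 2 ^ t) * (1 / ((2 : ℝ) ^ t) ^ 2
        * ∑ k ∈ Finset.range (M - 1), 1 / Real.sin (Real.pi * (v + 1 + k) / 2 ^ t) ^ 2) :=
        mul_le_mul_of_nonneg_left h1 (by positivity)
    _ = Real.pi / 2 ^ t * (Real.sin (Real.pi / 2 ^ t)
        * ∑ k ∈ Finset.range (M - 1), 1 / Real.sin (Real.pi * (v + 1 + k) / 2 ^ t) ^ 2) := by
        field_simp
    _ ≤ Real.pi / 2 ^ t * (2 ^ t / Real.pi * (1 / (v + 1 - 1 / 2) + 1 / (u + 1 - 1 / 2))) :=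
        mul_le_mul_of_nonneg_left h2 (by positivity)
    _ = 1 / (u + 1 / 2) + 1 / (v + 1 / 2) := by
        rw [← mul_assoc, div_mul_div_cancel₀ hN.ne', div_self hpi.ne', one_mul, add_comm,
          show u + 1 - 1 / 2 = u + 1 / 2 by ring, show v + 1 - 1 / 2 = v + 1 / 2 by ring]

/-- Phase estimation with majority vote tells the sign of a phase `±β` that is bounded away from
`0` and from `π`. -/
theorem flipProb_neg_sub_flipProb_ge {t M K : ℕ} (hK : 0 < K) (hM : 2 ^ t = 2 * M) (hM1 : 2 ≤ M)
    {β u v : ℝ} (hu : β = 2 * Real.pi * u / 2 ^ t) (huv : u + v = M) (hu2 : 1 / 2 < u)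
    (hv2 : 1 / 2 < v) :
    Real.pi * 2 ^ t * Real.sin (Real.pi / 2 ^ t) * (1 - (flipProb t K (-β) - flipProb t K β))
      ≤ 2 * tailBound u v := by
  have h1 := one_sub_negProb_neg_le hM hM1 hu huv hu2 hv2
  have h2 := negProb_le hM hM1 hu huv hu2 hv2
  have h3 := one_sub_flipProb_le t hK (-β)
  have h4 := flipProb_le t K β
  have hNM : (2 : ℝ) ^ t = 2 * M := by exact_mod_cast hM
  have hM1' : (2 : ℝ) ≤ M := by exact_mod_cast hM1
  have hsin : 0 ≤ Real.sin (Real.pi / 2 ^ t) :=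
    Real.sin_nonneg_of_nonneg_of_le_pi (by positivity) (by
      rw [div_le_iff₀ (by positivity), hNM]; nlinarith [Real.pi_pos])
  have h5 : 0 ≤ Real.pi * 2 ^ t * Real.sin (Real.pi / 2 ^ t) := by positivity
  have h6 : 1 - (flipProb t K (-β) - flipProb t K β)
      ≤ 2 * (1 - negProb t (-β)) + 2 * negProb t β := by linarith
  have := mul_le_mul_of_nonneg_left h6 h5
  rw [tailBound]
  linarith

end FejerBounds

/-! ### Spectrum of a unitary matrix times a reflection: the secular equation. -/

section SearchSpectrum

variable {ι κ κ' : Type*} [Fintype ι] [DecidableEq ι] [Fintype κ] [DecidableEq κ]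
  [Fintype κ'] [DecidableEq κ']

theorem reflection_mulVec (m v : ι → ℂ) :
    (1 - (2 : ℂ) • ketbra m) *ᵥ v = v - (2 * braket m v) • m := by
  rw [Matrix.sub_mulVec, Matrix.one_mulVec, Matrix.smul_mulVec, ketbra_mulVec, smul_smul]

theorem ketbra_conjTranspose (m : ι → ℂ) : (ketbra m)ᴴ = ketbra m := by
  ext i j
  simp [ketbra, Matrix.vecMulVec, Matrix.conjTranspose_apply, mul_comm]

theorem ketbra_mul_self {m : ι → ℂ} (hm : braket m m = 1) : ketbra m * ketbra m = ketbra m := by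
  rw [ketbra, Matrix.vecMulVec_mul_vecMulVec]
  rw [show star m ⬝ᵥ m = 1 from hm]
  simp

theorem reflection_mem_unitaryGroup {m : ι → ℂ} (hm : braket m m = 1) :
    (1 - (2 : ℂ) • ketbra m) ∈ Matrix.unitaryGroup ι ℂ := by
  rw [Matrix.mem_unitaryGroup_iff, Matrix.star_eq_conjTranspose, Matrix.conjTranspose_sub,
    Matrix.conjTranspose_one, Matrix.conjTranspose_smul, ketbra_conjTranspose]
  have h := ketbra_mul_self hm
  simp only [sub_mul, mul_sub, one_mul, mul_one, smul_mul_assoc, mul_smul_comm, h, star_ofNat]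
  module

theorem braket_mulVec_of_eig {A : Matrix ι ι ℂ} (hA : A ∈ Matrix.unitaryGroup ι ℂ) {c : ι → ℂ}
    {γ : ℝ} (hc : A *ᵥ c = Complex.exp (γ * Complex.I) • c) (x : ι → ℂ) :
    braket c (A *ᵥ x) = Complex.exp (γ * Complex.I) * braket c x := by
  have h1 := braket_mulVec_mulVec_of_mem_unitaryGroup hA c x
  rw [hc, braket_smul_left] at h1
  rw [← h1, ← mul_assoc, mul_comm (Complex.exp _), star_exp_mul_I, one_mul]

theorem exp_sub_exp (β γ : ℝ) :
    Complex.exp (γ * Complex.I) - Complex.exp (β * Complex.I)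
      = Complex.exp (γ * Complex.I) * (Complex.exp (((β - γ) / 2 : ℝ) * Complex.I)
        * (-2 * Complex.I * (Real.sin ((β - γ) / 2) : ℂ))) := by
  have h1 : Complex.exp (β * Complex.I) = Complex.exp (γ * Complex.I)
      * (Complex.exp (((β - γ) / 2 : ℝ) * Complex.I)
        * Complex.exp (((β - γ) / 2 : ℝ) * Complex.I)) := by
    rw [← Complex.exp_add, ← Complex.exp_add]; congr 1; push_cast; ring
  have h2 : (-2 * Complex.I * (Real.sin ((β - γ) / 2) : ℂ))
      = Complex.exp (-(((β - γ) / 2 : ℝ) * Complex.I))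
        - Complex.exp (((β - γ) / 2 : ℝ) * Complex.I) := by
    rw [Complex.ofReal_sin, Complex.sin]
    generalize (((β - γ) / 2 : ℝ) : ℂ) = z
    rw [show -z * Complex.I = -(z * Complex.I) by ring]
    linear_combination (-(Complex.exp (-(z * Complex.I)) - Complex.exp (z * Complex.I)))
      * Complex.I_sq
  rw [h2, mul_sub, ← Complex.exp_add, add_neg_cancel, Complex.exp_zero, h1]
  ring

/-- Components of an eigenvector of `A (1 - 2 |m⟩⟨m|)` along the eigenvectors of `A`. -/
theorem sin_mul_braket_of_eig {A : Matrix ι ι ℂ} (hA : A ∈ Matrix.unitaryGroup ι ℂ)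
    {m c w : ι → ℂ} {γ β : ℝ} (hc : A *ᵥ c = Complex.exp (γ * Complex.I) • c)
    (hw : (A * (1 - (2 : ℂ) • ketbra m)) *ᵥ w = Complex.exp (β * Complex.I) • w) :
    (Real.sin ((β - γ) / 2) : ℂ) * braket c w
      = (Real.sin ((β - γ) / 2) + Complex.I * Real.cos ((β - γ) / 2))
        * (braket c m * braket m w) := by
  have h1 := congrArg (braket c) hw
  rw [← Matrix.mulVec_mulVec, braket_mulVec_of_eig hA hc, reflection_mulVec, braket_sub_right,
    braket_smul_right, braket_smul_right] at h1
  have h2 : (Complex.exp (γ * Complex.I) - Complex.exp (β * Complex.I)) * braket c w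
      = Complex.exp (γ * Complex.I) * (2 * (braket c m * braket m w)) := by
    linear_combination h1
  rw [exp_sub_exp, mul_assoc] at h2
  have h3 := mul_left_cancel₀ (Complex.exp_ne_zero _) h2
  have h4 : Complex.exp (-(((β - γ) / 2 : ℝ) * Complex.I))
      * Complex.exp (((β - γ) / 2 : ℝ) * Complex.I) = 1 := by
    rw [← Complex.exp_add, neg_add_cancel, Complex.exp_zero]
  have h5 : Complex.exp (-(((β - γ) / 2 : ℝ) * Complex.I))
      = Real.cos ((β - γ) / 2) - Real.sin ((β - γ) / 2) * Complex.I := by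
    rw [← neg_mul, ← Complex.ofReal_neg, Complex.exp_mul_I, ← Complex.ofReal_cos,
      ← Complex.ofReal_sin, Real.cos_neg, Real.sin_neg]
    push_cast; ring
  generalize Complex.exp (((β - γ) / 2 : ℝ) * Complex.I) = e at h3 h4
  generalize Complex.exp (-(((β - γ) / 2 : ℝ) * Complex.I)) = e' at h4 h5
  generalize (Real.sin ((β - γ) / 2) : ℂ) = s at *
  generalize (Real.cos ((β - γ) / 2) : ℂ) = r at *
  have h6 : -2 * Complex.I * s * braket c w = e' * (2 * (braket c m * braket m w)) := by
    linear_combination e' * h3 - (-2 * Complex.I * s * braket c w) * h4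
  rw [h5] at h6
  linear_combination (Complex.I / 2) * h6
    + (s * braket c w - s * (braket c m * braket m w)) * Complex.I_sq

theorem braket_of_eig {A : Matrix ι ι ℂ} (hA : A ∈ Matrix.unitaryGroup ι ℂ)
    {m c w : ι → ℂ} {γ β : ℝ} (hc : A *ᵥ c = Complex.exp (γ * Complex.I) • c)
    (hw : (A * (1 - (2 : ℂ) • ketbra m)) *ᵥ w = Complex.exp (β * Complex.I) • w)
    (hs : Real.sin ((β - γ) / 2) ≠ 0) :
    braket c w
      = (1 + Complex.I * Real.cot ((β - γ) / 2)) * (braket c m * braket m w) := by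
  have h1 := sin_mul_braket_of_eig hA hc hw
  have hs' : (Real.sin ((β - γ) / 2) : ℂ) ≠ 0 := by exact_mod_cast hs
  rw [Real.cot_eq_cos_div_sin]
  push_cast
  push_cast at h1 hs'
  field_simp
  linear_combination h1

theorem braket_mul_braket_eq_zero_of_eig {A : Matrix ι ι ℂ} (hA : A ∈ Matrix.unitaryGroup ι ℂ)
    {m c w : ι → ℂ} {γ β : ℝ} (hc : A *ᵥ c = Complex.exp (γ * Complex.I) • c)
    (hw : (A * (1 - (2 : ℂ) • ketbra m)) *ᵥ w = Complex.exp (β * Complex.I) • w)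
    (hs : Real.sin ((β - γ) / 2) = 0) : braket c m * braket m w = 0 := by
  have h1 := sin_mul_braket_of_eig hA hc hw
  have hc : Real.cos ((β - γ) / 2) ≠ 0 := fun h => by
    have := Real.sin_sq_add_cos_sq ((β - γ) / 2)
    rw [hs, h] at this; norm_num at this
  rw [hs, Complex.ofReal_zero, zero_mul, zero_add] at h1
  have h2 : (Complex.I * Real.cos ((β - γ) / 2) : ℂ) ≠ 0 :=
    mul_ne_zero Complex.I_ne_zero (by exact_mod_cast hc)
  exact (mul_eq_zero.1 h1.symm).resolve_left h2

/-- `∑ₖ |⟨cₖ|m⟩|² cot ((β - γₖ) / 2)`, whose zeros are the eigenphases of `A (1 - 2 |m⟩⟨m|)` when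
`A cₖ = exp (i γₖ) cₖ`. -/
noncomputable def cotSum (c : κ → ι → ℂ) (γ : κ → ℝ) (m : ι → ℂ) (β : ℝ) : ℝ :=
  ∑ k, ‖braket (c k) m‖ ^ 2 * Real.cot ((β - γ k) / 2)

/-- `∑ₖ |⟨cₖ|m⟩|² cot² ((β - γₖ) / 2)`. -/
noncomputable def cotSqSum (c : κ → ι → ℂ) (γ : κ → ℝ) (m : ι → ℂ) (β : ℝ) : ℝ :=
  ∑ k, ‖braket (c k) m‖ ^ 2 * Real.cot ((β - γ k) / 2) ^ 2

namespace IsEigenbasis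

variable {A : Matrix ι ι ℂ} {c : κ → ι → ℂ} {γ : κ → ℝ} {m w : ι → ℂ} {β : ℝ}

theorem sum_weight (h : IsEigenbasis A c γ) (hm : braket m m = 1) :
    ∑ k, ‖braket (c k) m‖ ^ 2 = 1 := by
  have := h.sum_norm_sq m
  rw [hm] at this
  exact_mod_cast this

theorem sin_ne_zero (hA : A ∈ Matrix.unitaryGroup ι ℂ) (h : IsEigenbasis A c γ)
    (hw : (A * (1 - (2 : ℂ) • ketbra m)) *ᵥ w = Complex.exp (β * Complex.I) • w)
    (hmw : braket m w ≠ 0) (k : κ) (hk : braket (c k) m ≠ 0) :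
    Real.sin ((β - γ k) / 2) ≠ 0 := fun hs =>
  mul_ne_zero hk hmw (braket_mul_braket_eq_zero_of_eig hA (h.eig k) hw hs)

/-- Expanding `⟨m|w⟩` in the basis `c` gives `(1 + i cotSum) ⟨m|w⟩ = ⟨m|w⟩`. -/
theorem cotSum_eq_zero (hA : A ∈ Matrix.unitaryGroup ι ℂ) (h : IsEigenbasis A c γ)
    (hm : braket m m = 1)
    (hw : (A * (1 - (2 : ℂ) • ketbra m)) *ᵥ w = Complex.exp (β * Complex.I) • w)
    (hmw : braket m w ≠ 0) : cotSum c γ m β = 0 := by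
  have h1 : ∀ k, braket m (c k) * braket (c k) w
      = ((‖braket (c k) m‖ ^ 2 : ℝ) + Complex.I *
        ((‖braket (c k) m‖ ^ 2 * Real.cot ((β - γ k) / 2) : ℝ))) * braket m w := fun k => by
    by_cases hk : braket (c k) m = 0
    · rw [← star_braket, hk]; simp
    · rw [braket_of_eig hA (h.eig k) hw (h.sin_ne_zero hA hw hmw k hk), Complex.ofReal_mul,
        ← braket_mul_comm_eq_norm_sq]
      ring
  have h2 := h.complete m w
  simp only [h1] at h2
  rw [← Finset.sum_mul, Finset.sum_add_distrib, ← Finset.mul_sum, ← Complex.ofReal_sum,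
    ← Complex.ofReal_sum, h.sum_weight hm] at h2
  have h3 : Complex.I * (cotSum c γ m β : ℂ) = 0 := by
    have : (1 + Complex.I * (cotSum c γ m β : ℂ)) * braket m w = 1 * braket m w := by
      rw [one_mul]; exact_mod_cast h2
    have := mul_right_cancel₀ hmw this
    linear_combination this
  exact_mod_cast (mul_eq_zero.1 h3).resolve_left Complex.I_ne_zero

theorem norm_sq_one_add_I_mul (x : ℝ) : ‖(1 + Complex.I * x : ℂ)‖ ^ 2 = 1 + x ^ 2 := by
  rw [Complex.sq_norm, Complex.normSq_apply]
  simp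
  ring

/-- A zero of `cotSum` is an eigenphase of `A (1 - 2 |m⟩⟨m|)`. -/
theorem exists_eigenvector (h : IsEigenbasis A c γ) (hm : braket m m = 1)
    (hs : ∀ k, braket (c k) m ≠ 0 → Real.sin ((β - γ k) / 2) ≠ 0) (h0 : cotSum c γ m β = 0) :
    ∃ w : ι → ℂ, (A * (1 - (2 : ℂ) • ketbra m)) *ᵥ w = Complex.exp (β * Complex.I) • w ∧
      braket m w = 1 ∧ braket w w = ((1 + cotSqSum c γ m β : ℝ) : ℂ) := by
  -- The coefficients are those that `braket_of_eig` forces when `⟨m|w⟩ = 1`.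
  set g : κ → ℂ := fun k => (1 + Complex.I * Real.cot ((β - γ k) / 2)) * braket (c k) m with hg
  set w : ι → ℂ := ∑ k, g k • c k with hw
  have hcw : ∀ k, braket (c k) w = g k := fun k => by
    simp only [hw, braket_sum_right, braket_smul_right, h.ortho]
    simp
  have hmw : braket m w = 1 := by
    rw [← h.complete m w]
    simp only [hcw]
    have h1 : ∀ k, braket m (c k) * g k
        = ((‖braket (c k) m‖ ^ 2 : ℝ) + Complex.I *
          ((‖braket (c k) m‖ ^ 2 * Real.cot ((β - γ k) / 2) : ℝ))) := fun k => by
      rw [Complex.ofReal_mul, ← braket_mul_comm_eq_norm_sq, hg]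
      ring
    simp only [h1]
    rw [Finset.sum_add_distrib, ← Finset.mul_sum, ← Complex.ofReal_sum, ← Complex.ofReal_sum,
      h.sum_weight hm, show ∑ k, ‖braket (c k) m‖ ^ 2 * Real.cot ((β - γ k) / 2) = 0 from h0]
    simp
  refine ⟨w, ?_, hmw, ?_⟩
  · rw [← Matrix.mulVec_mulVec, reflection_mulVec, hmw, mul_one]
    conv_lhs => rw [hw, ← h.sum_smul m, Finset.smul_sum, ← Finset.sum_sub_distrib]
    rw [Matrix.mulVec_sum, hw, Finset.smul_sum]
    refine Finset.sum_congr rfl fun k _ => ?_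
    rw [Matrix.mulVec_sub, Matrix.mulVec_smul, Matrix.mulVec_smul, Matrix.mulVec_smul, h.eig k,
      smul_smul, smul_smul, smul_smul, smul_smul, ← sub_smul]
    congr 1
    by_cases hk : braket (c k) m = 0
    · simp [hg, hk]
    · have hsk : (Real.sin ((β - γ k) / 2) : ℂ) ≠ 0 := by exact_mod_cast hs k hk
      have h1 := exp_sub_exp β (γ k)
      have h2 : Complex.exp (((β - γ k) / 2 : ℝ) * Complex.I)
          = Real.cos ((β - γ k) / 2) + Real.sin ((β - γ k) / 2) * Complex.I := by
        rw [Complex.exp_mul_I, ← Complex.ofReal_cos, ← Complex.ofReal_sin]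
      have h3 : ((Real.sin ((β - γ k) / 2) : ℝ) : ℂ) ^ 2 + (Real.cos ((β - γ k) / 2) : ℂ) ^ 2 = 1 := by
        exact_mod_cast Real.sin_sq_add_cos_sq _
      rw [h2] at h1
      have h4 : (Real.cot ((β - γ k) / 2) : ℂ) * Real.sin ((β - γ k) / 2)
          = Real.cos ((β - γ k) / 2) := by
        rw [Real.cot_eq_cos_div_sin, Complex.ofReal_div, div_mul_cancel₀ _ hsk]
      have h5 : Complex.exp (β * Complex.I) = Complex.exp (γ k * Complex.I)
          * (1 + 2 * Complex.I * Real.sin ((β - γ k) / 2)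
            * (Real.cos ((β - γ k) / 2) + Real.sin ((β - γ k) / 2) * Complex.I)) := by
        linear_combination -h1
      simp only [hg]
      rw [h5]
      generalize (Real.cot ((β - γ k) / 2) : ℂ) = t at *
      generalize (Real.sin ((β - γ k) / 2) : ℂ) = s at *
      generalize (Real.cos ((β - γ k) / 2) : ℂ) = r at *
      rw [← h4] at h3 ⊢
      linear_combination (2 * Complex.exp (γ k * Complex.I) * braket (c k) m) * h3
        - (2 * Complex.exp (γ k * Complex.I) * braket (c k) m)
          * (Complex.I * t * s ^ 2 + t ^ 2 * s ^ 2 + s ^ 2) * Complex.I_sq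
  · rw [← h.sum_norm_sq w]
    congr 1
    rw [cotSqSum, ← h.sum_weight hm, ← Finset.sum_add_distrib]
    refine Finset.sum_congr rfl fun k _ => ?_
    rw [hcw, hg, norm_mul, mul_pow, norm_sq_one_add_I_mul]
    ring

variable {b : κ' → ι → ℂ} {β' : κ' → ℝ} {W : Matrix ι ι ℂ}

/-- Cauchy–Schwarz inside the eigenspace of phase `x`, the only one on which `w` has components. It
bounds the weight of `m` there from below by `1/⟨w|w⟩`. -/
theorem one_le_sum_weight_mul (hW : W ∈ Matrix.unitaryGroup ι ℂ) (hb : IsEigenbasis W b β')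
    {x : ℝ} (hx0 : -Real.pi < x) (hxpi : x ≤ Real.pi)
    (hw : W *ᵥ w = Complex.exp (x * Complex.I) • w) (hmw : braket m w = 1) {B : ℝ}
    (hB : braket w w = B) :
    1 ≤ (∑ i ∈ Finset.univ.filter fun i => β' i = x, ‖braket (b i) m‖ ^ 2) * B := by
  have hzero : ∀ i, β' i ≠ x → braket (b i) w = 0 := fun i hi => by
    refine braket_eq_zero_of_eig hW (hb.eig i) hw fun he => hi ?_
    have h1 : Complex.arg (Complex.exp (β' i * Complex.I)) = β' i :=
      Complex.arg_exp_mul_I (β' i) ▸ (toIocMod_eq_self _).2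
        ⟨hb.neg_pi_lt i, by linarith [hb.le_pi i]⟩
    have h2 : Complex.arg (Complex.exp (x * Complex.I)) = x :=
      Complex.arg_exp_mul_I x ▸ (toIocMod_eq_self _).2 ⟨hx0, by linarith⟩
    rw [← h1, ← h2, he]
  have h1 : (1 : ℝ) ≤ ∑ i ∈ Finset.univ.filter fun i => β' i = x,
      ‖braket (b i) m‖ * ‖braket (b i) w‖ := by
    have h2 := hb.complete m w
    rw [hmw, ← Finset.sum_subset (Finset.subset_univ (Finset.univ.filter fun i => β' i = x))
      (fun i _ hi => by rw [hzero i (by simpa using hi), mul_zero])] at h2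
    calc (1 : ℝ) = ‖∑ i ∈ Finset.univ.filter fun i => β' i = x,
          braket m (b i) * braket (b i) w‖ := by rw [h2, norm_one]
      _ ≤ _ := (norm_sum_le _ _).trans
          (Finset.sum_le_sum fun i _ => by rw [norm_mul, norm_braket_comm])
  have h3 := Finset.sum_mul_sq_le_sq_mul_sq (Finset.univ.filter fun i => β' i = x)
    (fun i => ‖braket (b i) m‖) (fun i => ‖braket (b i) w‖)
  have h4 : ∑ i ∈ Finset.univ.filter fun i => β' i = x, ‖braket (b i) w‖ ^ 2 ≤ B := by
    have h5 := hb.sum_norm_sq w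
    rw [hB] at h5
    rw [← show _ = B by exact_mod_cast h5]
    exact Finset.sum_le_sum_of_subset_of_nonneg (Finset.subset_univ _)
      fun _ _ _ => by positivity
  have h6 : 0 ≤ ∑ i ∈ Finset.univ.filter fun i => β' i = x, ‖braket (b i) m‖ ^ 2 :=
    Finset.sum_nonneg fun _ _ => by positivity
  nlinarith [mul_le_mul_of_nonneg_left h4 h6]

/-- The projection `v` of `m` onto the eigenspace satisfies `⟨m|v⟩ = ⟨v|v⟩ = S`. By `braket_of_eig`,
its components along the `c k` that overlap `m` have total square `S² (1 + cotSqSum)`; the remaining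
components only add to `⟨v|v⟩`. -/
theorem sum_weight_mul_le (hA : A ∈ Matrix.unitaryGroup ι ℂ) (h : IsEigenbasis A c γ)
    (hm : braket m m = 1) (hb : IsEigenbasis (A * (1 - (2 : ℂ) • ketbra m)) b β') (x : ℝ) :
    (∑ i ∈ Finset.univ.filter fun i => β' i = x, ‖braket (b i) m‖ ^ 2)
      * (1 + cotSqSum c γ m x) ≤ 1 := by
  set S : ℝ := ∑ i ∈ Finset.univ.filter fun i => β' i = x, ‖braket (b i) m‖ ^ 2 with hS
  set v : ι → ℂ := ∑ i ∈ Finset.univ.filter fun i => β' i = x, braket (b i) m • b i with hv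
  have hS0 : 0 ≤ S := Finset.sum_nonneg fun _ _ => by positivity
  have hF0 : 0 ≤ cotSqSum c γ m x := Finset.sum_nonneg fun _ _ => by positivity
  rcases hS0.eq_or_lt with h0 | hSpos
  · rw [← h0]; norm_num
  have hbr : ∀ u, braket u v = ∑ i ∈ Finset.univ.filter fun i => β' i = x,
      braket (b i) m * braket u (b i) := fun u => by
    rw [hv, braket, dotProduct_sum]
    exact Finset.sum_congr rfl fun i _ => braket_smul_right _ _ _
  have hmv : braket m v = S := by
    rw [hbr, hS, Complex.ofReal_sum]
    exact Finset.sum_congr rfl fun i _ => by rw [mul_comm, braket_mul_comm_eq_norm_sq]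
  have hbv : ∀ i, braket (b i) v = if β' i = x then braket (b i) m else 0 := fun i => by
    rw [hbr]
    simp only [hb.ortho, mul_ite, mul_one, mul_zero]
    rw [Finset.sum_ite_eq]
    simp
  have hvv : ∑ k, ‖braket (c k) v‖ ^ 2 = S := by
    have h1 := h.sum_norm_sq v
    rw [← hb.sum_norm_sq v] at h1
    have h2 : ∑ k, ‖braket (c k) v‖ ^ 2 = ∑ i, ‖braket (b i) v‖ ^ 2 := by exact_mod_cast h1
    rw [h2, hS, Finset.sum_filter]
    refine Finset.sum_congr rfl fun i _ => ?_
    rw [hbv]; split_ifs <;> simp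
  have hWv : (A * (1 - (2 : ℂ) • ketbra m)) *ᵥ v = Complex.exp (x * Complex.I) • v := by
    rw [hv, Matrix.mulVec_sum, Finset.smul_sum]
    refine Finset.sum_congr rfl fun i hi => ?_
    rw [Matrix.mulVec_smul, hb.eig, (Finset.mem_filter.1 hi).2, smul_comm]
  have hmv0 : braket m v ≠ 0 := by rw [hmv]; exact_mod_cast hSpos.ne'
  have h1 : ∀ k, S ^ 2 * (‖braket (c k) m‖ ^ 2
      + ‖braket (c k) m‖ ^ 2 * Real.cot ((x - γ k) / 2) ^ 2) = if braket (c k) m = 0 then 0 else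
        ‖braket (c k) v‖ ^ 2 := fun k => by
    split_ifs with hk
    · simp [hk]
    · rw [braket_of_eig hA (h.eig k) hWv (h.sin_ne_zero hA hWv hmv0 k hk), norm_mul, norm_mul,
        mul_pow, mul_pow, norm_sq_one_add_I_mul, hmv, Complex.norm_real, Real.norm_eq_abs, sq_abs]
      ring
  have h2 : S ^ 2 * (1 + cotSqSum c γ m x) ≤ S := by
    rw [← h.sum_weight hm, cotSqSum, ← Finset.sum_add_distrib, Finset.mul_sum]
    conv_rhs => rw [← hvv]
    refine Finset.sum_le_sum fun k _ => ?_
    rw [h1]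
    split_ifs
    · positivity
    · exact le_rfl
  nlinarith

end IsEigenbasis

end SearchSpectrum

/-! ### Zeros and monotonicity of weighted sums of cotangents. -/

section WeightedCot

variable {κ : Type*} [Fintype κ]

theorem continuousOn_cot {f : ℝ → ℝ} {s : Set ℝ} (hf : ContinuousOn f s)
    (h : ∀ x ∈ s, Real.sin (f x) ≠ 0) : ContinuousOn (fun x => Real.cot (f x)) s := by
  simp only [Real.cot_eq_cos_div_sin]
  exact (Real.continuous_cos.comp_continuousOn hf).div (Real.continuous_sin.comp_continuousOn hf) h

theorem sin_half_sub_ne_zero {x y : ℝ} (hx : 0 ≤ x) (hxpi : x < Real.pi) (hy : -Real.pi < y)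
    (hypi : y < Real.pi) (hxy : x ≠ y) : Real.sin ((x - y) / 2) ≠ 0 := by
  rcases lt_or_gt_of_ne hxy with h | h
  · exact (Real.sin_neg_of_neg_of_neg_pi_lt (by linarith) (by linarith)).ne
  · exact (Real.sin_pos_of_pos_of_lt_pi (by linarith) (by linarith)).ne'

theorem cot_mul_sin {x : ℝ} (h : Real.sin x ≠ 0) : Real.cot x * Real.sin x = Real.cos x := by
  rw [Real.cot_eq_cos_div_sin, div_mul_cancel₀ _ h]

theorem cot_neg (x : ℝ) : Real.cot (-x) = -Real.cot x := by
  rw [Real.cot_eq_cos_div_sin, Real.cot_eq_cos_div_sin, Real.cos_neg, Real.sin_neg, div_neg]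

theorem tan_mul_cot {x : ℝ} (hs : Real.sin x ≠ 0) (hc : Real.cos x ≠ 0) :
    Real.tan x * Real.cot x = 1 := by
  rw [Real.cot_eq_cos_div_sin, Real.tan_eq_sin_div_cos]; field_simp

/-- A weighted sum of cotangents has a zero between its pole at `0` and its next pole. -/
theorem exists_zero_before_pole {a γ : κ → ℝ} (ha : ∀ k, 0 ≤ a k)
    (hγ : ∀ k, a k ≠ 0 → -Real.pi < γ k ∧ γ k < Real.pi) (h0 : ∃ k, a k ≠ 0 ∧ γ k = 0) {g : ℝ}
    (hg : 0 < g) (hgpole : ∃ k, a k ≠ 0 ∧ γ k = g) (hbet : ∀ k, a k ≠ 0 → γ k ≤ 0 ∨ g ≤ γ k) :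
    ∃ α, 0 < α ∧ α < g ∧ ∑ k, a k * Real.cot ((α - γ k) / 2) = 0 ∧
      ∀ k, a k ≠ 0 → Real.sin ((α - γ k) / 2) ≠ 0 := by
  obtain ⟨k0, hk0, hγ0⟩ := h0
  obtain ⟨k1, hk1, hγ1⟩ := hgpole
  have hgpi : g < Real.pi := hγ1 ▸ (hγ k1 hk1).2
  have hsin : ∀ k, a k ≠ 0 → ∀ x ∈ Set.Icc 0 g, x ≠ γ k → Real.sin ((x - γ k) / 2) ≠ 0 :=
    fun k hk x hx hne =>
      sin_half_sub_ne_zero hx.1 (hx.2.trans_lt hgpi) (hγ k hk).1 (hγ k hk).2 hne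
  have hgs : 0 < Real.sin (g / 2) := Real.sin_pos_of_pos_of_lt_pi (by linarith) (by linarith)
  -- Multiplying the sum by `sin(x/2) sin((g - x)/2)` clears the poles at `0` and `g`. The two polar
  -- terms are written out so that the product is continuous on the closed interval. It is positive
  -- at `0` and negative at `g`.
  set H : κ → ℝ → ℝ := fun k x => if γ k = 0 then Real.cos (x / 2) * Real.sin ((g - x) / 2)
    else if γ k = g then -(Real.cos ((g - x) / 2) * Real.sin (x / 2))
    else Real.cot ((x - γ k) / 2) * Real.sin (x / 2) * Real.sin ((g - x) / 2) with hH
  have hcont : ContinuousOn (fun x => ∑ k, a k * H k x) (Set.Icc 0 g) := by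
    refine continuousOn_finsetSum _ fun k _ => ?_
    by_cases hk : a k = 0
    · simp only [hk, zero_mul]; exact continuousOn_const
    refine continuousOn_const.mul ?_
    by_cases hz : γ k = 0
    · simp only [hH, if_pos hz]
      fun_prop
    by_cases hzg : γ k = g
    · simp only [hH, if_neg hz, if_pos hzg]
      fun_prop
    simp only [hH, if_neg hz, if_neg hzg]
    refine ((continuousOn_cot (by fun_prop) fun x hx => hsin k hk x hx ?_).mul
      (by fun_prop)).mul (by fun_prop)
    rintro rfl
    rcases hbet k hk with h | h
    · exact hz (le_antisymm h hx.1)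
    · exact hzg (le_antisymm hx.2 h)
  have hH0 : 0 < ∑ k, a k * H k 0 := by
    refine Finset.sum_pos' (fun k _ => mul_nonneg (ha k) ?_) ⟨k0, Finset.mem_univ _, ?_⟩
    · simp only [hH]; split_ifs <;> simp [hgs.le]
    · simp only [hH, if_pos hγ0]
      simp only [zero_div, Real.cos_zero, one_mul, sub_zero]
      exact mul_pos (lt_of_le_of_ne (ha k0) hk0.symm) hgs
  have hHg : ∑ k, a k * H k g < 0 := by
    refine Finset.sum_neg' (fun k _ => mul_nonpos_of_nonneg_of_nonpos (ha k) ?_)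
      ⟨k1, Finset.mem_univ _, ?_⟩
    · simp only [hH]; split_ifs <;> simp [hgs.le]
    · simp only [hH, if_neg (hγ1.trans_ne hg.ne'), if_pos hγ1]
      simp only [sub_self, zero_div, Real.cos_zero, one_mul, mul_neg, neg_lt_zero]
      exact mul_pos (lt_of_le_of_ne (ha k1) hk1.symm) hgs
  obtain ⟨α, hα, hαz⟩ := intermediate_value_Icc' hg.le hcont ⟨hHg.le, hH0.le⟩
  have hα0 : α ≠ 0 := by rintro rfl; exact hH0.ne' hαz
  have hαg : α ≠ g := by rintro rfl; exact hHg.ne hαz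
  have hα0' : 0 < α := lt_of_le_of_ne hα.1 hα0.symm
  have hαg' : α < g := lt_of_le_of_ne hα.2 hαg
  have hns : ∀ k, a k ≠ 0 → Real.sin ((α - γ k) / 2) ≠ 0 := fun k hk =>
    hsin k hk α hα (by rintro rfl; rcases hbet k hk with h | h <;> linarith)
  refine ⟨α, hα0', hαg', ?_, hns⟩
  have hs1 : Real.sin (α / 2) ≠ 0 :=
    (Real.sin_pos_of_pos_of_lt_pi (by linarith) (by linarith)).ne'
  have hs2 : Real.sin ((g - α) / 2) ≠ 0 :=
    (Real.sin_pos_of_pos_of_lt_pi (by linarith) (by linarith)).ne'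
  have hfac : ∑ k, a k * H k α
      = (∑ k, a k * Real.cot ((α - γ k) / 2)) * (Real.sin (α / 2) * Real.sin ((g - α) / 2)) := by
    rw [Finset.sum_mul]
    refine Finset.sum_congr rfl fun k _ => ?_
    simp only [hH]
    split_ifs with h1 h2
    · rw [h1, sub_zero, ← cot_mul_sin hs1]; ring
    · rw [h2, ← cot_mul_sin hs2, show (α - g) / 2 = -((g - α) / 2) by ring, cot_neg]; ring
    · ring
  have hαz' := hfac.symm.trans hαz
  exact (mul_eq_zero.1 hαz').resolve_right (mul_ne_zero hs1 hs2)

theorem exists_eq_tan_before {a γ : κ → ℝ} (ha : ∀ k, 0 ≤ a k)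
    (hγ : ∀ k, a k ≠ 0 → -Real.pi < γ k ∧ γ k < Real.pi) (h0 : ∃ k, a k ≠ 0 ∧ γ k = 0) {α T : ℝ}
    (hα : 0 < α) (hαpi : α < Real.pi) (hbet : ∀ k, a k ≠ 0 → γ k ≤ 0 ∨ α < γ k)
    (hz : ∑ k, a k * Real.cot ((α - γ k) / 2) = 0) (hT : 0 < T) :
    ∃ β, 0 < β ∧ β < α ∧ ∑ k, a k * Real.cot ((β - γ k) / 2) = T * Real.tan (β / 2) := by
  obtain ⟨k0, hk0, hγ0⟩ := h0
  have hsin : ∀ k, a k ≠ 0 → ∀ x ∈ Set.Icc 0 α, x ≠ γ k → Real.sin ((x - γ k) / 2) ≠ 0 :=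
    fun k hk x hx hne =>
      sin_half_sub_ne_zero hx.1 (hx.2.trans_lt hαpi) (hγ k hk).1 (hγ k hk).2 hne
  have hs : ∀ x, 0 < x → x ≤ α → 0 < Real.sin (x / 2) := fun x hx hxα =>
    Real.sin_pos_of_pos_of_lt_pi (by linarith) (by linarith)
  have hc : ∀ x, 0 ≤ x → x ≤ α → 0 < Real.cos (x / 2) := fun x hx hxα =>
    Real.cos_pos_of_mem_Ioo ⟨by linarith, by linarith⟩
  -- Here only the pole at `0` has to be cleared, by the factor `sin(x/2)`. The difference of the
  -- two sides is positive at `0`, and negative at `α` because the cotangent sum vanishes there.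
  set H : κ → ℝ → ℝ := fun k x => if γ k = 0 then Real.cos (x / 2)
    else Real.cot ((x - γ k) / 2) * Real.sin (x / 2) with hH
  set G : ℝ → ℝ := fun x => ∑ k, a k * H k x
    - T * (Real.sin (x / 2) / Real.cos (x / 2)) * Real.sin (x / 2) with hG
  have hcont : ContinuousOn G (Set.Icc 0 α) := by
    refine (continuousOn_finsetSum _ fun k _ => ?_).sub
      ((continuousOn_const.mul (ContinuousOn.div (by fun_prop) (by fun_prop)
        fun x hx => (hc x hx.1 hx.2).ne')).mul (by fun_prop))
    by_cases hk : a k = 0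
    · simp only [hk, zero_mul]; exact continuousOn_const
    refine continuousOn_const.mul ?_
    by_cases hz : γ k = 0
    · simp only [hH, if_pos hz]
      fun_prop
    simp only [hH, if_neg hz]
    refine (continuousOn_cot (by fun_prop) fun x hx => hsin k hk x hx ?_).mul (by fun_prop)
    rintro rfl
    rcases hbet k hk with h | h
    · exact hz (le_antisymm h hx.1)
    · exact absurd hx.2 (not_le.2 h)
  have hfac : ∀ x, 0 < x → x ≤ α → G x = (∑ k, a k * Real.cot ((x - γ k) / 2)
      - T * Real.tan (x / 2)) * Real.sin (x / 2) := fun x hx hxα => by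
    rw [sub_mul, Finset.sum_mul, Real.tan_eq_sin_div_cos]
    change ∑ k, a k * H k x - _ = _
    refine congrArg (· - _) ?_
    refine Finset.sum_congr rfl fun k _ => ?_
    simp only [hH]
    split_ifs with h1
    · rw [h1, sub_zero, mul_assoc, cot_mul_sin (hs x hx hxα).ne']
    · ring
  have hG0 : 0 < G 0 := by
    simp only [hG, zero_div, Real.sin_zero, mul_zero, sub_zero]
    refine Finset.sum_pos' (fun k _ => mul_nonneg (ha k) ?_) ⟨k0, Finset.mem_univ _, ?_⟩
    · simp only [hH]; split_ifs <;> simp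
    · simp only [hH, if_pos hγ0, zero_div, Real.cos_zero, mul_one]
      exact lt_of_le_of_ne (ha k0) hk0.symm
  have hGα : G α < 0 := by
    rw [hfac α hα le_rfl, hz, zero_sub]
    have h1 : 0 < Real.tan (α / 2) := Real.tan_pos_of_pos_of_lt_pi_div_two (by linarith) (by linarith)
    have h2 := hs α hα le_rfl
    have := mul_pos (mul_pos hT h1) h2
    linarith
  obtain ⟨β, hβ, hβz⟩ := intermediate_value_Icc' hα.le hcont ⟨hGα.le, hG0.le⟩
  have hβ0 : 0 < β := lt_of_le_of_ne hβ.1 (by rintro rfl; exact hG0.ne' hβz)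
  have hβα : β < α := lt_of_le_of_ne hβ.2 (by rintro rfl; exact hGα.ne hβz)
  refine ⟨β, hβ0, hβα, ?_⟩
  rw [hfac β hβ0 hβα.le] at hβz
  exact sub_eq_zero.1 ((mul_eq_zero.1 hβz).resolve_right (hs β hβ0 hβα.le).ne')

theorem cot_le_cot {x y : ℝ} (hxy : x ≤ y) (hpos : 0 < Real.sin x * Real.sin y)
    (hlt : y - x ≤ Real.pi) : Real.cot y ≤ Real.cot x := by
  have hx : Real.sin x ≠ 0 := left_ne_zero_of_mul hpos.ne'
  have hy : Real.sin y ≠ 0 := right_ne_zero_of_mul hpos.ne'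
  have h1 : Real.cot x - Real.cot y = Real.sin (y - x) / (Real.sin x * Real.sin y) := by
    rw [Real.cot_eq_cos_div_sin, Real.cot_eq_cos_div_sin, div_sub_div _ _ hx hy, Real.sin_sub]
    ring
  have h2 : 0 ≤ Real.sin (y - x) := Real.sin_nonneg_of_nonneg_of_le_pi (by linarith) hlt
  have := div_nonneg h2 hpos.le
  linarith

/-- Each cotangent decreases between its poles, and only the pole at `0` is kept on the left. Its
weight will be `a₀²`. -/
theorem sum_cot_sub_le {a γ : κ → ℝ} (ha : ∀ k, 0 ≤ a k)
    (hγ : ∀ k, a k ≠ 0 → -Real.pi < γ k ∧ γ k < Real.pi) {α β β' : ℝ} (hαpi : α < Real.pi)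
    (hbet : ∀ k, a k ≠ 0 → γ k ≤ 0 ∨ α < γ k) (hβ : 0 < β) (hββ : β ≤ β') (hβα : β' ≤ α) :
    (∑ k ∈ Finset.univ.filter fun k => γ k = 0, a k) * (Real.cot (β / 2) - Real.cot (β' / 2))
      ≤ ∑ k, a k * Real.cot ((β - γ k) / 2) - ∑ k, a k * Real.cot ((β' - γ k) / 2) := by
  rw [← Finset.sum_sub_distrib, Finset.sum_mul, Finset.sum_filter]
  refine Finset.sum_le_sum fun k _ => ?_
  split_ifs with h
  · rw [h, sub_zero, sub_zero, mul_sub]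
  · by_cases hk : a k = 0
    · simp [hk]
    rw [← mul_sub]
    refine mul_nonneg (ha k) (sub_nonneg.2 (cot_le_cot (by linarith) ?_ (by linarith)))
    have h1 := hγ k hk
    rcases hbet k hk with h2 | h2
    · exact mul_pos (Real.sin_pos_of_pos_of_lt_pi (by linarith) (by linarith))
        (Real.sin_pos_of_pos_of_lt_pi (by linarith) (by linarith))
    · exact mul_pos_of_neg_of_neg (Real.sin_neg_of_neg_of_neg_pi_lt (by linarith) (by linarith))
        (Real.sin_neg_of_neg_of_neg_pi_lt (by linarith) (by linarith))

theorem cot_sq_add_cot_sq {β γ : ℝ} (h1 : Real.sin ((β - γ) / 2) ≠ 0)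
    (h2 : Real.sin ((β + γ) / 2) ≠ 0) :
    Real.cot ((β - γ) / 2) ^ 2 + Real.cot ((β + γ) / 2) ^ 2 + 2
      = 4 * (1 - Real.cos β * Real.cos γ) / (Real.cos β - Real.cos γ) ^ 2 := by
  have e1 : Real.cos β - Real.cos γ = -2 * (Real.sin ((β + γ) / 2) * Real.sin ((β - γ) / 2)) := by
    rw [Real.cos_sub_cos]; ring
  have e2 : Real.cos β = Real.cos ((β + γ) / 2 + (β - γ) / 2) := by congr 1; ring
  have e3 : Real.cos γ = Real.cos ((β + γ) / 2 - (β - γ) / 2) := by congr 1; ring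
  rw [e1, e2, e3, Real.cos_add, Real.cos_sub, Real.cot_eq_cos_div_sin, Real.cot_eq_cos_div_sin]
  have q1 := Real.cos_sq' ((β - γ) / 2)
  have q2 := Real.cos_sq' ((β + γ) / 2)
  generalize Real.sin ((β - γ) / 2) = s at *
  generalize Real.sin ((β + γ) / 2) = s' at *
  generalize Real.cos ((β - γ) / 2) = r at *
  generalize Real.cos ((β + γ) / 2) = r' at *
  field_simp
  linear_combination 4 * (s' ^ 2 + r' ^ 2) * q1 + 4 * q2

/-- A single `cot²` need not be monotone, but by `cot_sq_add_cot_sq` the sum over `±γ` is a rational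
function of `cos β`, which increases as `cos β` decreases towards `cos γ`. -/
theorem cot_sq_add_cot_sq_le {β β' γ : ℝ} (hβ : 0 < β) (hββ : β ≤ β') (hβγ : β' < |γ|)
    (hγ : |γ| < Real.pi) :
    Real.cot ((β - γ) / 2) ^ 2 + Real.cot ((β + γ) / 2) ^ 2
      ≤ Real.cot ((β' - γ) / 2) ^ 2 + Real.cot ((β' + γ) / 2) ^ 2 := by
  have hne : ∀ x, 0 < x → x < |γ| → Real.sin ((x - γ) / 2) ≠ 0 ∧ Real.sin ((x + γ) / 2) ≠ 0 :=
    fun x hx hxγ => by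
      have h1 := abs_lt.1 hγ
      have h2 : x ≠ γ := by rintro rfl; rw [abs_of_pos hx] at hxγ; exact lt_irrefl _ hxγ
      have h3 : x ≠ -γ := by
        rintro rfl; rw [abs_of_neg (by linarith)] at hxγ; exact lt_irrefl _ hxγ
      refine ⟨sin_half_sub_ne_zero hx.le (by linarith) h1.1 h1.2 h2, ?_⟩
      rw [← sub_neg_eq_add]
      exact sin_half_sub_ne_zero hx.le (by linarith) (by linarith) (by linarith) h3
  have e1 := cot_sq_add_cot_sq (hne β hβ (by linarith)).1 (hne β hβ (by linarith)).2
  have e2 := cot_sq_add_cot_sq (hne β' (by linarith) hβγ).1 (hne β' (by linarith) hβγ).2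
  have hb1 : Real.cos β' ≤ Real.cos β := Real.cos_le_cos_of_nonneg_of_le_pi hβ.le (by linarith) hββ
  have hb2 : Real.cos γ < Real.cos β' := by
    rw [← Real.cos_abs γ]
    exact Real.cos_lt_cos_of_nonneg_of_le_pi (by linarith) hγ.le hβγ
  have hb3 := Real.cos_le_one β
  have hb4 := Real.neg_one_le_cos γ
  generalize Real.cos β = b at *
  generalize Real.cos β' = b' at *
  generalize Real.cos γ = g at *
  have hp : 0 < b' - g := by linarith
  have hd : 0 ≤ b - b' := by linarith
  have key : 4 * (1 - b * g) / (b - g) ^ 2 ≤ 4 * (1 - b' * g) / (b' - g) ^ 2 := by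
    rw [div_le_div_iff₀ (by nlinarith) (by positivity)]
    have h1 : 0 ≤ 1 - b' * g := by nlinarith
    have h2 : 0 ≤ 2 - b' * g - g ^ 2 := by nlinarith
    -- The difference of the cross products, with the common factor `b - b'` taken out.
    have h3 : 0 ≤ (b - b') * ((1 - b' * g) * (b - b') + (b' - g) * (2 - b' * g - g ^ 2)) :=
      mul_nonneg hd (add_nonneg (mul_nonneg h1 hd) (mul_nonneg hp.le h2))
    linarith
  linarith

/-- The symmetry is tested on the indicator of `(0, α]`: there is no mass there, hence none on its
mirror image. -/
theorem abs_gt_of_symm {a γ : κ → ℝ} (ha : ∀ k, 0 ≤ a k)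
    (hsymm : ∀ f : ℝ → ℝ, ∑ k, a k * f (-γ k) = ∑ k, a k * f (γ k)) {α : ℝ}
    (hbet : ∀ k, a k ≠ 0 → γ k ≤ 0 ∨ α < γ k) (k : κ) (hk : a k ≠ 0) (hk0 : γ k ≠ 0) :
    α < |γ k| := by
  rcases lt_or_gt_of_ne hk0 with h | h
  · by_contra hc
    rw [abs_of_neg h, not_lt] at hc
    have h1 := hsymm fun x => if 0 < x ∧ x ≤ α then 1 else 0
    have h2 : ∑ k, a k * (if 0 < γ k ∧ γ k ≤ α then 1 else 0) = 0 := by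
      refine Finset.sum_eq_zero fun j _ => ?_
      by_cases hj : a j = 0
      · simp [hj]
      rw [if_neg, mul_zero]
      rintro ⟨h3, h4⟩
      rcases hbet j hj with h5 | h5 <;> linarith
    rw [h2, Finset.sum_eq_zero_iff_of_nonneg
      (fun j _ => mul_nonneg (ha j) (by split_ifs <;> norm_num))] at h1
    have h3 := h1 k (Finset.mem_univ _)
    rw [if_pos ⟨by linarith, hc⟩, mul_one] at h3
    exact hk h3
  · rw [abs_of_pos h]
    rcases hbet k hk with h5 | h5 <;> linarith

/-- Doubling the sum pairs `γ` with `-γ`, which makes the terms with `γ k ≠ 0` monotone; the pole at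
`0` is accounted for exactly. -/
theorem sum_cot_sq_le {a γ : κ → ℝ} (ha : ∀ k, 0 ≤ a k)
    (hγ : ∀ k, a k ≠ 0 → -Real.pi < γ k ∧ γ k < Real.pi)
    (hsymm : ∀ f : ℝ → ℝ, ∑ k, a k * f (-γ k) = ∑ k, a k * f (γ k)) {α β : ℝ}
    (hbet : ∀ k, a k ≠ 0 → γ k ≤ 0 ∨ α < γ k) (hβ : 0 < β) (hβα : β ≤ α) :
    ∑ k, a k * Real.cot ((β - γ k) / 2) ^ 2
      ≤ ∑ k, a k * Real.cot ((α - γ k) / 2) ^ 2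
        + (∑ k ∈ Finset.univ.filter fun k => γ k = 0, a k)
          * (Real.cot (β / 2) ^ 2 - Real.cot (α / 2) ^ 2) := by
  have hdouble : ∀ x : ℝ, 2 * ∑ k, a k * Real.cot ((x - γ k) / 2) ^ 2
      = ∑ k, a k * (Real.cot ((x - γ k) / 2) ^ 2 + Real.cot ((x + γ k) / 2) ^ 2) := fun x => by
    have h1 := hsymm fun y => Real.cot ((x - y) / 2) ^ 2
    simp only [sub_neg_eq_add] at h1
    simp only [mul_add, Finset.sum_add_distrib]
    rw [h1]; ring
  have key : ∑ k, a k * (Real.cot ((β - γ k) / 2) ^ 2 + Real.cot ((β + γ k) / 2) ^ 2)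
      ≤ ∑ k, a k * (Real.cot ((α - γ k) / 2) ^ 2 + Real.cot ((α + γ k) / 2) ^ 2)
        + 2 * ((∑ k ∈ Finset.univ.filter fun k => γ k = 0, a k)
          * (Real.cot (β / 2) ^ 2 - Real.cot (α / 2) ^ 2)) := by
    rw [Finset.sum_mul, Finset.mul_sum, Finset.sum_filter, ← Finset.sum_add_distrib]
    refine Finset.sum_le_sum fun k _ => ?_
    split_ifs with h
    · rw [h]; simp only [sub_zero, add_zero]; apply le_of_eq; ring
    · by_cases hk : a k = 0
      · simp [hk]
      rw [add_zero]
      exact mul_le_mul_of_nonneg_left (cot_sq_add_cot_sq_le hβ hβα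
        (abs_gt_of_symm ha hsymm hbet k hk h) (abs_lt.2 (hγ k hk))) (ha k)
  rw [← hdouble, ← hdouble] at key
  linarith

end WeightedCot

/-! ### The modified operator as an extended unitary times a reflection. -/

section ModifiedSearch

variable {n κ : Type*} [Fintype n] [DecidableEq n] [Fintype κ] [DecidableEq κ]

theorem ketTheta_eq (θ : ℝ) : ketTheta θ = cvec ![Real.cos θ, -Real.sin θ] := by
  ext i
  fin_cases i <;> simp [ketTheta, rotMatrix, cmat, ket, cvec, Matrix.conjTranspose_apply,
    -Complex.ofReal_cos, -Complex.ofReal_sin]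

theorem ketThetaPerp_eq (θ : ℝ) : ketThetaPerp θ = cvec ![Real.sin θ, Real.cos θ] := by
  ext i
  fin_cases i <;> simp [ketThetaPerp, rotMatrix, cmat, ket, cvec, Matrix.conjTranspose_apply,
    -Complex.ofReal_cos, -Complex.ofReal_sin]

theorem ket_one_eq : (ket 1 : Fin 2 → ℂ) = cvec ![0, 1] := by
  ext i
  fin_cases i <;> simp [ket, cvec]

theorem braket_ketTheta_self (θ : ℝ) : braket (ketTheta θ) (ketTheta θ) = 1 := by
  rw [ketTheta_eq, braket_cvec]
  norm_cast
  simp [← sq]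

theorem braket_ketThetaPerp_self (θ : ℝ) : braket (ketThetaPerp θ) (ketThetaPerp θ) = 1 := by
  rw [ketThetaPerp_eq, braket_cvec]
  norm_cast
  simp [← sq]

theorem braket_ketTheta_ketThetaPerp (θ : ℝ) : braket (ketTheta θ) (ketThetaPerp θ) = 0 := by
  rw [ketTheta_eq, ketThetaPerp_eq, braket_cvec]
  norm_cast
  simp; ring

theorem braket_ketThetaPerp_ketTheta (θ : ℝ) : braket (ketThetaPerp θ) (ketTheta θ) = 0 := by
  rw [← star_braket, braket_ketTheta_ketThetaPerp, star_zero]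

theorem braket_ketTheta_ket_one (θ : ℝ) :
    braket (ketTheta θ) (ket 1) = ((-Real.sin θ : ℝ) : ℂ) := by
  rw [ketTheta_eq, ket_one_eq, braket_cvec]
  simp

theorem braket_ketThetaPerp_ket_one (θ : ℝ) :
    braket (ketThetaPerp θ) (ket 1) = ((Real.cos θ : ℝ) : ℂ) := by
  rw [ketThetaPerp_eq, ket_one_eq, braket_cvec]
  simp

theorem ketbra_ketTheta_add (θ : ℝ) : ketbra (ketTheta θ) + ketbra (ketThetaPerp θ) = 1 := by
  have h := Complex.sin_sq_add_cos_sq (θ : ℂ)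
  ext i j
  rw [ketTheta_eq, ketThetaPerp_eq]
  fin_cases i <;> fin_cases j <;>
    simp [ketbra, Matrix.vecMulVec, cvec, -Complex.ofReal_cos, -Complex.ofReal_sin]
  · rw [← h]; push_cast; ring
  · ring
  · ring
  · rw [← h]; push_cast; ring

theorem ket_zero_add_ket_one : ketbra (ket 0 : Fin 2 → ℂ) + ketbra (ket 1) = 1 := by
  ext i j
  fin_cases i <;> fin_cases j <;> simp [ketbra, Matrix.vecMulVec, ket]

theorem ketbra_tensor {ι : Type*} (u : ι → ℂ) (v : n → ℂ) :
    ketbra (tensor u v) = ketbra u ⊗ₖ ketbra v := by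
  ext ⟨i, j⟩ ⟨i', j'⟩
  simp [ketbra, Matrix.vecMulVec, tensor]
  ring

/-- The operator `|θ⟩⟨θ| ⊗ (-I) + |θ^⊥⟩⟨θ^⊥| ⊗ A`. -/
noncomputable def extendedOp (A : Matrix n n ℂ) (θ : ℝ) : Matrix (Fin 2 × n) (Fin 2 × n) ℂ :=
  ketbra (ketTheta θ) ⊗ₖ (-1 : Matrix n n ℂ) + ketbra (ketThetaPerp θ) ⊗ₖ A

/-- The controlled reflection `|0⟩⟨0| ⊗ I + |1⟩⟨1| ⊗ U₁` is itself the reflection about `|1⟩|μ⟩`, so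
the modified operator has the form treated by the secular equation. -/
theorem modifiedSearchOp_eq (A : Matrix n n ℂ) (μ : n → ℂ) (θ : ℝ) :
    modifiedSearchOp (1 - (2 : ℂ) • ketbra μ) A θ
      = extendedOp A θ * (1 - (2 : ℂ) • ketbra (tensor (ket 1) μ)) := by
  rw [modifiedSearchOp, extendedOp, ketbra_tensor]
  congr 1
  rw [sub_eq_add_neg, ← neg_smul, Matrix.kronecker_add, Matrix.kronecker_smul, ← add_assoc,
    ← Matrix.add_kronecker, ket_zero_add_ket_one, Matrix.one_kronecker_one, neg_smul,
    ← sub_eq_add_neg]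

theorem extendedOp_mem_unitaryGroup {A : Matrix n n ℂ} (hA : A ∈ Matrix.unitaryGroup n ℂ)
    (θ : ℝ) : extendedOp A θ ∈ Matrix.unitaryGroup (Fin 2 × n) ℂ := by
  have h0 : ∀ u v : Fin 2 → ℂ, braket u v = 0 → ketbra u * ketbra v = 0 := fun u v huv => by
    rw [ketbra, ketbra, Matrix.vecMulVec_mul_vecMulVec, show star u ⬝ᵥ v = 0 from huv, zero_smul]
    ext i j
    simp [Matrix.vecMulVec]
  rw [Matrix.mem_unitaryGroup_iff, Matrix.star_eq_conjTranspose] at *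
  rw [extendedOp, Matrix.conjTranspose_add, Matrix.conjTranspose_kronecker,
    Matrix.conjTranspose_kronecker, ketbra_conjTranspose, ketbra_conjTranspose, add_mul, mul_add,
    mul_add, ← Matrix.mul_kronecker_mul, ← Matrix.mul_kronecker_mul, ← Matrix.mul_kronecker_mul,
    ← Matrix.mul_kronecker_mul, ketbra_mul_self (braket_ketTheta_self θ),
    ketbra_mul_self (braket_ketThetaPerp_self θ), h0 _ _ (braket_ketTheta_ketThetaPerp θ),
    h0 _ _ (braket_ketThetaPerp_ketTheta θ), hA, Matrix.zero_kronecker, Matrix.zero_kronecker,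
    add_zero, zero_add, Matrix.conjTranspose_neg, Matrix.conjTranspose_one, neg_mul_neg, one_mul,
    ← Matrix.add_kronecker, ketbra_ketTheta_add, Matrix.one_kronecker_one]

theorem extendedOp_mulVec_tensor (A : Matrix n n ℂ) (θ : ℝ) (x : Fin 2 → ℂ) (v : n → ℂ) :
    extendedOp A θ *ᵥ tensor x v
      = braket (ketTheta θ) x • tensor (ketTheta θ) (-v)
        + braket (ketThetaPerp θ) x • tensor (ketThetaPerp θ) (A *ᵥ v) := by
  rw [extendedOp, Matrix.add_mulVec, kronecker_mulVec_tensor, kronecker_mulVec_tensor,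
    ketbra_mulVec, ketbra_mulVec, tensor_smul_left, tensor_smul_left, Matrix.neg_mulVec,
    Matrix.one_mulVec]

theorem extendedOp_mulVec_theta (A : Matrix n n ℂ) (θ : ℝ) (v : n → ℂ) :
    extendedOp A θ *ᵥ tensor (ketTheta θ) v
      = Complex.exp (Real.pi * Complex.I) • tensor (ketTheta θ) v := by
  rw [extendedOp_mulVec_tensor, braket_ketTheta_self, braket_ketThetaPerp_ketTheta, one_smul,
    zero_smul, add_zero, Complex.exp_pi_mul_I, ← tensor_smul_right, neg_one_smul]

theorem extendedOp_mulVec_thetaPerp {A : Matrix n n ℂ} (θ : ℝ) {v : n → ℂ} {z : ℂ}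
    (h : A *ᵥ v = z • v) :
    extendedOp A θ *ᵥ tensor (ketThetaPerp θ) v = z • tensor (ketThetaPerp θ) v := by
  rw [extendedOp_mulVec_tensor, braket_ketThetaPerp_self, braket_ketTheta_ketThetaPerp, one_smul,
    zero_smul, zero_add, h, tensor_smul_right]

theorem ket_one_eq_ketTheta (θ : ℝ) : (ket 1 : Fin 2 → ℂ)
    = ((-Real.sin θ : ℝ) : ℂ) • ketTheta θ + ((Real.cos θ : ℝ) : ℂ) • ketThetaPerp θ := by
  rw [← braket_ketTheta_ket_one, ← braket_ketThetaPerp_ket_one, ← ketbra_mulVec, ← ketbra_mulVec,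
    ← Matrix.add_mulVec, ketbra_ketTheta_add, Matrix.one_mulVec]

theorem sum_smul_tensor_ket (v : Fin 2 × n → ℂ) :
    ∑ p : Fin 2 × n, v p • tensor (ket p.1) (ket p.2) = v := by
  ext ⟨i, j⟩
  rw [Finset.sum_apply, Finset.sum_eq_single (i, j)]
  · simp [tensor, ket]
  · rintro ⟨i', j'⟩ _ hne
    simp only [Pi.smul_apply, tensor, ket, Pi.single_apply, smul_eq_mul]
    by_cases h1 : i = i'
    · by_cases h2 : j = j'
      · exact absurd (by rw [h1, h2]) hne
      · simp [h2]
    · simp [h1]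
  · simp

/-- The phases of the eigenbasis of `extendedOp A θ` obtained from an eigenbasis of `A`. -/
noncomputable def extendedPhase (γ : κ → ℝ) (j : Fin 2 × κ) : ℝ :=
  if j.1 = 0 then Real.pi else γ j.2

/-- The eigenbasis of `extendedOp A θ` obtained from an eigenbasis of `A`. -/
noncomputable def extendedBasis (c : κ → n → ℂ) (θ : ℝ) (j : Fin 2 × κ) : Fin 2 × n → ℂ :=
  tensor (if j.1 = 0 then ketTheta θ else ketThetaPerp θ) (c j.2)

theorem IsEigenbasis.extended {A : Matrix n n ℂ} {c : κ → n → ℂ} {γ : κ → ℝ}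
    (h : IsEigenbasis A c γ) (θ : ℝ) :
    IsEigenbasis (extendedOp A θ) (extendedBasis c θ) (extendedPhase γ) := by
  refine ⟨?_, ?_, ?_, ?_, ?_⟩
  · rintro ⟨i, k⟩ ⟨i', k'⟩
    rw [extendedBasis, extendedBasis, braket_tensor, h.ortho]
    fin_cases i <;> fin_cases i' <;>
      simp [braket_ketTheta_self, braket_ketThetaPerp_self, braket_ketTheta_ketThetaPerp,
        braket_ketThetaPerp_ketTheta]
  · intro u v
    have h2 : ∀ x x' : Fin 2 → ℂ, ∑ i : Fin 2,
        braket x (if i = 0 then ketTheta θ else ketThetaPerp θ)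
          * braket (if i = 0 then ketTheta θ else ketThetaPerp θ) x' = braket x x' := fun x x' => by
      rw [Fin.sum_univ_two]
      simp only [if_true, one_ne_zero, if_false]
      conv_rhs => rw [← Matrix.one_mulVec x', ← ketbra_ketTheta_add θ, Matrix.add_mulVec,
        ketbra_mulVec, ketbra_mulVec, braket_add_right, braket_smul_right, braket_smul_right]
      ring
    have hprod : ∀ (p q : Fin 2 × n), ∑ j, braket (tensor (ket p.1) (ket p.2)) (extendedBasis c θ j)
        * braket (extendedBasis c θ j) (tensor (ket q.1) (ket q.2))
        = braket (tensor (ket p.1) (ket p.2)) (tensor (ket q.1) (ket q.2)) := fun p q => by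
      simp only [extendedBasis, braket_tensor, Fintype.sum_prod_type]
      rw [← h2, ← h.complete, Finset.sum_mul_sum]
      exact Finset.sum_congr rfl fun i _ => Finset.sum_congr rfl fun k _ => by ring
    have hright : ∀ (p : Fin 2 × n), ∑ j, braket (tensor (ket p.1) (ket p.2)) (extendedBasis c θ j)
        * braket (extendedBasis c θ j) v = braket (tensor (ket p.1) (ket p.2)) v := fun p => by
      rw [← sum_smul_tensor_ket v]
      simp only [braket_sum_right, braket_smul_right, Finset.mul_sum]
      rw [Finset.sum_comm]
      refine Finset.sum_congr rfl fun q _ => ?_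
      rw [← hprod p q, Finset.mul_sum]
      exact Finset.sum_congr rfl fun j _ => by ring
    rw [← sum_smul_tensor_ket u]
    simp only [braket_sum_left, braket_smul_left, Finset.sum_mul]
    rw [Finset.sum_comm]
    refine Finset.sum_congr rfl fun p _ => ?_
    rw [← hright p, Finset.mul_sum]
    exact Finset.sum_congr rfl fun j _ => by ring
  · rintro ⟨i, k⟩
    fin_cases i
    · exact extendedOp_mulVec_theta A θ (c k)
    · exact extendedOp_mulVec_thetaPerp θ (h.eig k)
  · rintro ⟨i, k⟩
    rw [extendedPhase]
    split_ifs
    · linarith [Real.pi_pos]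
    · exact h.neg_pi_lt k
  · rintro ⟨i, k⟩
    rw [extendedPhase]
    split_ifs
    · exact le_rfl
    · exact h.le_pi k

theorem cot_half_sub_pi (β : ℝ) : Real.cot ((β - Real.pi) / 2) = -Real.tan (β / 2) := by
  rw [Real.cot_eq_cos_div_sin, Real.tan_eq_sin_div_cos,
    show (β - Real.pi) / 2 = β / 2 - Real.pi / 2 by ring, Real.cos_sub_pi_div_two,
    Real.sin_sub_pi_div_two, div_neg]

theorem sin_half_sub_pi (β : ℝ) : Real.sin ((β - Real.pi) / 2) = -Real.cos (β / 2) := by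
  rw [show (β - Real.pi) / 2 = β / 2 - Real.pi / 2 by ring, Real.sin_sub_pi_div_two]

theorem norm_braket_extendedBasis (c : κ → n → ℂ) (θ : ℝ) (μ : n → ℂ) (i : Fin 2) (k : κ) :
    ‖braket (extendedBasis c θ (i, k)) (tensor (ket 1) μ)‖ ^ 2
      = (if i = 0 then Real.sin θ ^ 2 else Real.cos θ ^ 2) * ‖braket (c k) μ‖ ^ 2 := by
  rw [extendedBasis, braket_tensor, norm_mul, mul_pow]
  congr 1
  fin_cases i
  · simp [braket_ketTheta_ket_one, -Complex.ofReal_sin]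
  · simp [braket_ketThetaPerp_ket_one, -Complex.ofReal_cos]

/-- The eigenvectors `|θ⟩|c k⟩` all have phase `π` and carry total weight `sin² θ` of the target.
They contribute the tangent, since `cot((β - π)/2) = -tan(β/2)`. -/
theorem cotSum_extended {A : Matrix n n ℂ} {c : κ → n → ℂ} {γ : κ → ℝ} (h : IsEigenbasis A c γ)
    {μ : n → ℂ} (hμ : braket μ μ = 1) (θ β : ℝ) :
    cotSum (extendedBasis c θ) (extendedPhase γ) (tensor (ket 1) μ) β
      = Real.cos θ ^ 2 * cotSum c γ μ β - Real.sin θ ^ 2 * Real.tan (β / 2) := by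
  rw [cotSum, Fintype.sum_prod_type, Fin.sum_univ_two]
  simp only [norm_braket_extendedBasis, extendedPhase, if_true, one_ne_zero, if_false,
    cot_half_sub_pi, mul_assoc]
  rw [← Finset.mul_sum, ← Finset.mul_sum, ← Finset.sum_mul, h.sum_weight hμ, cotSum]
  ring

theorem cotSqSum_extended {A : Matrix n n ℂ} {c : κ → n → ℂ} {γ : κ → ℝ} (h : IsEigenbasis A c γ)
    {μ : n → ℂ} (hμ : braket μ μ = 1) (θ β : ℝ) :
    cotSqSum (extendedBasis c θ) (extendedPhase γ) (tensor (ket 1) μ) β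
      = Real.cos θ ^ 2 * cotSqSum c γ μ β + Real.sin θ ^ 2 * Real.tan (β / 2) ^ 2 := by
  rw [cotSqSum, Fintype.sum_prod_type, Fin.sum_univ_two]
  simp only [norm_braket_extendedBasis, extendedPhase, if_true, one_ne_zero, if_false,
    cot_half_sub_pi, mul_assoc, neg_sq]
  rw [← Finset.mul_sum, ← Finset.mul_sum, ← Finset.sum_mul, h.sum_weight hμ, cotSqSum]
  ring

theorem braket_tensor_ket_one_self {μ : n → ℂ} (hμ : braket μ μ = 1) :
    braket (tensor (ket 1 : Fin 2 → ℂ) μ) (tensor (ket 1) μ) = 1 := by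
  rw [braket_tensor, hμ, ket_one_eq, braket_cvec]; simp

/-- The overlap of an eigenvector of the modified search operator with `|θ⟩|μ⟩`. -/
theorem braket_theta_of_eig {A : Matrix n n ℂ} (hA : A ∈ Matrix.unitaryGroup n ℂ) {μ : n → ℂ}
    (hμ : braket μ μ = 1) {θ β : ℝ} (hc : Real.cos (β / 2) ≠ 0) {w : Fin 2 × n → ℂ}
    (hw : (extendedOp A θ * (1 - (2 : ℂ) • ketbra (tensor (ket 1) μ))) *ᵥ w
      = Complex.exp (β * Complex.I) • w) :
    braket (tensor (ketTheta θ) μ) w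
      = -((Real.sin θ : ℂ) * (1 - Complex.I * Real.tan (β / 2)))
        * braket (tensor (ket 1) μ) w := by
  rw [braket_of_eig (extendedOp_mem_unitaryGroup hA θ) (extendedOp_mulVec_theta A θ μ) hw
    (by rw [sin_half_sub_pi]; exact neg_ne_zero.2 hc), cot_half_sub_pi, braket_tensor, hμ,
    braket_ketTheta_ket_one]
  push_cast; ring

/-- The overlap of an eigenvector of the modified search operator with `|θ^⊥⟩(|φ₀⟩ - a₀|μ⟩)`. -/
theorem braket_start_of_eig {A : Matrix n n ℂ} (hA : A ∈ Matrix.unitaryGroup n ℂ)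
    {μ φ₀ : n → ℂ} (hμ : braket μ μ = 1) (hφ : A *ᵥ φ₀ = φ₀) {a₀ : ℝ} (ha : braket φ₀ μ = a₀)
    {θ β : ℝ} (hθ : Real.cos θ ≠ 0) (hs : Real.sin (β / 2) ≠ 0) (hc : Real.cos (β / 2) ≠ 0)
    {w : Fin 2 × n → ℂ}
    (hw : (extendedOp A θ * (1 - (2 : ℂ) • ketbra (tensor (ket 1) μ))) *ᵥ w
      = Complex.exp (β * Complex.I) • w) :
    braket (tensor (ketThetaPerp θ) (φ₀ - (a₀ : ℂ) • μ)) w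
      = Complex.I * ((a₀ * Real.cos θ * (Real.cot (β / 2) - Real.tan θ ^ 2 * Real.tan (β / 2)) : ℝ)
        : ℂ) * braket (tensor (ket 1) μ) w := by
  have h1 := braket_theta_of_eig hA hμ hc hw
  have h2 : braket (tensor (ketThetaPerp θ) φ₀) w
      = (1 + Complex.I * Real.cot (β / 2)) * (Real.cos θ * a₀) * braket (tensor (ket 1) μ) w := by
    have hφ' : extendedOp A θ *ᵥ tensor (ketThetaPerp θ) φ₀
        = Complex.exp ((0 : ℝ) * Complex.I) • tensor (ketThetaPerp θ) φ₀ := by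
      have := extendedOp_mulVec_thetaPerp θ (z := 1) (by rw [hφ, one_smul])
      simpa using this
    have := braket_of_eig (extendedOp_mem_unitaryGroup hA θ) hφ' hw (by rwa [sub_zero])
    rw [this, sub_zero, braket_tensor, braket_ketThetaPerp_ket_one, ha]
    ring
  -- `|θ^⊥⟩|μ⟩` need not be an eigenvector of `extendedOp`. Its overlap is eliminated by writing
  -- `|1⟩` in the basis `|θ⟩, |θ^⊥⟩`, and `|θ⟩|μ⟩` is an eigenvector.
  have h3 : braket (tensor (ket 1) μ) w
      = -Real.sin θ * braket (tensor (ketTheta θ) μ) w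
        + Real.cos θ * braket (tensor (ketThetaPerp θ) μ) w := by
    rw [ket_one_eq_ketTheta θ, tensor_add_left, tensor_smul_left, tensor_smul_left,
      braket_add_left, braket_smul_left, braket_smul_left, Complex.star_def,
      Complex.conj_ofReal, Complex.conj_ofReal]
    push_cast; ring
  rw [tensor_sub_right, tensor_smul_right, braket_sub_left, braket_smul_left, h2,
    Complex.star_def, Complex.conj_ofReal]
  rw [h1] at h3
  have hcθ : (Real.cos θ : ℂ) ≠ 0 := by exact_mod_cast hθ
  have h4 : (Real.sin θ : ℂ) ^ 2 + (Real.cos θ : ℂ) ^ 2 = 1 := by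
    exact_mod_cast Real.sin_sq_add_cos_sq θ
  apply mul_left_cancel₀ hcθ
  rw [Real.tan_eq_sin_div_cos θ]
  rw [Complex.ofReal_mul, Complex.ofReal_mul, Complex.ofReal_sub, Complex.ofReal_mul,
    Complex.ofReal_pow, Complex.ofReal_div]
  generalize braket (tensor (ket 1) μ) w = x at *
  generalize braket (tensor (ketThetaPerp θ) μ) w = y at *
  generalize (Real.cos θ : ℂ) = r at *
  generalize (Real.sin θ : ℂ) = s at *
  field_simp
  linear_combination (a₀ : ℂ) * h3 + (a₀ : ℂ) * x * h4

theorem real_extendedOp {A : Matrix n n ℂ} (hA : A.map star = A) {μ : n → ℂ} (hμ : star μ = μ)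
    (θ : ℝ) :
    (extendedOp A θ * (1 - (2 : ℂ) • ketbra (tensor (ket 1) μ))).map star
      = extendedOp A θ * (1 - (2 : ℂ) • ketbra (tensor (ket 1) μ)) := by
  have hket : ∀ {ι : Type} (u : ι → ℂ), star u = u → ∀ i j, star (ketbra u i j) = ketbra u i j :=
    fun u hu i j => by
      have := fun i => congrFun hu i
      simp only [Pi.star_apply] at this
      simp [ketbra, Matrix.vecMulVec, this]
  have hA' : ∀ i j, star (A i j) = A i j := fun i j => congrFun (congrFun hA i) j
  have h1 : ∀ i j, star (extendedOp A θ i j) = extendedOp A θ i j := by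
    rintro ⟨i, j⟩ ⟨i', j'⟩
    simp only [extendedOp, Matrix.add_apply, Matrix.kroneckerMap_apply, star_add, star_mul',
      hket _ (show star (ketTheta θ) = ketTheta θ by rw [ketTheta_eq, star_cvec]),
      hket _ (show star (ketThetaPerp θ) = ketThetaPerp θ by rw [ketThetaPerp_eq, star_cvec]), hA',
      Matrix.neg_apply, star_neg, Matrix.one_apply]
    split_ifs <;> simp
  have hm : ∀ p, star (tensor (ket 1 : Fin 2 → ℂ) μ p) = tensor (ket 1) μ p := fun p => by
    have h2 : star (μ p.2) = μ p.2 := congrFun hμ p.2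
    have h3 : star ((ket 1 : Fin 2 → ℂ) p.1) = ket 1 p.1 := by
      rw [ket_one_eq]; exact congrFun (star_cvec _) p.1
    rw [tensor, star_mul', h2, h3]
  have h2 : ∀ i j, star ((1 - (2 : ℂ) • ketbra (tensor (ket 1 : Fin 2 → ℂ) μ)) i j)
      = (1 - (2 : ℂ) • ketbra (tensor (ket 1) μ)) i j := fun i j => by
    simp only [Matrix.sub_apply, Matrix.smul_apply, star_sub, star_smul, ketbra, Matrix.vecMulVec,
      Matrix.of_apply, Pi.star_apply, star_mul', hm, Matrix.one_apply]
    split_ifs <;> simp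
  ext i j
  rw [Matrix.map_apply, Matrix.mul_apply, star_sum]
  exact Finset.sum_congr rfl fun k _ => by rw [star_mul', h1, h2]

theorem star_tensor_ket_one {μ : n → ℂ} (hμ : star μ = μ) :
    star (tensor (ket 1 : Fin 2 → ℂ) μ) = tensor (ket 1) μ := by
  ext p
  have h2 : star (μ p.2) = μ p.2 := congrFun hμ p.2
  have h3 : star ((ket 1 : Fin 2 → ℂ) p.1) = ket 1 p.1 := by
    rw [ket_one_eq]; exact congrFun (star_cvec _) p.1
  rw [Pi.star_apply, tensor, star_mul', h2, h3]

end ModifiedSearch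

/-! ### Real search operators, the hitting time and the principal eigenphase. -/

section RealSearch

variable {n κ : Type*} [Fintype n] [DecidableEq n] [Fintype κ] [DecidableEq κ]

theorem cmat_mem_unitaryGroup {A : Matrix n n ℝ} (hA : A ∈ Matrix.orthogonalGroup n ℝ) :
    cmat A ∈ Matrix.unitaryGroup n ℂ := by
  rw [Matrix.mem_orthogonalGroup_iff] at hA
  rw [Matrix.mem_unitaryGroup_iff]
  ext i j
  have h := congrFun (congrFun hA i) j
  simp only [Matrix.mul_apply, Matrix.transpose_apply, Matrix.one_apply] at h
  simp only [Matrix.mul_apply, Matrix.star_apply, cmat, Matrix.map_apply, Matrix.one_apply,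
    Complex.star_def, Complex.conj_ofReal]
  have h' := congrArg (fun x : ℝ => (x : ℂ)) h
  push_cast at h'
  rw [h']
  split_ifs <;> simp

theorem cmat_map_star (A : Matrix n n ℝ) : (cmat A).map star = cmat A := by
  ext i j; simp [cmat]

theorem cmat_mulVec_cvec (A : Matrix n n ℝ) (v : n → ℝ) : cmat A *ᵥ cvec v = cvec (A *ᵥ v) := by
  ext i; simp [cmat, cvec, Matrix.mulVec, dotProduct]

theorem re_cmat_mulVec (A : Matrix n n ℝ) (v : n → ℂ) (i : n) :
    ((cmat A *ᵥ v) i).re = (A *ᵥ fun j => (v j).re) i := by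
  simp [cmat, Matrix.mulVec, dotProduct]

theorem im_cmat_mulVec (A : Matrix n n ℝ) (v : n → ℂ) (i : n) :
    ((cmat A *ᵥ v) i).im = (A *ᵥ fun j => (v j).im) i := by
  simp [cmat, Matrix.mulVec, dotProduct]

theorem exists_eq_smul_of_fixed {A : Matrix n n ℝ} {φ : n → ℝ}
    (h : ∀ v : n → ℝ, A *ᵥ v = v → ∃ r : ℝ, v = r • φ) {v : n → ℂ} (hv : cmat A *ᵥ v = v) :
    ∃ z : ℂ, v = z • cvec φ := by
  obtain ⟨r, hr⟩ := h (fun j => (v j).re) (by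
    ext i; rw [← re_cmat_mulVec, hv])
  obtain ⟨s, hs⟩ := h (fun j => (v j).im) (by
    ext i; rw [← im_cmat_mulVec, hv])
  refine ⟨⟨r, s⟩, ?_⟩
  ext i
  have h1 := congrFun hr i
  have h2 := congrFun hs i
  simp only [Pi.smul_apply, smul_eq_mul] at h1 h2
  apply Complex.ext <;> simp [cvec, h1, h2]

theorem eq_zero_of_neg_fixed {A : Matrix n n ℝ} (h : ∀ v : n → ℝ, A *ᵥ v = -v → v = 0)
    {v : n → ℂ} (hv : cmat A *ᵥ v = -v) : v = 0 := by
  have h1 := h (fun j => (v j).re) (by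
    ext i; rw [← re_cmat_mulVec, hv]; simp)
  have h2 := h (fun j => (v j).im) (by
    ext i; rw [← im_cmat_mulVec, hv]; simp)
  ext i
  exact Complex.ext (congrFun h1 i) (congrFun h2 i)

theorem IsEigenbasis.lt_pi {A : Matrix n n ℝ} {c : κ → n → ℂ} {γ : κ → ℝ}
    (hc : IsEigenbasis (cmat A) c γ) (h : ∀ v : n → ℝ, A *ᵥ v = -v → v = 0) (k : κ) :
    γ k < Real.pi := by
  refine lt_of_le_of_ne (hc.le_pi k) fun hk => ?_
  have h1 := hc.eig k
  rw [hk, Complex.exp_pi_mul_I, neg_one_smul] at h1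
  have h2 := hc.ortho k k
  rw [eq_zero_of_neg_fixed h h1, if_pos rfl, braket_zero_right] at h2
  exact zero_ne_one h2

/-- The basis vectors of phase `0` are multiples of `φ`, and the others are orthogonal to it. The
weight of the pole at `0` is therefore `⟨μ|φ⟩²`. -/
theorem IsEigenbasis.sum_weight_zero {A : Matrix n n ℝ} (hA : A ∈ Matrix.orthogonalGroup n ℝ)
    {c : κ → n → ℂ} {γ : κ → ℝ} (hc : IsEigenbasis (cmat A) c γ) {φ : n → ℝ} (hφ : φ ⬝ᵥ φ = 1)
    (hAφ : A *ᵥ φ = φ) (h : ∀ v : n → ℝ, A *ᵥ v = v → ∃ r : ℝ, v = r • φ) (μ : n → ℝ) :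
    ∑ k ∈ Finset.univ.filter fun k => γ k = 0, ‖braket (c k) (cvec μ)‖ ^ 2 = (μ ⬝ᵥ φ) ^ 2 := by
  have hφφ : braket (cvec φ) (cvec φ) = 1 := by rw [braket_cvec, hφ]; simp
  have hφμ : braket (cvec φ) (cvec μ) = ((μ ⬝ᵥ φ : ℝ) : ℂ) := by
    rw [braket_cvec, dotProduct_comm]
  have h1 : ∀ k, γ k ≠ 0 → braket (c k) (cvec φ) = 0 := fun k hk => by
    have hφ' : cmat A *ᵥ cvec φ = Complex.exp ((0 : ℝ) * Complex.I) • cvec φ := by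
      rw [cmat_mulVec_cvec, hAφ]; simp
    refine braket_eq_zero_of_eig (cmat_mem_unitaryGroup hA) (hc.eig k) hφ' fun he => hk ?_
    have h2 : Complex.arg (Complex.exp (γ k * Complex.I)) = γ k :=
      Complex.arg_exp_mul_I (γ k) ▸ (toIocMod_eq_self _).2
        ⟨hc.neg_pi_lt k, by linarith [hc.le_pi k]⟩
    rw [← h2, he]; simp
  have h2 : ∀ k, γ k = 0 → ‖braket (c k) (cvec μ)‖ ^ 2
      = ‖braket (c k) (cvec φ)‖ ^ 2 * (μ ⬝ᵥ φ) ^ 2 := fun k hk => by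
    have h3 := hc.eig k
    rw [hk, Complex.ofReal_zero, zero_mul, Complex.exp_zero, one_smul] at h3
    obtain ⟨z, hz⟩ := exists_eq_smul_of_fixed h h3
    rw [hz, braket_smul_left, braket_smul_left, hφφ, hφμ, norm_mul, norm_mul, mul_pow, mul_pow,
      norm_one, Complex.norm_real, Real.norm_eq_abs, sq_abs]
    ring
  rw [Finset.sum_congr rfl fun k hk => h2 k (Finset.mem_filter.1 hk).2, ← Finset.sum_mul]
  have h4 := hc.sum_norm_sq (cvec φ)
  rw [hφφ] at h4
  have h5 : ∑ k, ‖braket (c k) (cvec φ)‖ ^ 2 = 1 := by exact_mod_cast h4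
  rw [Finset.sum_subset (Finset.subset_univ _) fun k _ hk => by
    rw [h1 k (by simpa using hk)]; simp, h5, one_mul]

theorem mem_eigSpace_iff {W : Matrix n n ℂ} {z : ℂ} {v : EuclideanSpace ℂ n} :
    v ∈ eigSpace W z ↔ W *ᵥ v.ofLp = z • v.ofLp := by
  rw [eigSpace, Module.End.mem_eigenspace_iff]
  exact ⟨fun h => congrArg WithLp.ofLp h, fun h => congrArg (WithLp.toLp 2) h⟩

theorem mem_eigenphases_of_eig {W : Matrix n n ℂ} {α : ℝ} (h0 : 0 < α) (hpi : α ≤ Real.pi)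
    {w : n → ℂ} (hw : W *ᵥ w = Complex.exp (α * Complex.I) • w) (hw0 : w ≠ 0) :
    α ∈ eigenphases W := by
  refine ⟨h0, hpi, fun h => hw0 ?_⟩
  have h1 : WithLp.toLp 2 w ∈ eigSpace W (Complex.exp (α * Complex.I)) := mem_eigSpace_iff.2 hw
  rw [h, Submodule.mem_bot] at h1
  exact congrArg WithLp.ofLp h1

theorem IsEigenbasis.braket_eq_zero_of_ne {W : Matrix n n ℂ} (hW : W ∈ Matrix.unitaryGroup n ℂ)
    {b : κ → n → ℂ} {β : κ → ℝ} (hb : IsEigenbasis W b β) {w : n → ℂ} {x : ℝ}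
    (hx0 : -Real.pi < x) (hxpi : x ≤ Real.pi) (hw : W *ᵥ w = Complex.exp (x * Complex.I) • w)
    (i : κ) (hi : β i ≠ x) : braket (b i) w = 0 := by
  refine braket_eq_zero_of_eig hW (hb.eig i) hw fun he => hi ?_
  have h1 : Complex.arg (Complex.exp (β i * Complex.I)) = β i :=
    Complex.arg_exp_mul_I (β i) ▸ (toIocMod_eq_self _).2
      ⟨hb.neg_pi_lt i, by linarith [hb.le_pi i]⟩
  have h2 : Complex.arg (Complex.exp (x * Complex.I)) = x :=
    Complex.arg_exp_mul_I x ▸ (toIocMod_eq_self _).2 ⟨hx0, by linarith⟩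
  rw [← h1, ← h2, he]

/-- The projection `P` has components only on basis vectors of phase `±α`, and `⟨P|P⟩ = ⟨P|ψ⟩`;
Cauchy–Schwarz gives the bound. -/
theorem phaseWeight_le {W : Matrix n n ℂ} (hW : W ∈ Matrix.unitaryGroup n ℂ)
    {b : κ → n → ℂ} {β : κ → ℝ} (hb : IsEigenbasis W b β) {α : ℝ} (h0 : 0 < α)
    (hpi : α ≤ Real.pi) (ψ : n → ℂ) :
    phaseWeight W ψ α
      ≤ ∑ i ∈ Finset.univ.filter fun i => β i = α ∨ β i = -α, ‖braket (b i) ψ‖ ^ 2 := by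
  set P := (phaseSpace W α).starProjection (WithLp.toLp 2 ψ) with hP
  set S := Finset.univ.filter fun i => β i = α ∨ β i = -α with hS
  have hmem : P ∈ phaseSpace W α := Submodule.starProjection_apply_mem _ _
  have hz : ∀ i, i ∉ S → braket (b i) P.ofLp = 0 := fun i hi => by
    have hi' : β i ≠ α ∧ β i ≠ -α := by simpa [hS, not_or] using hi
    obtain ⟨x, hx, y, hy, hxy⟩ := Submodule.mem_sup.1 hmem
    rw [← hxy, WithLp.ofLp_add, braket_add_right,
      hb.braket_eq_zero_of_ne hW (by linarith) hpi (mem_eigSpace_iff.1 hx) i hi'.1, zero_add]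
    have hy' := mem_eigSpace_iff.1 hy
    rcases hpi.lt_or_eq with h | h
    · refine hb.braket_eq_zero_of_ne hW (x := -α) (by linarith) (by linarith) ?_ i hi'.2
      rw [hy']; congr 2; push_cast; ring
    -- For `α = π` the two eigenvalues coincide, and `-π` is not in the range of phases.
    · refine hb.braket_eq_zero_of_ne hW (x := α) (by linarith) hpi ?_ i hi'.1
      rw [hy', h]; congr 1
      rw [Complex.exp_neg, Complex.exp_pi_mul_I]; norm_num
  have h1 : inner ℂ P P = inner ℂ P (WithLp.toLp 2 ψ) := by
    have := Submodule.starProjection_inner_eq_zero (K := phaseSpace W α) (WithLp.toLp 2 ψ) P hmem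
    have h2 := congrArg star this
    rw [Complex.star_def, inner_conj_symm, inner_sub_right, ← hP] at h2
    rw [map_zero] at h2
    exact (sub_eq_zero.1 h2).symm
  have h2 : ((‖P‖ ^ 2 : ℝ) : ℂ) = ∑ i ∈ S, braket P.ofLp (b i) * braket (b i) ψ := by
    have h3 := hb.complete P.ofLp ψ
    have h4 : braket P.ofLp ψ = inner ℂ P (WithLp.toLp 2 ψ) := by rw [inner_eq_braket]
    rw [h4, ← h1, inner_self_eq_norm_sq_to_K] at h3
    rw [Finset.sum_subset (Finset.subset_univ S) fun i _ hi => by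
      rw [← star_braket, hz i hi]; simp, h3]
    push_cast; rfl
  have h3 : ‖P‖ ^ 2 ≤ ∑ i ∈ S, ‖braket (b i) P.ofLp‖ * ‖braket (b i) ψ‖ := by
    have h4 := congrArg norm h2
    rw [Complex.norm_real, Real.norm_eq_abs, abs_of_nonneg (by positivity)] at h4
    rw [h4]
    exact (norm_sum_le _ _).trans
      (Finset.sum_le_sum fun i _ => by rw [norm_mul, norm_braket_comm])
  have h5 := Finset.sum_mul_sq_le_sq_mul_sq S (fun i => ‖braket (b i) P.ofLp‖)
    (fun i => ‖braket (b i) ψ‖)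
  have h6 : ∑ i ∈ S, ‖braket (b i) P.ofLp‖ ^ 2 ≤ ‖P‖ ^ 2 := by
    have h7 := hb.sum_norm_sq P.ofLp
    rw [← inner_eq_braket, inner_self_eq_norm_sq_to_K] at h7
    have h8 : ∑ i, ‖braket (b i) P.ofLp‖ ^ 2 = ‖P‖ ^ 2 :=
      Complex.ofReal_injective (by rw [h7]; push_cast; rfl)
    rw [← h8]
    exact Finset.sum_le_sum_of_subset_of_nonneg (Finset.subset_univ _) fun _ _ _ => by positivity
  have h7 : 0 ≤ ∑ i ∈ S, ‖braket (b i) ψ‖ ^ 2 := Finset.sum_nonneg fun _ _ => by positivity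
  change ‖P‖ ^ 2 ≤ _
  have h8 : (‖P‖ ^ 2) ^ 2 ≤ ‖P‖ ^ 2 * ∑ i ∈ S, ‖braket (b i) ψ‖ ^ 2 :=
    (pow_le_pow_left₀ (by positivity) h3 2).trans
      (h5.trans (mul_le_mul_of_nonneg_right h6 h7))
  by_contra hcon
  push Not at hcon
  have hpos : 0 < ‖P‖ ^ 2 := h7.trans_lt hcon
  nlinarith

theorem phaseWeight_le_braket (W : Matrix n n ℂ) (ψ : n → ℂ) (α : ℝ) {r : ℝ}
    (hr : braket ψ ψ = r) : phaseWeight W ψ α ≤ r := by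
  have h1 := Submodule.norm_starProjection_apply_le (phaseSpace W α) (WithLp.toLp 2 ψ)
  have h2 : ‖(WithLp.toLp 2 ψ : EuclideanSpace ℂ n)‖ ^ 2 = r := by
    have : inner ℂ (WithLp.toLp 2 ψ : EuclideanSpace ℂ n) (WithLp.toLp 2 ψ) = (r : ℂ) := by
      rw [inner_eq_braket]; exact hr
    rw [inner_self_eq_norm_sq_to_K] at this
    exact Complex.ofReal_injective (by push_cast; exact this)
  rw [← h2]
  exact pow_le_pow_left₀ (norm_nonneg _) h1 2

theorem phaseWeight_nonneg (W : Matrix n n ℂ) (ψ : n → ℂ) (α : ℝ) : 0 ≤ phaseWeight W ψ α :=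
  sq_nonneg _

theorem one_div_le_quantumHittingTime {U₂ : Matrix n n ℝ} {φ₀ μ : n → ℝ} {ε α : ℝ} (hε : 0 < ε)
    (hα : IsLeast (eigenphases (searchOp U₂ μ)) α)
    (hp : ε < phaseWeight (searchOp U₂ μ) (cvec (startState φ₀ μ)) α) :
    1 / α ≤ quantumHittingTime U₂ φ₀ μ ε := by
  have hα0 : 0 < α := hα.1.1
  -- The set must be shown nonempty, as the infimum of the empty set is `0` by convention. At `y =
  -- 1/α` the tail is an empty sum because `α` is the least eigenphase; below `1/α` the tail
  -- contains the principal weight, which exceeds `ε`.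
  refine le_csInf ⟨1 / α, by positivity, ?_⟩ ?_
  · have h : {x ∈ eigenphases (searchOp U₂ μ) | 1 / α < 1 / x} = ∅ := by
      ext x
      simp only [Set.mem_ofPred_eq, Set.mem_empty_iff_false, iff_false, not_and, not_lt]
      intro hx
      exact one_div_le_one_div_of_le hα0 (hα.2 hx)
    rw [qhTail, h, finsum_mem_empty]
    exact hε.le
  · rintro y ⟨_, hy⟩
    by_contra hc
    push Not at hc
    have hfin : {x ∈ eigenphases (searchOp U₂ μ) | y < 1 / x}.Finite :=
      (eigenphases_finite _).subset fun x hx => hx.1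
    have h1 : phaseWeight (searchOp U₂ μ) (cvec (startState φ₀ μ)) α
        ≤ qhTail (searchOp U₂ μ) (cvec (startState φ₀ μ)) y := by
      rw [qhTail, finsum_mem_eq_finite_toFinset_sum _ hfin]
      exact Finset.single_le_sum
        (f := fun x => phaseWeight (searchOp U₂ μ) (cvec (startState φ₀ μ)) x)
        (fun x _ => phaseWeight_nonneg _ _ _) (hfin.mem_toFinset.2 ⟨hα.1, hc⟩)
    linarith

theorem braket_startState_self {φ₀ μ : n → ℝ} (hφ : φ₀ ⬝ᵥ φ₀ = 1) (hμ : μ ⬝ᵥ μ = 1) :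
    braket (cvec (startState φ₀ μ)) (cvec (startState φ₀ μ)) = ((1 - (μ ⬝ᵥ φ₀) ^ 2 : ℝ) : ℂ) := by
  rw [braket_cvec, startState, sub_dotProduct, dotProduct_sub, dotProduct_sub, smul_dotProduct,
    smul_dotProduct, dotProduct_smul, dotProduct_smul, hφ, hμ, dotProduct_comm φ₀ μ]
  congr 1
  simp only [smul_eq_mul]
  ring

theorem cvec_startState (φ₀ μ : n → ℝ) :
    cvec (startState φ₀ μ) = cvec φ₀ - ((μ ⬝ᵥ φ₀ : ℝ) : ℂ) • cvec μ := by
  ext i; simp [cvec, startState]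

theorem real_searchOp (U₂ : Matrix n n ℝ) (μ : n → ℝ) :
    (searchOp U₂ μ).map star = searchOp U₂ μ := by
  have h : searchOp U₂ μ = cmat (U₂ * (1 - (2 : ℝ) • Matrix.vecMulVec μ μ)) := by
    ext i j
    simp [searchOp, markedReflection, cmat, ketbra, Matrix.mul_apply, Matrix.vecMulVec, cvec,
      Matrix.one_apply]
    refine Finset.sum_congr rfl fun k _ => ?_
    split_ifs <;> simp
  rw [h, cmat_map_star]

/-- Opposite eigenphases carry the same weight. -/
theorem IsEigenbasis.sum_weight_pair {W : Matrix n n ℂ} {b : κ → n → ℂ} {β : κ → ℝ}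
    (hW : W ∈ Matrix.unitaryGroup n ℂ) (hreal : W.map star = W) (hb : IsEigenbasis W b β)
    {m : n → ℂ} (hm : star m = m) {x : ℝ} (hx : 0 < x) (hxpi : x < Real.pi) :
    ∑ i ∈ Finset.univ.filter fun i => β i = x ∨ β i = -x, ‖braket (b i) m‖ ^ 2
      = 2 * ∑ i ∈ Finset.univ.filter fun i => β i = x, ‖braket (b i) m‖ ^ 2 := by
  rw [Finset.filter_or, Finset.sum_union]
  · have hsym := hb.sum_weight_neg hW hreal hm
      (fun y => if y = x then 1 else 0) (fun i _ _ => by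
        rw [if_neg (by linarith), if_neg hxpi.ne'])
    simp only [mul_ite, mul_one, mul_zero, ← Finset.sum_filter] at hsym
    have : (Finset.univ.filter fun i => -β i = x) = Finset.univ.filter fun i => β i = -x := by
      ext i; simp [neg_eq_iff_eq_neg]
    rw [this] at hsym
    rw [hsym]; ring
  · rw [Finset.disjoint_filter]
    intro i _ h2 h3
    linarith

/-- Spectral facts about the principal eigenphase of the abstract search operator. -/
theorem principal_eigenphase {U₂ : Matrix n n ℝ} {φ₀ μ : n → ℝ} {α : ℝ}
    (hU : U₂ ∈ Matrix.orthogonalGroup n ℝ) (hφ : φ₀ ⬝ᵥ φ₀ = 1) (hUφ : U₂ *ᵥ φ₀ = φ₀)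
    (h1 : ∀ v : n → ℝ, U₂ *ᵥ v = v → ∃ r : ℝ, v = r • φ₀)
    (hneg : ∀ v : n → ℝ, U₂ *ᵥ v = -v → v = 0) (hμ : μ ⬝ᵥ μ = 1) (ha : μ ⬝ᵥ φ₀ ≠ 0)
    (hα : IsLeast (eigenphases (searchOp U₂ μ)) α)
    (hp : 1 / 2 ≤ phaseWeight (searchOp U₂ μ) (cvec (startState φ₀ μ)) α)
    {c : κ → n → ℂ} {γ : κ → ℝ} (hc : IsEigenbasis (cmat U₂) c γ) :
    α < Real.pi ∧ (∀ k, braket (c k) (cvec μ) ≠ 0 → γ k ≤ 0 ∨ α < γ k) ∧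
      cotSum c γ (cvec μ) α = 0 ∧
      1 + cotSqSum c γ (cvec μ) α ≤ 4 * ((μ ⬝ᵥ φ₀) ^ 2 * Real.cot (α / 2) ^ 2) := by
  have hA := cmat_mem_unitaryGroup hU
  have hμμ : braket (cvec μ) (cvec μ) = 1 := by rw [braket_cvec, hμ]; simp
  have hW : searchOp U₂ μ ∈ Matrix.unitaryGroup n ℂ :=
    mul_mem hA (reflection_mem_unitaryGroup hμμ)
  obtain ⟨b, β, hb⟩ := exists_isEigenbasis hW
  have hα0 : 0 < α := hα.1.1
  have hαpi : α ≤ Real.pi := hα.1.2.1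
  set a₀ := μ ⬝ᵥ φ₀ with ha₀
  have hφμ : braket (cvec φ₀) (cvec μ) = (a₀ : ℂ) := by rw [braket_cvec, dotProduct_comm]
  -- As `φ₀` is fixed by `U₂`, its overlap with `b i` is `(1 + i cot(β i/2)) a₀ ⟨μ|b i⟩`.
  -- Subtracting `a₀ μ` leaves the purely imaginary part.
  have hov : ∀ i, β i = α ∨ β i = -α → ‖braket (b i) (cvec (startState φ₀ μ))‖ ^ 2
      = a₀ ^ 2 * Real.cot (α / 2) ^ 2 * ‖braket (b i) (cvec μ)‖ ^ 2 := fun i hi => by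
    have hs : Real.sin (β i / 2) ≠ 0 := by
      have : 0 < Real.sin (α / 2) := Real.sin_pos_of_pos_of_lt_pi (by linarith) (by linarith)
      rcases hi with h | h
      · rw [h]; exact this.ne'
      · rw [h, neg_div, Real.sin_neg]; exact (neg_neg_of_pos this).ne
    have hφ' : cmat U₂ *ᵥ cvec φ₀ = Complex.exp ((0 : ℝ) * Complex.I) • cvec φ₀ := by
      rw [cmat_mulVec_cvec, hUφ]; simp
    have h2 := braket_of_eig hA hφ' (hb.eig i) (by rwa [sub_zero])
    rw [sub_zero, hφμ] at h2
    have h3 : braket (cvec (startState φ₀ μ)) (b i)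
        = Complex.I * ((a₀ * Real.cot (β i / 2) : ℝ) : ℂ) * braket (cvec μ) (b i) := by
      rw [cvec_startState, braket_sub_left, braket_smul_left, h2, Complex.star_def,
        Complex.conj_ofReal]
      push_cast; ring
    have h4 : Real.cot (β i / 2) ^ 2 = Real.cot (α / 2) ^ 2 := by
      rcases hi with h | h
      · rw [h]
      · rw [h, neg_div, cot_neg, neg_sq]
    rw [norm_braket_comm, h3, norm_mul, norm_mul, Complex.norm_I, one_mul, Complex.norm_real,
      mul_pow, Real.norm_eq_abs, sq_abs, mul_pow, h4, norm_braket_comm (cvec μ)]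
  have hpw := phaseWeight_le hW hb hα0 hαpi (cvec (startState φ₀ μ))
  rw [Finset.sum_congr rfl fun i hi => hov i (Finset.mem_filter.1 hi).2, ← Finset.mul_sum] at hpw
  -- At `α = π` the factor `cot(π/2) = 0` would make the principal weight vanish.
  have hαlt : α < Real.pi := by
    refine lt_of_le_of_ne hαpi fun h => ?_
    rw [h, Real.cot_eq_cos_div_sin, Real.cos_pi_div_two] at hpw
    norm_num at hpw
    rw [h] at hp
    linarith
  set S := ∑ i ∈ Finset.univ.filter fun i => β i = α, ‖braket (b i) (cvec μ)‖ ^ 2 with hS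
  have hsplit := hb.sum_weight_pair hW (real_searchOp U₂ μ) (star_cvec μ) hα0 hαlt
  rw [← hS] at hsplit
  rw [hsplit] at hpw
  have hSF := IsEigenbasis.sum_weight_mul_le hA hc hμμ hb α
  rw [← hS] at hSF
  have hS0 : 0 ≤ S := Finset.sum_nonneg fun _ _ => by positivity
  have hSpos : 0 < S := by
    refine lt_of_le_of_ne hS0 fun h => ?_
    rw [← h] at hpw
    linarith
  obtain ⟨i, hi, hi0⟩ : ∃ i, β i = α ∧ braket (b i) (cvec μ) ≠ 0 := by
    by_contra hcon
    push Not at hcon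
    refine hSpos.ne' (Finset.sum_eq_zero fun i hi => ?_)
    rw [hcon i (Finset.mem_filter.1 hi).2]; simp
  have hbi := hb.eig i
  rw [hi] at hbi
  have hmi : braket (cvec μ) (b i) ≠ 0 := fun h => hi0 (by rw [← star_braket, h, star_zero])
  have hz := IsEigenbasis.cotSum_eq_zero hA hc hμμ hbi hmi
  refine ⟨hαlt, ?_, hz, ?_⟩
  -- A pole in `(0, α]` would force a zero of the secular sum between `0` and the first such pole,
  -- that is, an eigenphase below `α`.
  · by_contra hcon
    push Not at hcon
    obtain ⟨k, hk, hk0, hkα⟩ := hcon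
    set T := Finset.univ.filter fun k => braket (c k) (cvec μ) ≠ 0 ∧ 0 < γ k with hT
    obtain ⟨k1, hk1, hmin⟩ := T.exists_min_image γ ⟨k, by simp [hT, hk, hk0]⟩
    have hk1' : braket (c k1) (cvec μ) ≠ 0 ∧ 0 < γ k1 := by simpa [hT] using hk1
    have hg : γ k1 ≤ α := (hmin k (by simp [hT, hk, hk0])).trans hkα
    have hne : ∀ k, ‖braket (c k) (cvec μ)‖ ^ 2 ≠ 0 ↔ braket (c k) (cvec μ) ≠ 0 := fun k => by
      simp
    have hzero : ∃ k, ‖braket (c k) (cvec μ)‖ ^ 2 ≠ 0 ∧ γ k = 0 := by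
      by_contra hcon
      push Not at hcon
      have h2 := hc.sum_weight_zero hU hφ hUφ h1 μ
      rw [Finset.sum_eq_zero fun k hk => by
        by_contra h3
        exact hcon k h3 (Finset.mem_filter.1 hk).2] at h2
      exact pow_ne_zero 2 ha h2.symm
    obtain ⟨x, hx0, hxg, hxz, hxs⟩ := exists_zero_before_pole
      (a := fun k => ‖braket (c k) (cvec μ)‖ ^ 2) (γ := γ) (fun k => by positivity)
      (fun k _ => ⟨hc.neg_pi_lt k, hc.lt_pi hneg k⟩) hzero hk1'.2
      ⟨k1, (hne k1).2 hk1'.1, rfl⟩ (fun j hj => by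
        by_contra hcon
        push Not at hcon
        exact absurd (hmin j (by simp only [hT, Finset.mem_filter, Finset.mem_univ, true_and]
                                 exact ⟨(hne j).1 hj, hcon.1⟩)) (not_le.2 hcon.2))
    obtain ⟨w, hw, hw1, _⟩ := hc.exists_eigenvector hμμ (fun j hj => hxs j ((hne j).2 hj)) hxz
    have hw0 : w ≠ 0 := by
      rintro rfl
      rw [braket_zero_right] at hw1
      exact zero_ne_one hw1
    have := hα.2 (mem_eigenphases_of_eig hx0 (by linarith) hw hw0)
    linarith
  -- The bounds `1/2 ≤ 2 S a₀² cot²(α/2)` and `S (1 + cotSqSum) ≤ 1` are combined; the weight `S`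
  -- cancels.
  · have hA0 : 0 ≤ a₀ ^ 2 * Real.cot (α / 2) ^ 2 := by positivity
    have hF0 : 0 ≤ cotSqSum c γ (cvec μ) α := Finset.sum_nonneg fun _ _ => by positivity
    have h2 : 1 / 2 * (1 + cotSqSum c γ (cvec μ) α)
        ≤ a₀ ^ 2 * Real.cot (α / 2) ^ 2 * (2 * S) * (1 + cotSqSum c γ (cvec μ) α) :=
      mul_le_mul_of_nonneg_right (hp.trans hpw) (by linarith)
    have h3 := mul_le_mul_of_nonneg_left hSF hA0
    nlinarith

end RealSearch

/-! ### Poles of the modified secular equation and the second moment of the target. -/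

section ModifiedSpectrum

variable {n κ ι : Type*} [Fintype n] [DecidableEq n] [Fintype κ] [DecidableEq κ] [Fintype ι]
  [DecidableEq ι] {A : Matrix n n ℂ} {c : κ → n → ℂ} {γ : κ → ℝ} {μ : n → ℂ} {θ β : ℝ}
  {w : Fin 2 × n → ℂ}

/-- An eigenvector that overlaps the target cannot sit on a pole of its secular sum, and `π` is a
pole of weight `sin² θ`. -/
theorem cos_half_ne_zero_of_modified (hA : A ∈ Matrix.unitaryGroup n ℂ) (hc : IsEigenbasis A c γ)
    (hμ : braket μ μ = 1) (hs : Real.sin θ ≠ 0)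
    (hw : (extendedOp A θ * (1 - (2 : ℂ) • ketbra (tensor (ket 1) μ))) *ᵥ w
      = Complex.exp (β * Complex.I) • w) (hm : braket (tensor (ket 1) μ) w ≠ 0) :
    Real.cos (β / 2) ≠ 0 := by
  obtain ⟨k, hk⟩ : ∃ k, braket (c k) μ ≠ 0 := by
    by_contra hcon
    push Not at hcon
    have := hc.sum_weight hμ
    simp [hcon] at this
  have h1 : braket (extendedBasis c θ (0, k)) (tensor (ket 1) μ) ≠ 0 := fun h => by
    have h2 := norm_braket_extendedBasis c θ μ 0 k
    rw [h] at h2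
    simp [hs, hk] at h2
  have h2 := IsEigenbasis.sin_ne_zero (extendedOp_mem_unitaryGroup hA θ) (hc.extended θ) hw hm _ h1
  simp only [extendedPhase, if_true, sin_half_sub_pi] at h2
  exact neg_ne_zero.1 h2

theorem sin_half_ne_zero_of_modified (hA : A ∈ Matrix.unitaryGroup n ℂ) (hc : IsEigenbasis A c γ)
    (hcos : Real.cos θ ≠ 0) {k : κ} (hk : braket (c k) μ ≠ 0)
    (hw : (extendedOp A θ * (1 - (2 : ℂ) • ketbra (tensor (ket 1) μ))) *ᵥ w
      = Complex.exp (β * Complex.I) • w) (hm : braket (tensor (ket 1) μ) w ≠ 0) :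
    Real.sin ((β - γ k) / 2) ≠ 0 := by
  have h1 : braket (extendedBasis c θ (1, k)) (tensor (ket 1) μ) ≠ 0 := fun h => by
    have h2 := norm_braket_extendedBasis c θ μ 1 k
    rw [h] at h2
    simp [hcos, hk] at h2
  have h2 := IsEigenbasis.sin_ne_zero (extendedOp_mem_unitaryGroup hA θ) (hc.extended θ) hw hm _ h1
  simpa [extendedPhase] using h2

/-- Being orthogonal to the target, `w` is an eigenvector of `extendedOp` for `-1`. It is then
orthogonal to all `|θ^⊥⟩|c k⟩`, whose phases differ from `π`. The target is a combination of
`|θ⟩|μ⟩` and `|θ^⊥⟩|μ⟩`, so the remaining overlap vanishes too. -/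
theorem braket_theta_eq_zero_of_neg (hA : A ∈ Matrix.unitaryGroup n ℂ) (hc : IsEigenbasis A c γ)
    (hγ : ∀ k, γ k < Real.pi) (hs : Real.sin θ ≠ 0)
    (hw : (extendedOp A θ * (1 - (2 : ℂ) • ketbra (tensor (ket 1) μ))) *ᵥ w
      = Complex.exp (Real.pi * Complex.I) • w) (hm : braket (tensor (ket 1) μ) w = 0) :
    braket (tensor (ketTheta θ) μ) w = 0 := by
  have hw' : extendedOp A θ *ᵥ w = Complex.exp (Real.pi * Complex.I) • w := by
    rw [← Matrix.mulVec_mulVec, reflection_mulVec, hm, mul_zero, zero_smul, sub_zero] at hw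
    exact hw
  have h1 : ∀ k, braket (tensor (ketThetaPerp θ) (c k)) w = 0 := fun k => by
    refine braket_eq_zero_of_eig (extendedOp_mem_unitaryGroup hA θ)
      (extendedOp_mulVec_thetaPerp θ (hc.eig k)) hw' fun he => (hγ k).ne ?_
    have h2 : Complex.arg (Complex.exp (γ k * Complex.I)) = γ k :=
      Complex.arg_exp_mul_I (γ k) ▸ (toIocMod_eq_self _).2
        ⟨hc.neg_pi_lt k, by linarith [hc.le_pi k]⟩
    rw [← h2, he, Complex.exp_pi_mul_I, Complex.arg_neg_one]
  have h2 : braket (tensor (ketThetaPerp θ) μ) w = 0 := by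
    have h3 := (hc.extended θ).complete (tensor (ketThetaPerp θ) μ) w
    rw [← h3]
    refine Finset.sum_eq_zero ?_
    rintro ⟨i, k⟩ -
    fin_cases i
    · simp [extendedBasis, braket_tensor, braket_ketThetaPerp_ketTheta]
    · simp [extendedBasis, h1]
  rw [ket_one_eq_ketTheta θ, tensor_add_left, tensor_smul_left, tensor_smul_left, braket_add_left,
    braket_smul_left, braket_smul_left, h2, mul_zero, add_zero] at hm
  rcases mul_eq_zero.1 hm with h | h
  · exfalso
    rw [Complex.star_def, Complex.conj_ofReal, Complex.ofReal_eq_zero, neg_eq_zero] at h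
    exact hs h
  · exact h

/-- The unit vector `|θ⟩|μ⟩` is expanded in the eigenbasis: by `braket_theta_of_eig` the squares are
`sin² θ (1 + tan²(φ i/2))` times the weights of the target, and they add up to `1`. -/
theorem sum_weight_mul_tan_sq (hA : A ∈ Matrix.unitaryGroup n ℂ) (hc : IsEigenbasis A c γ)
    (hγ : ∀ k, γ k < Real.pi) (hμ : braket μ μ = 1) (hs : 0 < Real.sin θ)
    {b : ι → Fin 2 × n → ℂ} {φ : ι → ℝ}
    (hb : IsEigenbasis (extendedOp A θ * (1 - (2 : ℂ) • ketbra (tensor (ket 1) μ))) b φ) :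
    ∑ i, ‖braket (b i) (tensor (ket 1) μ)‖ ^ 2 * Real.tan (φ i / 2) ^ 2
      = 1 / Real.tan θ ^ 2 := by
  have h1 := hb.sum_norm_sq (tensor (ketTheta θ) μ)
  rw [braket_tensor, braket_ketTheta_self, hμ, one_mul, ← Complex.ofReal_one] at h1
  have h1 := Complex.ofReal_injective h1
  have h2 := hb.sum_weight (braket_tensor_ket_one_self hμ)
  have h3 : ∀ i, ‖braket (b i) (tensor (ketTheta θ) μ)‖ ^ 2
      = Real.sin θ ^ 2 * (1 + Real.tan (φ i / 2) ^ 2) * ‖braket (b i) (tensor (ket 1) μ)‖ ^ 2 :=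
    fun i => by
    -- At phase `π` both overlaps are zero, so the conventional value of `tan(π/2)` plays no role.
    by_cases hi : φ i = Real.pi
    · have he := hb.eig i
      rw [hi] at he
      have h4 : braket (tensor (ket 1) μ) (b i) = 0 := by
        by_contra hcon
        refine cos_half_ne_zero_of_modified hA hc hμ hs.ne' he hcon Real.cos_pi_div_two
      rw [norm_braket_comm, braket_theta_eq_zero_of_neg hA hc hγ hs.ne' he h4, norm_braket_comm, h4]
      simp
    · have h5 : 0 < Real.cos (φ i / 2) := Real.cos_pos_of_mem_Ioo
        ⟨by linarith [hb.neg_pi_lt i], by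
          have := lt_of_le_of_ne (hb.le_pi i) hi
          linarith⟩
      rw [norm_braket_comm, braket_theta_of_eig hA hμ h5.ne' (hb.eig i), norm_mul, norm_neg,
        norm_mul, mul_pow, mul_pow, norm_braket_comm, Complex.norm_real, Real.norm_eq_abs, sq_abs]
      congr 2
      rw [← Complex.normSq_eq_norm_sq, Complex.normSq_apply]
      simp [-Complex.ofReal_tan]
      ring
  rw [Finset.sum_congr rfl fun i _ => h3 i] at h1
  have h4 : ∑ i, ‖braket (b i) (tensor (ket 1) μ)‖ ^ 2 * Real.tan (φ i / 2) ^ 2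
      * Real.sin θ ^ 2 = 1 - Real.sin θ ^ 2 := by
    have h5 : ∀ i, Real.sin θ ^ 2 * (1 + Real.tan (φ i / 2) ^ 2)
        * ‖braket (b i) (tensor (ket 1) μ)‖ ^ 2
        = Real.sin θ ^ 2 * ‖braket (b i) (tensor (ket 1) μ)‖ ^ 2
          + ‖braket (b i) (tensor (ket 1) μ)‖ ^ 2 * Real.tan (φ i / 2) ^ 2 * Real.sin θ ^ 2 :=
      fun i => by ring
    rw [Finset.sum_congr rfl fun i _ => h5 i, Finset.sum_add_distrib, ← Finset.mul_sum, h2,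
      mul_one] at h1
    linarith
  rw [← Finset.sum_mul] at h4
  rw [Real.tan_eq_sin_div_cos θ, div_pow, one_div_div, eq_div_iff (by positivity), h4,
    Real.cos_sq']

end ModifiedSpectrum

/-- The even-odd symmetrization of an integral against the spectral measure of a real vector. -/
theorem IsEigenbasis.sum_weight_odd {ι κ : Type*} [Fintype ι] [DecidableEq ι] [Fintype κ]
    [DecidableEq κ] {W : Matrix ι ι ℂ} {b : κ → ι → ℂ} {β : κ → ℝ}
    (hW : W ∈ Matrix.unitaryGroup ι ℂ) (hreal : W.map star = W) (h : IsEigenbasis W b β)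
    {m : ι → ℂ} (hm : star m = m) (hpi : ∀ i, braket (b i) m ≠ 0 → β i ≠ Real.pi) {Y : ℝ → ℝ}
    (hY : ∀ x, Y (-x) = -Y x) (q : ℝ → ℝ) :
    ∑ i, ‖braket (b i) m‖ ^ 2 * (Y (β i) * (1 - 2 * q (β i)))
      = ∑ i, ‖braket (b i) m‖ ^ 2 * (Y |β i| * (q (-|β i|) - q |β i|)) := by
  have h1 := h.sum_weight_neg hW hreal hm (fun x => Y x * (1 - 2 * q x))
    fun i hi he => absurd he (hpi i hi)
  have h2 : ∀ i, ‖braket (b i) m‖ ^ 2 * (Y |β i| * (q (-|β i|) - q |β i|))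
      = (‖braket (b i) m‖ ^ 2 * (Y (β i) * (1 - 2 * q (β i)))
        + ‖braket (b i) m‖ ^ 2 * (Y (-β i) * (1 - 2 * q (-β i)))) / 2 := fun i => by
    rcases abs_choice (β i) with h3 | h3
    · rw [h3, hY]; ring
    · rw [h3, neg_neg, hY]; ring
  rw [Finset.sum_congr rfl fun i _ => h2 i, ← Finset.sum_div, Finset.sum_add_distrib, h1]
  ring

/-! ### Location of the first phase of the modified operator. -/

section WeightedCotTan

variable {κ : Type*} [Fintype κ] {a γ : κ → ℝ} {α β₁ T : ℝ}

theorem sum_cot_neg (hsymm : ∀ f : ℝ → ℝ, ∑ k, a k * f (-γ k) = ∑ k, a k * f (γ k)) (β : ℝ) :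
    ∑ k, a k * Real.cot ((-β - γ k) / 2) = -∑ k, a k * Real.cot ((β - γ k) / 2) := by
  rw [← hsymm fun x => Real.cot ((-β - x) / 2), ← Finset.sum_neg_distrib]
  refine Finset.sum_congr rfl fun k _ => ?_
  rw [show (-β - -γ k) / 2 = -((β - γ k) / 2) by ring, cot_neg]
  ring

/-- Below its pole at `π`, the multiple `T tan (β / 2)` of the tangent meets a weighted sum of
cotangents for the first time at `β₁`. -/
theorem le_of_sum_cot_eq_tan (ha : ∀ k, 0 ≤ a k)
    (hγ : ∀ k, a k ≠ 0 → -Real.pi < γ k ∧ γ k < Real.pi) (hα : α < Real.pi)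
    (hbet : ∀ k, a k ≠ 0 → γ k ≤ 0 ∨ α < γ k) (hT : 0 < T) (hβ₁α : β₁ ≤ α)
    (hβ₁ : ∑ k, a k * Real.cot ((β₁ - γ k) / 2) = T * Real.tan (β₁ / 2)) {β : ℝ} (hβ : 0 < β)
    (h : ∑ k, a k * Real.cot ((β - γ k) / 2) = T * Real.tan (β / 2)) : β₁ ≤ β := by
  by_contra hcon
  push Not at hcon
  -- The cotangent sum decreases while the tangent strictly increases, so they cannot already meet
  -- before `β₁`.
  have h1 := sum_cot_sub_le ha hγ hα hbet hβ hcon.le hβ₁α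
  rw [h, hβ₁, ← mul_sub] at h1
  have h2 : Real.cot (β₁ / 2) ≤ Real.cot (β / 2) := cot_le_cot (by linarith)
    (mul_pos (Real.sin_pos_of_pos_of_lt_pi (by linarith) (by linarith))
      (Real.sin_pos_of_pos_of_lt_pi (by linarith) (by linarith))) (by linarith)
  have h3 : Real.tan (β / 2) < Real.tan (β₁ / 2) :=
    Real.tan_lt_tan_of_nonneg_of_lt_pi_div_two (by linarith) (by linarith) (by linarith)
  have h4 : 0 ≤ ∑ k ∈ Finset.univ.filter fun k => γ k = 0, a k := Finset.sum_nonneg fun k _ => ha k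
  nlinarith [mul_nonneg h4 (sub_nonneg.2 h2), mul_pos hT (sub_pos.2 h3)]

/-- If the weights are symmetric, the first phase also bounds the negative phases. -/
theorem le_abs_of_sum_cot_eq_tan (ha : ∀ k, 0 ≤ a k)
    (hsymm : ∀ f : ℝ → ℝ, ∑ k, a k * f (-γ k) = ∑ k, a k * f (γ k))
    (hγ : ∀ k, a k ≠ 0 → -Real.pi < γ k ∧ γ k < Real.pi) (hα : α < Real.pi)
    (hbet : ∀ k, a k ≠ 0 → γ k ≤ 0 ∨ α < γ k) (hT : 0 < T) (hβ₁α : β₁ ≤ α)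
    (hβ₁ : ∑ k, a k * Real.cot ((β₁ - γ k) / 2) = T * Real.tan (β₁ / 2)) {β : ℝ} (hβ : β ≠ 0)
    (h : ∑ k, a k * Real.cot ((β - γ k) / 2) = T * Real.tan (β / 2)) : β₁ ≤ |β| := by
  rcases lt_or_gt_of_ne hβ with h1 | h1
  · rw [abs_of_neg h1]
    refine le_of_sum_cot_eq_tan ha hγ hα hbet hT hβ₁α hβ₁ (by linarith) ?_
    rw [sum_cot_neg hsymm, h, neg_div, Real.tan_neg]
    ring
  · rw [abs_of_pos h1]
    exact le_of_sum_cot_eq_tan ha hγ hα hbet hT hβ₁α hβ₁ h1 h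

/-- The first phase `β₁`, when `T = (a₀ cot (α / 2) / 10)²`: it is close to `α`. -/
theorem cot_sq_le_of_sum_cot_eq_tan (ha : ∀ k, 0 ≤ a k)
    (hγ : ∀ k, a k ≠ 0 → -Real.pi < γ k ∧ γ k < Real.pi) (hα : α < Real.pi)
    (hbet : ∀ k, a k ≠ 0 → γ k ≤ 0 ∨ α < γ k) (hβ₁0 : 0 < β₁) (hβ₁α : β₁ ≤ α)
    (hz : ∑ k, a k * Real.cot ((α - γ k) / 2) = 0) {a₀ : ℝ} (ha₀ : a₀ ≠ 0)
    (hsum : ∑ k ∈ Finset.univ.filter (fun k => γ k = 0), a k = a₀ ^ 2)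
    (hβ₁ : ∑ k, a k * Real.cot ((β₁ - γ k) / 2)
      = (a₀ * Real.cot (α / 2) / 10) ^ 2 * Real.tan (β₁ / 2)) :
    Real.cot (α / 2) ≤ Real.cot (β₁ / 2) ∧
      Real.cot (β₁ / 2) ^ 2 ≤ Real.cot (β₁ / 2) * Real.cot (α / 2)
        + Real.cot (α / 2) ^ 2 / 100 := by
  have h2 : Real.cot (α / 2) ≤ Real.cot (β₁ / 2) := cot_le_cot (by linarith)
    (mul_pos (Real.sin_pos_of_pos_of_lt_pi (by linarith) (by linarith))
      (Real.sin_pos_of_pos_of_lt_pi (by linarith) (by linarith))) (by linarith)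
  refine ⟨h2, ?_⟩
  have h1 := sum_cot_sub_le ha hγ hα hbet hβ₁0 hβ₁α le_rfl
  rw [hsum, hβ₁, hz, sub_zero] at h1
  have h3 : Real.tan (β₁ / 2) * Real.cot (β₁ / 2) = 1 := tan_mul_cot
    (Real.sin_pos_of_pos_of_lt_pi (by linarith) (by linarith)).ne'
    (Real.cos_pos_of_mem_Ioo ⟨by linarith, by linarith⟩).ne'
  have h4 : 0 < Real.cot (β₁ / 2) := by
    rw [Real.cot_eq_cos_div_sin]
    exact div_pos (Real.cos_pos_of_mem_Ioo ⟨by linarith, by linarith⟩)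
      (Real.sin_pos_of_pos_of_lt_pi (by linarith) (by linarith))
  -- Multiplying by `cot(β₁/2)` removes the tangent and leaves a quadratic inequality for
  -- `cot(β₁/2)`.
  have h5 := mul_le_mul_of_nonneg_right h1 h4.le
  rw [mul_assoc (_ ^ 2) (Real.tan _), h3] at h5
  have h6 : 0 < a₀ ^ 2 := by positivity
  refine le_of_mul_le_mul_left ?_ h6
  nlinarith

end WeightedCotTan

/-! ### Weight of the first phase and the overlap as a spectral sum. -/

section ModifiedSpectrum

variable {n κ ι : Type*} [Fintype n] [DecidableEq n] [Fintype κ] [DecidableEq κ] [Fintype ι]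
  [DecidableEq ι]

/-- The eigenvectors of the modified operator for its first eigenphases `±β₁`. -/
theorem two_le_sum_weight_pair_mul {A : Matrix n n ℂ} (hA : A ∈ Matrix.unitaryGroup n ℂ)
    (hreal : A.map star = A) {c : κ → n → ℂ} {γ : κ → ℝ} (hc : IsEigenbasis A c γ) {μ : n → ℂ}
    (hμ : braket μ μ = 1) (hμs : star μ = μ) {θ : ℝ} (hcos : Real.cos θ ≠ 0)
    (hγ : ∀ k, γ k < Real.pi) {α β₁ : ℝ} (hα : α < Real.pi)
    (hbet : ∀ k, braket (c k) μ ≠ 0 → γ k ≤ 0 ∨ α < γ k) (h0 : 0 < β₁) (hβ₁ : β₁ ≤ α)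
    (hz : cotSum c γ μ β₁ = Real.tan θ ^ 2 * Real.tan (β₁ / 2)) {b : ι → Fin 2 × n → ℂ} {β : ι → ℝ}
    (hb : IsEigenbasis (extendedOp A θ * (1 - (2 : ℂ) • ketbra (tensor (ket 1) μ))) b β) :
    2 ≤ (∑ i ∈ Finset.univ.filter fun i => |β i| = β₁, ‖braket (b i) (tensor (ket 1) μ)‖ ^ 2)
      * (1 + (Real.cos θ ^ 2 * cotSqSum c γ μ β₁ + Real.sin θ ^ 2 * Real.tan (β₁ / 2) ^ 2)) := by
  have hmm := braket_tensor_ket_one_self hμ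
  have hW : extendedOp A θ * (1 - (2 : ℂ) • ketbra (tensor (ket 1) μ))
      ∈ Matrix.unitaryGroup (Fin 2 × n) ℂ :=
    mul_mem (extendedOp_mem_unitaryGroup hA θ) (reflection_mem_unitaryGroup hmm)
  have hcot : cotSum (extendedBasis c θ) (extendedPhase γ) (tensor (ket 1) μ) β₁ = 0 := by
    rw [cotSum_extended hc hμ, hz, Real.tan_eq_sin_div_cos θ]
    field_simp
    ring
  obtain ⟨w, hw, hw1, hww⟩ := (hc.extended θ).exists_eigenvector hmm (β := β₁) (fun j hj => by
    obtain ⟨i, k⟩ := j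
    by_cases hi : i = 0
    · simp only [extendedPhase, hi, if_true, sin_half_sub_pi]
      exact neg_ne_zero.2 (Real.cos_pos_of_mem_Ioo ⟨by linarith, by linarith⟩).ne'
    · simp only [extendedPhase, hi, if_false]
      have hk : braket (c k) μ ≠ 0 := fun h => by
        have h2 := norm_braket_extendedBasis c θ μ i k
        rw [h] at h2
        simp [hj] at h2
      refine sin_half_sub_ne_zero h0.le (by linarith) (hc.neg_pi_lt k) (hγ k) fun he => ?_
      rcases hbet k hk with h | h <;> linarith) hcot
  rw [cotSqSum_extended hc hμ] at hww
  have h1 := IsEigenbasis.one_le_sum_weight_mul hW hb (by linarith) (by linarith) hw hw1 hww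
  have h2 := hb.sum_weight_pair hW (real_extendedOp hreal hμs θ) (star_tensor_ket_one hμs) h0
    (by linarith)
  have h3 : (Finset.univ.filter fun i => |β i| = β₁)
      = Finset.univ.filter fun i => β i = β₁ ∨ β i = -β₁ := by
    ext i; simp [abs_eq h0.le]
  rw [h3, h2]
  linarith

/-- The overlap of the output of the algorithm with the target, in terms of the spectral measure of
the modified search operator. -/
theorem norm_braket_rotate_modified {A : Matrix n n ℂ} (hA : A ∈ Matrix.unitaryGroup n ℂ)
    (hreal : A.map star = A) {μ φ₀ : n → ℂ} (hμ : braket μ μ = 1) (hμs : star μ = μ)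
    (hφ : A *ᵥ φ₀ = φ₀) {a₀ : ℝ} (ha : braket φ₀ μ = a₀) {θ : ℝ} (hcos : Real.cos θ ≠ 0)
    {b : ι → Fin 2 × n → ℂ} {β : ι → ℝ}
    (hb : IsEigenbasis (extendedOp A θ * (1 - (2 : ℂ) • ketbra (tensor (ket 1) μ))) b β)
    (hsc : ∀ i, braket (b i) (tensor (ket 1) μ) ≠ 0 →
      Real.sin (β i / 2) ≠ 0 ∧ Real.cos (β i / 2) ≠ 0) (C Δ ε : ℝ) :
    ‖braket (withRegisters (tensor (ket 1) μ))
        (rotate C (extendedOp A θ * (1 - (2 : ℂ) • ketbra (tensor (ket 1) μ))) Δ ε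
          *ᵥ withRegisters (tensor (ketThetaPerp θ) (φ₀ - (a₀ : ℂ) • μ)))‖
      = |a₀ * Real.cos θ| * |∑ i, ‖braket (b i) (tensor (ket 1) μ)‖ ^ 2 *
          ((Real.cot (|β i| / 2) - Real.tan θ ^ 2 * Real.tan (|β i| / 2)) *
            (flipProb (precisionQubits Δ) (repetitions C ε) (-|β i|)
              - flipProb (precisionQubits Δ) (repetitions C ε) |β i|))| := by
  have hmm := braket_tensor_ket_one_self hμ
  have hW : extendedOp A θ * (1 - (2 : ℂ) • ketbra (tensor (ket 1) μ))
      ∈ Matrix.unitaryGroup (Fin 2 × n) ℂ :=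
    mul_mem (extendedOp_mem_unitaryGroup hA θ) (reflection_mem_unitaryGroup hmm)
  set t := precisionQubits Δ
  set K := repetitions C ε
  rw [braket_rotate hb]
  rw [← hb.sum_weight_odd hW (real_extendedOp hreal hμs θ) (star_tensor_ket_one hμs)
    (fun i hi he => (hsc i hi).2 (by rw [he, Real.cos_pi_div_two]))
    (Y := fun x => Real.cot (x / 2) - Real.tan θ ^ 2 * Real.tan (x / 2)) (fun x => by
      rw [neg_div, cot_neg, Real.tan_neg]; ring) (flipProb t K)]
  -- Up to a common imaginary factor, each product of overlaps is the weight of the target times an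
  -- odd function of the phase.
  have h1 : ∀ i, braket (tensor (ket 1) μ) (b i)
      * braket (b i) (tensor (ketThetaPerp θ) (φ₀ - (a₀ : ℂ) • μ))
      = -(Complex.I * (a₀ * Real.cos θ : ℝ)) * ((‖braket (b i) (tensor (ket 1) μ)‖ ^ 2 *
        (Real.cot (β i / 2) - Real.tan θ ^ 2 * Real.tan (β i / 2)) : ℝ) : ℂ) := fun i => by
    by_cases hi : braket (b i) (tensor (ket 1) μ) = 0
    · rw [hi, ← star_braket, hi]; simp
    · have h2 := braket_start_of_eig hA hμ hφ ha hcos (hsc i hi).1 (hsc i hi).2 (hb.eig i)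
      rw [← star_braket (tensor (ketThetaPerp θ) _), h2]
      have h3 := braket_mul_comm_eq_norm_sq (tensor (ket 1) μ) (b i)
      rw [star_mul', star_mul', star_braket, Complex.star_def, Complex.conj_I,
        Complex.conj_ofReal]
      push_cast at h3 ⊢
      rw [← h3]
      ring
  rw [Finset.sum_congr rfl fun i _ => by rw [h1 i, mul_assoc, ← Complex.ofReal_mul],
    ← Finset.mul_sum, ← Complex.ofReal_sum, norm_mul, norm_neg, norm_mul, Complex.norm_I, one_mul,
    Complex.norm_real, Complex.norm_real, Real.norm_eq_abs, Real.norm_eq_abs]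
  congr 2
  exact Finset.sum_congr rfl fun i _ => by ring

/-- Reduction of the analysis of the modified algorithm to its spectral measure: the `w i` are the
weights of the target state on the eigenvectors of the modified search operator, and the `x i` are
the absolute values of the eigenphases, the least of which is `β₁`. -/
theorem exists_modified_spectrum {U₂ : Matrix n n ℝ} {φ₀ μ : n → ℝ} {α θ : ℝ}
    (hU : U₂ ∈ Matrix.orthogonalGroup n ℝ) (hφ : φ₀ ⬝ᵥ φ₀ = 1) (hUφ : U₂ *ᵥ φ₀ = φ₀)
    (h1 : ∀ v : n → ℝ, U₂ *ᵥ v = v → ∃ r : ℝ, v = r • φ₀)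
    (hneg : ∀ v : n → ℝ, U₂ *ᵥ v = -v → v = 0) (hμ : μ ⬝ᵥ μ = 1) (ha : μ ⬝ᵥ φ₀ ≠ 0)
    (hα : IsLeast (eigenphases (searchOp U₂ μ)) α)
    (hp : 1 / 2 ≤ phaseWeight (searchOp U₂ μ) (cvec (startState φ₀ μ)) α)
    (hθ : 0 ≤ θ) (hθpi : θ < Real.pi / 2)
    (htan : Real.tan θ = (μ ⬝ᵥ φ₀) * Real.cot (α / 2) / 10) :
    0 < μ ⬝ᵥ φ₀ ∧ (μ ⬝ᵥ φ₀) ^ 2 ≤ 1 / 2 ∧ 0 < θ ∧ 1 / 20 ≤ Real.tan θ ∧ 0 < α ∧ α < Real.pi ∧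
    ∃ (N : ℕ) (w x : Fin N → ℝ) (β₁ : ℝ), (∀ i, 0 ≤ w i) ∧ ∑ i, w i = 1 ∧
      ∑ i, w i * Real.tan (x i / 2) ^ 2 = 1 / Real.tan θ ^ 2 ∧
      (∀ i, w i ≠ 0 → β₁ ≤ x i ∧ x i < Real.pi) ∧
      0 < β₁ ∧ β₁ ≤ α ∧ Real.cot (α / 2) ≤ Real.cot (β₁ / 2) ∧
      Real.cot (β₁ / 2) ≤ 1.01 * Real.cot (α / 2) ∧
      2 ≤ (∑ i ∈ Finset.univ.filter fun i => x i = β₁, w i)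
        * (403 * Real.sin θ ^ 2 + 1 / 200) ∧
      ∀ C Δ ε : ℝ, ‖braket (withRegisters (tensor (ket 1) (cvec μ)))
        (rotate C (modifiedSearchOp (markedReflection μ) (cmat U₂) θ) Δ ε
          *ᵥ withRegisters (tensor (ketThetaPerp θ) (cvec (startState φ₀ μ))))‖
        = (μ ⬝ᵥ φ₀) * Real.cos θ * |∑ i, w i *
          ((Real.cot (x i / 2) - Real.tan θ ^ 2 * Real.tan (x i / 2)) *
            (flipProb (precisionQubits Δ) (repetitions C ε) (-x i)
              - flipProb (precisionQubits Δ) (repetitions C ε) (x i)))| := by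
  have hA := cmat_mem_unitaryGroup hU
  have hAreal := cmat_map_star U₂
  obtain ⟨c, γ, hc⟩ := exists_isEigenbasis hA
  obtain ⟨hαpi, hbet, hz, hF⟩ := principal_eigenphase hU hφ hUφ h1 hneg hμ ha hα hp hc
  have hα0 : 0 < α := hα.1.1
  set a₀ := μ ⬝ᵥ φ₀ with ha₀
  have hμμ : braket (cvec μ) (cvec μ) = 1 := by rw [braket_cvec, hμ]; simp
  have hcot0 : 0 < Real.cot (α / 2) := by
    rw [Real.cot_eq_cos_div_sin]
    exact div_pos (Real.cos_pos_of_mem_Ioo ⟨by linarith, by linarith⟩)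
      (Real.sin_pos_of_pos_of_lt_pi (by linarith) (by linarith))
  have hF0 : 0 ≤ cotSqSum c γ (cvec μ) α := Finset.sum_nonneg fun _ _ => by positivity
  have htan0 : 0 ≤ Real.tan θ := Real.tan_nonneg_of_nonneg_of_le_pi_div_two hθ hθpi.le
  have hAτ : a₀ ^ 2 * Real.cot (α / 2) ^ 2 = 100 * Real.tan θ ^ 2 := by rw [htan]; ring
  -- `1 ≤ 1 + cotSqSum ≤ 4 a₀² cot²(α/2) = 400 tan² θ`.
  have htan1 : 1 / 20 ≤ Real.tan θ := by
    rw [hAτ] at hF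
    nlinarith
  have ha0 : 0 < a₀ := by
    by_contra hcon
    nlinarith [mul_nonneg (sub_nonneg.2 (not_lt.1 hcon)) hcot0.le]
  -- The principal weight, at least `1/2`, is at most the squared norm `1 - a₀²` of the start state.
  have ha2 : a₀ ^ 2 ≤ 1 / 2 := by
    have := hp.trans (phaseWeight_le_braket _ _ α (braket_startState_self hφ hμ))
    linarith
  have hθ0 : 0 < θ := lt_of_le_of_ne hθ fun h => by
    rw [← h, Real.tan_zero] at htan1
    norm_num at htan1
  have hsin : 0 < Real.sin θ := Real.sin_pos_of_pos_of_lt_pi hθ0 (by linarith)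
  have hcos : 0 < Real.cos θ := Real.cos_pos_of_mem_Ioo ⟨by linarith, hθpi⟩
  refine ⟨ha0, ha2, hθ0, htan1, hα0, hαpi, ?_⟩
  have hγ : ∀ k, γ k < Real.pi := fun k => hc.lt_pi hneg k
  have hsum := hc.sum_weight_zero hU hφ hUφ h1 μ
  have hw0 : ∀ k, 0 ≤ ‖braket (c k) (cvec μ)‖ ^ 2 := fun k => by positivity
  have hwγ : ∀ k, ‖braket (c k) (cvec μ)‖ ^ 2 ≠ 0 → -Real.pi < γ k ∧ γ k < Real.pi :=
    fun k _ => ⟨hc.neg_pi_lt k, hγ k⟩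
  have hwbet : ∀ k, ‖braket (c k) (cvec μ)‖ ^ 2 ≠ 0 → γ k ≤ 0 ∨ α < γ k :=
    fun k hk => hbet k (by simpa using hk)
  have hsymm : ∀ f : ℝ → ℝ, ∑ k, ‖braket (c k) (cvec μ)‖ ^ 2 * f (-γ k)
      = ∑ k, ‖braket (c k) (cvec μ)‖ ^ 2 * f (γ k) := fun f =>
    hc.sum_weight_neg hA hAreal (star_cvec μ) f fun k _ h => absurd h (hγ k).ne
  obtain ⟨k₀, hk₀, hγ₀⟩ : ∃ k, ‖braket (c k) (cvec μ)‖ ^ 2 ≠ 0 ∧ γ k = 0 := by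
    by_contra hcon
    push Not at hcon
    rw [Finset.sum_eq_zero fun k hk => by
      by_contra h3
      exact hcon k h3 (Finset.mem_filter.1 hk).2] at hsum
    exact pow_ne_zero 2 ha hsum.symm
  have hk₀' : braket (c k₀) (cvec μ) ≠ 0 := by simpa using hk₀
  have hT : 0 < Real.tan θ ^ 2 := by positivity
  obtain ⟨β₁, hβ0, hβα, hβ⟩ := exists_eq_tan_before hw0 hwγ ⟨k₀, hk₀, hγ₀⟩ hα0 hαpi hwbet hz hT
  obtain ⟨hX1, hX2⟩ := cot_sq_le_of_sum_cot_eq_tan hw0 hwγ hαpi hwbet hβ0 hβα.le hz ha hsum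
    (by rw [hβ, htan])
  -- If `X = cot(β₁/2)` exceeded `1.01 κ` with `κ = cot(α/2)`, then `X (X - κ) > κ²/100`, against
  -- `hX2`.
  have hX3 : Real.cot (β₁ / 2) ≤ 1.01 * Real.cot (α / 2) := by
    by_contra hcon
    push Not at hcon
    nlinarith
  have hm := star_cvec μ
  have hW : extendedOp (cmat U₂) θ * (1 - (2 : ℂ) • ketbra (tensor (ket 1) (cvec μ)))
      ∈ Matrix.unitaryGroup (Fin 2 × n) ℂ := mul_mem (extendedOp_mem_unitaryGroup hA θ)
    (reflection_mem_unitaryGroup (braket_tensor_ket_one_self hμμ))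
  obtain ⟨b, β, hb⟩ := exists_isEigenbasis hW
  have hsc : ∀ i, braket (b i) (tensor (ket 1) (cvec μ)) ≠ 0 →
      Real.sin (β i / 2) ≠ 0 ∧ Real.cos (β i / 2) ≠ 0 := fun i hi => by
    have hi' : braket (tensor (ket 1) (cvec μ)) (b i) ≠ 0 := fun h =>
      hi (by rw [← star_braket, h, star_zero])
    refine ⟨?_, cos_half_ne_zero_of_modified hA hc hμμ hsin.ne' (hb.eig i) hi'⟩
    have := sin_half_ne_zero_of_modified hA hc hcos.ne' hk₀' (hb.eig i) hi'
    rwa [hγ₀, sub_zero] at this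
  refine ⟨_, fun i => ‖braket (b i) (tensor (ket 1) (cvec μ))‖ ^ 2, fun i => |β i|, β₁,
    fun i => by positivity, hb.sum_weight (braket_tensor_ket_one_self hμμ), ?_, ?_, hβ0, hβα.le,
    hX1, hX3, ?_, ?_⟩
  · rw [← sum_weight_mul_tan_sq hA hc hγ hμμ hsin hb]
    refine Finset.sum_congr rfl fun i _ => ?_
    rcases abs_choice (β i) with h | h
    · simp only [h]
    · simp only [h, neg_div, Real.tan_neg, neg_sq]
  · intro i hi
    have hi0 : braket (b i) (tensor (ket 1) (cvec μ)) ≠ 0 := by simpa using hi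
    have hi' : braket (tensor (ket 1) (cvec μ)) (b i) ≠ 0 := fun h =>
      hi0 (by rw [← star_braket, h, star_zero])
    have h2 := IsEigenbasis.cotSum_eq_zero (extendedOp_mem_unitaryGroup hA θ) (hc.extended θ)
      (braket_tensor_ket_one_self hμμ) (hb.eig i) hi'
    rw [cotSum_extended hc hμμ] at h2
    have h3 : cotSum c γ (cvec μ) (β i) = Real.tan θ ^ 2 * Real.tan (β i / 2) := by
      rw [Real.tan_eq_sin_div_cos θ]
      field_simp
      linarith
    refine ⟨le_abs_of_sum_cot_eq_tan hw0 hsymm hwγ hαpi hwbet hT hβα.le hβ (fun h => ?_) h3, ?_⟩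
    · exact (hsc i hi0).1 (by rw [h, zero_div, Real.sin_zero])
    · refine abs_lt.2 ⟨hb.neg_pi_lt i, lt_of_le_of_ne (hb.le_pi i) fun h => ?_⟩
      exact (hsc i hi0).2 (by rw [h, Real.cos_pi_div_two])
  · refine (two_le_sum_weight_pair_mul hA hAreal hc hμμ hm hcos.ne' hγ hαpi hbet hβ0 hβα.le hβ
      hb).trans (mul_le_mul_of_nonneg_left ?_ (Finset.sum_nonneg fun _ _ => by positivity))
    have h2 := sum_cot_sq_le hw0 hwγ hsymm hwbet hβ0 hβα.le
    rw [hsum] at h2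
    change cotSqSum c γ (cvec μ) β₁ ≤ cotSqSum c γ (cvec μ) α + _ at h2
    -- The value at `α` is at most `400 tan² θ - 1`. Moving to `β₁` adds at most `a₀² · 0.02
    -- cot²(α/2) = 2 tan² θ`. Multiplication by `cos² θ` then gives `402 sin² θ - cos² θ`, which
    -- with the leading `1` makes `403 sin² θ`.
    have h3 : cotSqSum c γ (cvec μ) β₁ ≤ 402 * Real.tan θ ^ 2 - 1 := by
      have h4 : Real.cot (β₁ / 2) ^ 2 - Real.cot (α / 2) ^ 2 ≤ 0.02 * Real.cot (α / 2) ^ 2 := by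
        nlinarith
      have h5 := mul_le_mul_of_nonneg_left h4 (sq_nonneg a₀)
      linarith
    have h4 : Real.cos θ ^ 2 * Real.tan θ ^ 2 = Real.sin θ ^ 2 := by
      rw [Real.tan_eq_sin_div_cos]; field_simp
    have h5 := mul_le_mul_of_nonneg_left h3 (sq_nonneg (Real.cos θ))
    have h6 : Real.tan (β₁ / 2) * Real.cot (β₁ / 2) = 1 := tan_mul_cot
      (Real.sin_pos_of_pos_of_lt_pi (by linarith) (by linarith)).ne'
      (Real.cos_pos_of_mem_Ioo ⟨by linarith, by linarith⟩).ne'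
    have h7 : 0 ≤ Real.tan (β₁ / 2) :=
      Real.tan_nonneg_of_nonneg_of_le_pi_div_two (by linarith) (by linarith)
    have h8 : Real.tan (β₁ / 2) * Real.cot (α / 2) ≤ 1 := by
      rw [← h6]; exact mul_le_mul_of_nonneg_left hX1 h7
    have h9 : Real.tan (β₁ / 2) * Real.tan θ ≤ a₀ / 10 := by
      rw [htan]
      nlinarith
    have h10 : Real.sin θ ^ 2 * Real.tan (β₁ / 2) ^ 2 ≤ 1 / 200 := by
      have h11 : (Real.tan (β₁ / 2) * Real.tan θ) ^ 2 ≤ (a₀ / 10) ^ 2 :=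
        pow_le_pow_left₀ (by positivity) h9 2
      rw [← h4]
      have h12 : Real.cos θ ^ 2 ≤ 1 := Real.cos_sq_le_one θ
      have h13 := mul_le_mul h12 h11 (by positivity) zero_le_one
      linarith
    have h11 := Real.sin_sq_add_cos_sq θ
    linarith
  · intro C Δ ε
    have h2 := norm_braket_rotate_modified hA hAreal hμμ hm (φ₀ := cvec φ₀) (a₀ := a₀)
      (by rw [cmat_mulVec_cvec, hUφ]) (by rw [braket_cvec, dotProduct_comm]) hcos.ne' hb hsc C Δ ε
    rw [cvec_startState, markedReflection, modifiedSearchOp_eq, h2,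
      abs_of_pos (mul_pos ha0 hcos)]

end ModifiedSpectrum

/-! ### Numerical bounds for phase estimation and the weighted-sum inequality. -/

section Estimates

theorem tailBound_anti {u v u₀ v₀ : ℝ} (hu₀ : 1 / 2 < u₀) (hu : u₀ ≤ u) (hv₀ : 1 / 2 < v₀)
    (hv : v₀ ≤ v) : tailBound u v ≤ tailBound u₀ v₀ := by
  rw [tailBound, tailBound]
  have h := fun {x y : ℝ} (hx : 0 < x) (h : x ≤ y) => one_div_le_one_div_of_le hx h
  exact add_le_add
    (add_le_add (h (by linarith) (by linarith)) (h (by linarith) (by linarith)))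
    (add_le_add (h (by linarith) (by linarith)) (h (by linarith) (by linarith)))

/-- The region is covered by five quadrants `u₀ ≤ u`, `v₀ ≤ v`, and `tailBound` is monotone, so only
the corners have to be evaluated. -/
theorem tailBound_le_of_four_le {u v : ℝ} (hu : 1.269 ≤ u) (hv : 1.45 ≤ v) (huv : 4 ≤ u + v) :
    tailBound u v ≤ 2.643 := by
  have h := fun (u₀ v₀ : ℝ) (h1 : 1 / 2 < u₀) (h2 : 1 / 2 < v₀) (h3 : tailBound u₀ v₀ ≤ 2.643)
    (h4 : u₀ ≤ u) (h5 : v₀ ≤ v) => (tailBound_anti h1 h4 h2 h5).trans h3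
  rcases le_total u 1.33 with h1 | h1
  · exact h 1.269 2.67 (by norm_num) (by norm_num) (by rw [tailBound]; norm_num) hu (by linarith)
  rcases le_total u 1.5 with h2 | h2
  · exact h 1.33 2.5 (by norm_num) (by norm_num) (by rw [tailBound]; norm_num) h1 (by linarith)
  rcases le_total u 1.8 with h3 | h3
  · exact h 1.5 2.2 (by norm_num) (by norm_num) (by rw [tailBound]; norm_num) h2 (by linarith)
  rcases le_total u 2.2 with h4 | h4
  · exact h 1.8 1.8 (by norm_num) (by norm_num) (by rw [tailBound]; norm_num) h3 (by linarith)
  · exact h 2.2 1.45 (by norm_num) (by norm_num) (by rw [tailBound]; norm_num) h4 hv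

theorem tailBound_le_of_sixteen_le {u v : ℝ} (hu : 1.269 ≤ u) (hv : 2.7 ≤ v) (huv : 16 ≤ u + v) :
    tailBound u v ≤ 2.0327 := by
  rcases le_total u 4 with h1 | h1
  · exact (tailBound_anti (by norm_num) hu (by norm_num) (show 12 ≤ v by linarith)).trans
      (by rw [tailBound]; norm_num)
  · exact (tailBound_anti (by norm_num) h1 (by norm_num) hv).trans (by rw [tailBound]; norm_num)

/-- From `sin x ≥ x - x³/6`; the limit for large `N` is `π²`. -/
theorem le_pi_mul_sin_pi_div {N N₀ : ℝ} (hN₀ : 4 ≤ N₀) (hN : N₀ ≤ N) :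
    9.8695 * (1 - 9.8697 / (6 * N₀ ^ 2)) ≤ Real.pi * N * Real.sin (Real.pi / N) := by
  have hN0 : 0 < N := by linarith
  have h1 := Real.sin_ge_sub_cube (x := Real.pi / N) (by positivity)
  have h2 : 9.8695 ≤ Real.pi ^ 2 := by nlinarith [Real.pi_gt_d6]
  have h3 : Real.pi ^ 2 ≤ 9.8697 := by nlinarith [Real.pi_lt_d6, Real.pi_pos]
  have h4 : Real.pi * N * (Real.pi / N - (Real.pi / N) ^ 3 / 6)
      = Real.pi ^ 2 * (1 - Real.pi ^ 2 / (6 * N ^ 2)) := by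
    field_simp
  have h5 : Real.pi ^ 2 / (6 * N ^ 2) ≤ 9.8697 / (6 * N₀ ^ 2) := by gcongr
  have h6 := mul_le_mul_of_nonneg_left h1 (by positivity : 0 ≤ Real.pi * N)
  rw [h4] at h6
  refine le_trans ?_ h6
  have h7 : 9.8697 / (6 * N₀ ^ 2) ≤ 1 := by
    rw [div_le_one (by positivity)]
    nlinarith
  exact mul_le_mul h2 (by linarith) (by linarith) (by positivity)

/-- The success probability gap of the phase flip at a phase `β` whose distances to `0` and `π`
are at least `u₀` and `v₀` grid cells. -/
theorem flipProb_gap_ge {t K : ℕ} (hK : 0 < K) {N₀ G D : ℝ} (hN₀ : 4 ≤ N₀)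
    (hN : N₀ ≤ 2 ^ t) {β : ℝ}
    (hu : 1 / 2 < 2 ^ t * β / (2 * Real.pi)) (hv : 1 / 2 < 2 ^ t * (Real.pi - β) / (2 * Real.pi))
    (hG : tailBound (2 ^ t * β / (2 * Real.pi)) (2 ^ t * (Real.pi - β) / (2 * Real.pi)) ≤ G)
    (hD : D ≤ 1) (hGD : 2 * G ≤ 9.8695 * (1 - 9.8697 / (6 * N₀ ^ 2)) * (1 - D)) :
    D ≤ flipProb t K (-β) - flipProb t K β := by
  have hπ := Real.pi_pos
  have ht : t ≠ 0 := by
    rintro rfl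
    norm_num at hN
    linarith
  obtain ⟨r, rfl⟩ := Nat.exists_eq_add_one_of_ne_zero ht
  have hM : (2 : ℕ) ^ (r + 1) = 2 * 2 ^ r := by ring
  have hM1 : 2 ≤ 2 ^ r := by
    have h1 : (4 : ℝ) ≤ 2 * 2 ^ r := by
      have : (2 : ℝ) ^ (r + 1) = 2 * 2 ^ r := by ring
      rw [← this]; linarith
    have h2 : 4 ≤ 2 * 2 ^ r := by exact_mod_cast h1
    omega
  have h1 := flipProb_neg_sub_flipProb_ge (t := r + 1) hK hM hM1 (β := β)
    (u := 2 ^ (r + 1) * β / (2 * Real.pi)) (v := 2 ^ (r + 1) * (Real.pi - β) / (2 * Real.pi))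
    (by field_simp) (by
      push_cast
      field_simp
      ring) hu hv
  have h2 := le_pi_mul_sin_pi_div hN₀ hN
  have h3 : 0 < 9.8695 * (1 - 9.8697 / (6 * N₀ ^ 2)) := by
    have : 9.8697 / (6 * N₀ ^ 2) < 1 := by
      rw [div_lt_one (by positivity)]
      nlinarith
    linarith
  by_contra hcon
  push Not at hcon
  have h4 : 9.8695 * (1 - 9.8697 / (6 * N₀ ^ 2)) * (1 - D)
      < Real.pi * 2 ^ (r + 1) * Real.sin (Real.pi / 2 ^ (r + 1))
        * (1 - (flipProb (r + 1) K (-β) - flipProb (r + 1) K β)) :=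
    mul_lt_mul' h2 (by linarith) (by linarith) (h3.trans_le h2)
  linarith [h1, h4, hGD, hG]

theorem flipProb_gap_nonneg (t K : ℕ) {β : ℝ} (h0 : 0 < β) (hpi : β < Real.pi) :
    0 ≤ flipProb t K (-β) - flipProb t K β := sub_nonneg.2 (flipProb_le_flipProb_neg t K h0 hpi)

theorem flipProb_gap_le_one (t K : ℕ) (β : ℝ) :
    flipProb t K (-β) - flipProb t K β ≤ 1 := by
  linarith [flipProb_nonneg t K β, flipProb_le_one t K (-β)]

theorem le_two_pow_precisionQubits {T : ℝ} :
    2 * Real.pi * T ≤ 2 ^ precisionQubits (1 / T) := by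
  have h1 : ⌈2 * Real.pi / (1 / T)⌉₊ ≤ 2 ^ precisionQubits (1 / T) :=
    Nat.le_pow_clog (by norm_num) _
  have h2 : (⌈2 * Real.pi / (1 / T)⌉₊ : ℝ) ≤ 2 ^ precisionQubits (1 / T) := by exact_mod_cast h1
  refine le_trans ?_ ((Nat.le_ceil _).trans h2)
  rw [div_div_eq_mul_div, div_one]

/-- A strict inequality between powers of two gains a factor `2`: a grid with more than `4` or `16`
points has at least `8` or `32`. -/
theorem two_pow_succ_le_of_lt {r t : ℕ} (h : (2 : ℝ) ^ r < 2 ^ t) : (2 : ℝ) ^ (r + 1) ≤ 2 ^ t :=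
  pow_le_pow_right₀ (by norm_num) ((pow_lt_pow_iff_right₀ (by norm_num)).1 h)

/-- If the cotangents of two angles are within a factor `X`, then so are the angles. -/
theorem le_mul_of_cot_le {a b X : ℝ} (hb : 0 < b) (hba : b ≤ a) (ha : a < Real.pi / 2)
    (h : Real.cot b ≤ X * Real.cot a) : a ≤ X * b := by
  have hsa : 0 < Real.sin a := Real.sin_pos_of_pos_of_lt_pi (by linarith) (by linarith)
  have hsb : 0 < Real.sin b := Real.sin_pos_of_pos_of_lt_pi (by linarith) (by linarith)
  have hca : 0 < Real.cos a := Real.cos_pos_of_mem_Ioo ⟨by linarith, ha⟩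
  have h1 : Real.cos a ≤ Real.cos (a - b) :=
    Real.cos_le_cos_of_nonneg_of_le_pi (by linarith) (by linarith) (by linarith)
  have h2 := mul_cos_le_sin (z := a - b) (by linarith) (by linarith)
  have h3 : (a - b) * Real.cos a ≤ Real.sin (a - b) :=
    (mul_le_mul_of_nonneg_left h1 (by linarith)).trans h2
  have h4 := Real.sin_le hb.le
  have h5 : a * Real.cos a * Real.sin b ≤ b * Real.cos b * Real.sin a := by
    have h6 := mul_le_mul_of_nonneg_left h3 hb.le
    have h7 := mul_le_mul_of_nonneg_left h4 (mul_nonneg (sub_nonneg.2 hba) hca.le)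
    rw [Real.sin_sub] at h6
    nlinarith
  rw [Real.cot_eq_cos_div_sin, Real.cot_eq_cos_div_sin, ← mul_div_assoc,
    div_le_div_iff₀ hsb hsa] at h
  have h6 := mul_le_mul_of_nonneg_left h hb.le
  have h7 : a * (Real.cos a * Real.sin b) ≤ X * b * (Real.cos a * Real.sin b) := by linarith
  exact le_of_mul_le_mul_right h7 (mul_pos hca hsb)

/-- The contribution of the first phases outweighs the defect `v` of the other phases. -/
theorem weighted_sum_ge {N : ℕ} {w r D : Fin N → ℝ} (hw : ∀ i, 0 ≤ w i) (hw1 : ∑ i, w i = 1)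
    (hr : ∑ i, w i * r i ^ 2 = 1) (hr0 : ∀ i, w i ≠ 0 → 0 < r i) {S : Finset (Fin N)} {B c M v : ℝ}
    (hB : 0 < B) (hS : 2 ≤ (∑ i ∈ S, w i) * B) (hv : 0 ≤ v) (hM : 0 ≤ M)
    (hv' : ∀ i, w i ≠ 0 → -v ≤ (1 - r i ^ 2) * (1 / r i * D i - c))
    (hM' : ∀ i ∈ S, w i ≠ 0 → M ≤ (1 - r i ^ 2) * (1 / r i * D i - c)) :
    2 * M / B - v ≤ ∑ i, w i * ((1 / r i - r i) * D i) := by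
  -- Subtracting `c (1 - r²)` changes nothing, because `∑ w` and `∑ w r²` are both `1`.
  have h1 : ∑ i, w i * ((1 / r i - r i) * D i)
      = ∑ i, w i * ((1 - r i ^ 2) * (1 / r i * D i - c)) := by
    have h2 : ∀ i, w i * ((1 - r i ^ 2) * (1 / r i * D i - c))
        = w i * ((1 / r i - r i) * D i) - c * w i + c * (w i * r i ^ 2) := fun i => by
      by_cases hi : w i = 0
      · rw [hi]; ring
      · have := (hr0 i hi).ne'
        field_simp
        ring
    rw [Finset.sum_congr rfl fun i _ => h2 i, Finset.sum_add_distrib, Finset.sum_sub_distrib,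
      ← Finset.mul_sum, ← Finset.mul_sum, hw1, hr]
    ring
  have h2 : ∀ i, (if i ∈ S then w i * M else 0) - w i * v
      ≤ w i * ((1 - r i ^ 2) * (1 / r i * D i - c)) := fun i => by
    by_cases hi : w i = 0
    · simp [hi]
    · split_ifs with hiS
      · have := mul_le_mul_of_nonneg_left (hM' i hiS hi) (hw i)
        nlinarith [mul_nonneg (hw i) hv]
      · have := mul_le_mul_of_nonneg_left (hv' i hi) (hw i)
        linarith
  have h3 := Finset.sum_le_sum fun i (_ : i ∈ Finset.univ) => h2 i
  rw [Finset.sum_sub_distrib, ← Finset.sum_mul, hw1, ← Finset.sum_filter, ← Finset.sum_mul,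
    Finset.filter_mem_eq_inter, Finset.univ_inter, one_mul] at h3
  rw [h1]
  refine le_trans (sub_le_sub_right ?_ v) h3
  rw [div_le_iff₀ hB]
  nlinarith [mul_le_mul_of_nonneg_right hS hM]

end Estimates

/-! ### The quantitative lower bound for the overlap. -/

section FinalBound

/-- The worst case is `D = 0` for `r ≤ 1` and `D = 1` for `r ≥ 1`. The latter leads to a cubic with
minimum near `r = 1.709`, where the square in the hint is centred. -/
theorem defect_le_of_small_angle {r D : ℝ} (hr : 0 < r) (hD0 : 0 ≤ D) (hD1 : D ≤ 1) :
    -0.39 ≤ (1 - r ^ 2) * (1 / r * D - 0.39) := by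
  have hr1 : 0 < 1 / r := by positivity
  rcases le_total r 1 with h | h
  · have h1 : 0 ≤ 1 - r ^ 2 := by nlinarith
    nlinarith [mul_nonneg h1 (mul_nonneg hr1.le hD0), sq_nonneg r]
  · have h1 : 0 ≤ r ^ 2 - 1 := by nlinarith
    have h2 : 1 / r * D ≤ 1 / r := mul_le_of_le_one_right hr1.le hD1
    have h3 : -0.39 ≤ (r ^ 2 - 1) * (0.39 - 1 / r) := by
      have h4 : 0 ≤ 0.39 * r ^ 3 - r ^ 2 + 1 := by
        nlinarith [mul_nonneg (sq_nonneg (r - 1.709)) (show 0 ≤ 0.39 * r + 0.33302 by linarith)]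
      have h5 : (r ^ 2 - 1) * (0.39 - 1 / r) + 0.39 = (0.39 * r ^ 3 - r ^ 2 + 1) / r := by
        field_simp; ring
      have h6 : 0 ≤ (0.39 * r ^ 3 - r ^ 2 + 1) / r := div_nonneg h4 hr.le
      linarith
    nlinarith [mul_le_mul_of_nonneg_left h2 h1]

/-- With `D` bounded below for `r ≤ 1`, a larger `c` makes the defect small on both sides of `r =
1`. The squares in the hints are centred at the minima of the two cubics. -/
theorem defect_le_of_large_angle {r D : ℝ} (hr : 0 < r) (hD1 : D ≤ 1)
    (hD : r ≤ 1 → 0.587 ≤ D) :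
    -0.0307 ≤ (1 - r ^ 2) * (1 / r * D - 0.8) := by
  have hr1 : 0 < 1 / r := by positivity
  rcases le_total r 1 with h | h
  · have h1 : 0 ≤ 1 - r ^ 2 := by nlinarith
    have h2 : 1 / r * 0.587 ≤ 1 / r * D := mul_le_mul_of_nonneg_left (hD h) hr1.le
    have h3 : -0.0307 ≤ (1 - r ^ 2) * (1 / r * 0.587 - 0.8) := by
      have h4 : 0 ≤ 0.8 * r ^ 3 - 0.587 * r ^ 2 - 0.7693 * r + 0.587 := by
        nlinarith [mul_nonneg (sq_nonneg (r - 0.8613)) (show 0 ≤ 0.8 * r + 0.79108 by linarith)]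
      have h5 : (1 - r ^ 2) * (1 / r * 0.587 - 0.8) + 0.0307
          = (0.8 * r ^ 3 - 0.587 * r ^ 2 - 0.7693 * r + 0.587) / r := by
        field_simp; ring
      have h6 := div_nonneg h4 hr.le
      linarith
    nlinarith [mul_le_mul_of_nonneg_left h2 h1]
  · have h1 : 0 ≤ r ^ 2 - 1 := by nlinarith
    have h2 : 1 / r * D ≤ 1 / r := mul_le_of_le_one_right hr1.le hD1
    have h3 : -0.0307 ≤ (r ^ 2 - 1) * (0.8 - 1 / r) := by
      have h4 : 0 ≤ 0.8 * r ^ 3 - r ^ 2 - 0.7693 * r + 1 := by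
        nlinarith [mul_nonneg (sq_nonneg (r - 1.12)) (show 0 ≤ 0.8 * r + 0.792 by linarith)]
      have h5 : (r ^ 2 - 1) * (0.8 - 1 / r) + 0.0307
          = (0.8 * r ^ 3 - r ^ 2 - 0.7693 * r + 1) / r := by
        field_simp; ring
      have h6 := div_nonneg h4 hr.le
      linarith
    nlinarith [mul_le_mul_of_nonneg_left h2 h1]

/-- At the first phase `r ≤ a/10`, hence `1/r ≥ 10/a` and `1 - r² ≥ 1 - 1/200`. -/
theorem main_term_ge {a r D d c : ℝ} (ha : 0 < a) (ha2 : a ^ 2 ≤ 1 / 2) (hr : 0 < r)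
    (hra : r ≤ a / 10) (hd : 0 ≤ d) (hdD : d ≤ D) (hc : c * a ≤ 10 * d) :
    0.995 * (10 * d / a - c) ≤ (1 - r ^ 2) * (1 / r * D - c) := by
  have h1 : 10 / a ≤ 1 / r := by
    rw [div_le_div_iff₀ ha hr]; linarith
  have h2 : 10 * d / a ≤ 1 / r * D := by
    rw [mul_div_right_comm]
    exact mul_le_mul h1 hdD hd (by positivity)
  have h3 : 0.995 ≤ 1 - r ^ 2 := by nlinarith
  have h4 : 0 ≤ 10 * d / a - c := by
    rw [sub_nonneg, le_div_iff₀ ha]; exact hc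
  exact mul_le_mul h3 (by linarith) h4 (by linarith)

/-- Converts bounds on `t = tan² θ` into bounds on `s = sin² θ = t/(1 + t)`. -/
theorem le_of_mul_one_add_eq {s t y : ℝ} (ht : 0 ≤ t) (h : s * (1 + t) = t)
    (hy : t ≤ y * (1 + t)) : s ≤ y :=
  le_of_mul_le_mul_right (h.le.trans hy) (by linarith)

theorem ge_of_mul_one_add_eq {s t y : ℝ} (ht : 0 ≤ t) (h : s * (1 + t) = t)
    (hy : y * (1 + t) ≤ t) : y ≤ s :=
  le_of_mul_le_mul_right (hy.trans h.ge) (by linarith)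

set_option maxHeartbeats 1000000 in
/-- The quantitative core: lower bound for the overlap in terms of the spectral measure. -/
theorem overlap_ge {a θ α β₁ T : ℝ} {K : ℕ} (hK : 0 < K) (ha : 0 < a) (ha2 : a ^ 2 ≤ 1 / 2)
    (hθ : 0 < θ) (hθpi : θ < Real.pi / 2) (htan : Real.tan θ = a * Real.cot (α / 2) / 10)
    (hτ : 1 / 20 ≤ Real.tan θ) (hα : 0 < α) (hαpi : α < Real.pi) {N : ℕ} {w x : Fin N → ℝ}
    (hw : ∀ i, 0 ≤ w i) (hw1 : ∑ i, w i = 1)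
    (hwt : ∑ i, w i * Real.tan (x i / 2) ^ 2 = 1 / Real.tan θ ^ 2)
    (hx : ∀ i, w i ≠ 0 → β₁ ≤ x i ∧ x i < Real.pi) (hβ : 0 < β₁) (hβα : β₁ ≤ α)
    (hcot : Real.cot (α / 2) ≤ Real.cot (β₁ / 2))
    (hcot' : Real.cot (β₁ / 2) ≤ 1.01 * Real.cot (α / 2))
    (hS : 2 ≤ (∑ i ∈ Finset.univ.filter fun i => x i = β₁, w i)
      * (403 * Real.sin θ ^ 2 + 1 / 200)) (hT : 1 / α / 0.78 ≤ T) :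
    1 / 10000 ≤ a * Real.cos θ * |∑ i, w i *
      ((Real.cot (x i / 2) - Real.tan θ ^ 2 * Real.tan (x i / 2)) *
        (flipProb (precisionQubits (1 / T)) K (-x i)
          - flipProb (precisionQubits (1 / T)) K (x i)))| := by
  have hπ := Real.pi_pos
  have hπ6 := Real.pi_gt_d6
  have hπ6' := Real.pi_lt_d6
  set t := precisionQubits (1 / T)
  set τ := Real.tan θ with hτdef
  have hτ0 : 0 < τ := by linarith
  have hsin : 0 < Real.sin θ := Real.sin_pos_of_pos_of_lt_pi hθ (by linarith)
  have hcos : 0 < Real.cos θ := Real.cos_pos_of_mem_Ioo ⟨by linarith, hθpi⟩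
  have ha1 : a ≤ 0.70711 := by nlinarith
  have hsτ : Real.cos θ * τ = Real.sin θ := by
    rw [hτdef, Real.tan_eq_sin_div_cos]; field_simp
  have hsq : Real.sin θ ^ 2 * (1 + τ ^ 2) = τ ^ 2 := by
    have h1 := Real.sin_sq_add_cos_sq θ
    have h2 : Real.cos θ ^ 2 * τ ^ 2 = Real.sin θ ^ 2 := by rw [← mul_pow, hsτ]
    have h3 : Real.cos θ ^ 2 = 1 - Real.sin θ ^ 2 := by linarith
    rw [h3] at h2
    linarith
  have hτ2 : 1 / 400 ≤ τ ^ 2 :=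
    le_trans (by norm_num) (pow_le_pow_left₀ (by norm_num) hτ 2)
  have hN : 2 * Real.pi ≤ 2 ^ t * (0.78 * α) := by
    have h1 : 2 * Real.pi * T ≤ 2 ^ t := le_two_pow_precisionQubits
    have h2 : 1 ≤ T * (0.78 * α) := by
      rw [div_div, div_le_iff₀ (by positivity)] at hT
      linarith
    have h3 : 0 ≤ 0.78 * α := by positivity
    have h4 := mul_le_mul_of_nonneg_right h1 h3
    have h5 := mul_le_mul_of_nonneg_left h2 (by positivity : 0 ≤ 2 * Real.pi)
    linarith
  have hβα' : α ≤ 1.01 * β₁ := by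
    have := le_mul_of_cot_le (a := α / 2) (b := β₁ / 2) (X := 1.01) (by linarith) (by linarith)
      (by linarith) hcot'
    linarith
  have hNpos : (0 : ℝ) < 2 ^ t := by positivity
  -- The grid spacing is at most `0.78 α ≤ 0.78 · 1.01 β₁`, and `1/(0.78 · 1.01) > 1.269`.
  have hu : ∀ y, β₁ ≤ y → 1.269 ≤ 2 ^ t * y / (2 * Real.pi) := fun y hy => by
    rw [le_div_iff₀ (by positivity)]
    have h1 := mul_le_mul_of_nonneg_left hβα' hNpos.le
    have h2 := mul_le_mul_of_nonneg_left hy hNpos.le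
    linarith
  have huv : ∀ y, 2 ^ t * y / (2 * Real.pi) + 2 ^ t * (Real.pi - y) / (2 * Real.pi)
      = 2 ^ t / 2 := fun y => by field_simp; ring
  have hcot0 : 0 < Real.cot (α / 2) := by
    by_contra hcon
    have := mul_nonneg ha.le (neg_nonneg.2 (not_lt.1 hcon))
    linarith
  have htc : ∀ y, 0 < y → y < Real.pi → 0 < Real.tan (y / 2) ∧
      Real.cot (y / 2) = 1 / Real.tan (y / 2) := fun y hy hyπ => by
    have h1 := Real.tan_pos_of_pos_of_lt_pi_div_two (x := y / 2) (by linarith) (by linarith)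
    refine ⟨h1, ?_⟩
    rw [eq_div_iff h1.ne', mul_comm]
    exact tan_mul_cot (Real.sin_pos_of_pos_of_lt_pi (by linarith) (by linarith)).ne'
      (Real.cos_pos_of_mem_Ioo ⟨by linarith, by linarith⟩).ne'
  have hx0 : ∀ i, w i ≠ 0 → 0 < x i := fun i hi => hβ.trans_le (hx i hi).1
  set r : Fin N → ℝ := fun i => τ * Real.tan (x i / 2) with hrdef
  set D : Fin N → ℝ := fun i => flipProb t K (-x i) - flipProb t K (x i) with hDdef
  have hr0 : ∀ i, w i ≠ 0 → 0 < r i := fun i hi =>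
    mul_pos hτ0 (htc (x i) (hx0 i hi) (hx i hi).2).1
  have hr1 : ∑ i, w i * r i ^ 2 = 1 := by
    have h1 : ∀ i, w i * r i ^ 2 = τ ^ 2 * (w i * Real.tan (x i / 2) ^ 2) := fun i => by
      simp only [hrdef]; ring
    rw [Finset.sum_congr rfl fun i _ => h1 i, ← Finset.mul_sum, hwt]
    field_simp
  have hsum : ∑ i, w i * ((Real.cot (x i / 2) - τ ^ 2 * Real.tan (x i / 2)) * D i)
      = τ * ∑ i, w i * ((1 / r i - r i) * D i) := by
    rw [Finset.mul_sum]
    refine Finset.sum_congr rfl fun i _ => ?_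
    by_cases hi : w i = 0
    · rw [hi]; ring
    · obtain ⟨h1, h2⟩ := htc (x i) (hx0 i hi) (hx i hi).2
      rw [h2]
      simp only [hrdef]
      field_simp
  -- This is where the choice of `θ` enters: `τ tan(β₁/2) = (a/10) cot(α/2) tan(β₁/2)`, and
  -- `cot(α/2) ≤ cot(β₁/2)`.
  have hrS : Real.tan (β₁ / 2) * τ ≤ a / 10 := by
    obtain ⟨h1, h2⟩ := htc β₁ hβ (by linarith)
    have h3 : Real.tan (β₁ / 2) * Real.cot (α / 2) ≤ 1 := by
      have := mul_le_mul_of_nonneg_left hcot h1.le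
      rw [h2] at this
      rwa [mul_one_div_cancel h1.ne'] at this
    rw [htan]
    have := mul_le_mul_of_nonneg_left h3 (by positivity : 0 ≤ a / 10)
    linarith
  have hD0 : ∀ i, w i ≠ 0 → 0 ≤ D i := fun i hi =>
    flipProb_gap_nonneg t K (hx0 i hi) (hx i hi).2
  have hD1 : ∀ i, D i ≤ 1 := fun i => flipProb_gap_le_one t K (x i)
  have hBpos : 0 < 403 * Real.sin θ ^ 2 + 1 / 200 := by positivity
  -- Common end of both cases: `d` bounds the gap at the first phase, `c` is the subtracted
  -- multiple, `v` the defect. A sum of at least `0.004/a`, together with `sin θ ≥ 0.04`, exceeds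
  -- the claimed `1/10000`.
  have hfin : ∀ d c v : ℝ, 0 ≤ d → 0 ≤ v → c * a ≤ 10 * d →
      (∀ i, w i ≠ 0 → x i = β₁ → d ≤ D i) →
      (∀ i, w i ≠ 0 → -v ≤ (1 - r i ^ 2) * (1 / r i * D i - c)) →
      (0.004 + v * a) * (403 * Real.sin θ ^ 2 + 1 / 200) ≤ 1.99 * (10 * d - c * a) →
      1 / 10000 ≤ a * Real.cos θ * |τ * ∑ i, w i * ((1 / r i - r i) * D i)| := by
    intro d c v hd hv hcd hdD hvi hnum
    have h1 := weighted_sum_ge hw hw1 hr1 hr0 hBpos hS hv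
      (M := 0.995 * (10 * d / a - c)) (by
        have : 0 ≤ 10 * d / a - c := by rw [sub_nonneg, le_div_iff₀ ha]; exact hcd
        positivity) hvi (fun i hiS hi => by
        have hi' := (Finset.mem_filter.1 hiS).2
        refine main_term_ge ha ha2 (hr0 i hi) ?_ hd (hdD i hi hi') hcd
        simp only [hrdef]
        rw [hi', mul_comm]
        exact hrS)
    have h2 : 0.004 ≤ a * (2 * (0.995 * (10 * d / a - c))
        / (403 * Real.sin θ ^ 2 + 1 / 200) - v) := by
      have h3 : a * (2 * (0.995 * (10 * d / a - c)) / (403 * Real.sin θ ^ 2 + 1 / 200) - v)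
          = 1.99 * (10 * d - c * a) / (403 * Real.sin θ ^ 2 + 1 / 200) - v * a := by
        field_simp
        ring
      rw [h3, le_sub_iff_add_le, le_div_iff₀ hBpos]
      exact hnum
    have h4 : 0.004 ≤ a * ∑ i, w i * ((1 / r i - r i) * D i) :=
      h2.trans (mul_le_mul_of_nonneg_left h1 ha.le)
    have h5 : 0.04 ≤ Real.sin θ := by
      refine (pow_le_pow_iff_left₀ (by norm_num) hsin.le two_ne_zero).1 ?_
      exact ge_of_mul_one_add_eq (sq_nonneg τ) hsq (by linarith)
    have h6 : 1 / 10000 ≤ Real.sin θ * (a * ∑ i, w i * ((1 / r i - r i) * D i)) :=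
      le_trans (by norm_num) (mul_le_mul h5 h4 (by norm_num) hsin.le)
    refine h6.trans ?_
    have h7 := le_abs_self (τ * ∑ i, w i * ((1 / r i - r i) * D i))
    have h8 := mul_le_mul_of_nonneg_left h7 (mul_pos ha hcos).le
    rw [← hsτ]
    linarith
  rw [hsum]
  -- The guaranteed weight of the first phase is about `2/(403 sin² θ)`. For small `τ` it is large
  -- enough to beat the crude defect `0.39`. For large `τ` the defect must be small, and there `α`
  -- is small, so the grid is finer and all phases with `r ≤ 1` are well resolved. The threshold is
  -- where `2 ^ t > 16` becomes available.
  rcases le_total τ 0.281 with hcase | hcase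
  · have hcot2 : 1 / 2 ≤ Real.cot (α / 2) ^ 2 := by
      have h1 : 100 * τ ^ 2 = a ^ 2 * Real.cot (α / 2) ^ 2 := by rw [htan]; ring
      have h2 := mul_le_mul_of_nonneg_right ha2 (sq_nonneg (Real.cot (α / 2)))
      linarith
    have hα2 : α < 2 := by
      by_contra hcon
      push Not at hcon
      have h1 : Real.cos (α / 2) ≤ Real.cos 1 :=
        Real.cos_le_cos_of_nonneg_of_le_pi (by norm_num) (by linarith) (by linarith)
      have h2 := Real.cos_one_le
      have h3 : 0 < Real.cos (α / 2) := Real.cos_pos_of_mem_Ioo ⟨by linarith, by linarith⟩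
      have h4 : 0 < Real.sin (α / 2) :=
        Real.sin_pos_of_pos_of_lt_pi (by linarith) (by linarith)
      rw [Real.cot_eq_cos_div_sin, div_pow, le_div_iff₀ (by positivity)] at hcot2
      have h5 := pow_le_pow_left₀ h3.le (h1.trans h2) 2
      linarith [Real.sin_sq_add_cos_sq (α / 2)]
    -- `α < 2` gives `2 ^ t ≥ 2π/1.56 > 4`.
    have hN8 : (8 : ℝ) ≤ 2 ^ t := by
      have := two_pow_succ_le_of_lt (r := 2) (t := t) (by
        by_contra hcon
        push Not at hcon
        have h1 := mul_le_mul hcon (show 0.78 * α ≤ 1.56 by linarith) (by positivity)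
          (by norm_num)
        linarith)
      norm_num at this
      exact this
    have hgap : ∀ i, w i ≠ 0 → x i = β₁ → 0.448 ≤ D i := fun i _ hi => by
      have hv : 1.45 ≤ 2 ^ t * (Real.pi - x i) / (2 * Real.pi) := by
        rw [le_div_iff₀ (by positivity), hi]
        have := mul_le_mul hN8 (show Real.pi - 2 ≤ Real.pi - β₁ by linarith) (by linarith)
          (by positivity)
        linarith
      have hu' := hu (x i) hi.ge
      exact flipProb_gap_ge hK (by norm_num) hN8 (by linarith) (by linarith)
        (tailBound_le_of_four_le hu' hv (by rw [huv]; linarith)) (by norm_num) (by norm_num)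
    refine hfin 0.448 0.39 0.39 (by norm_num) (by norm_num) (by linarith) hgap
      (fun i hi => defect_le_of_small_angle (hr0 i hi) (hD0 i hi) (hD1 i)) ?_
    have h2 : τ ^ 2 ≤ 0.281 ^ 2 := pow_le_pow_left₀ hτ0.le hcase 2
    have h1 : Real.sin θ ^ 2 ≤ 0.0732 :=
      le_of_mul_one_add_eq (sq_nonneg τ) hsq (by linarith)
    have h3 : (0.004 + 0.39 * a) * (403 * Real.sin θ ^ 2 + 1 / 200)
        ≤ (0.004 + 0.39 * a) * 29.51 := mul_le_mul_of_nonneg_left (by linarith) (by positivity)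
    linarith
  · have hκ : 3.9739 ≤ Real.cot (α / 2) := by
      by_contra hcon
      push Not at hcon
      have := mul_le_mul ha1 hcon.le hcot0.le (by norm_num)
      linarith
    have hα2 : α ≤ 0.5033 := by
      obtain ⟨h1, h2⟩ := htc α hα hαpi
      have h3 := Real.le_tan (x := α / 2) (by linarith) (by linarith)
      rw [h2, le_div_iff₀ h1] at hκ
      linarith
    -- `α ≤ 0.5033` gives `2 ^ t ≥ 2π/0.392574`, barely above `16`.
    have hN32 : (32 : ℝ) ≤ 2 ^ t := by
      have := two_pow_succ_le_of_lt (r := 4) (t := t) (by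
        by_contra hcon
        push Not at hcon
        have h1 := mul_le_mul hcon (show 0.78 * α ≤ 0.392574 by linarith) (by positivity)
          (by norm_num)
        linarith)
      norm_num at this
      exact this
    have hs2 : 0.27 ≤ θ := by
      have h2 : 0.281 ^ 2 ≤ τ ^ 2 := pow_le_pow_left₀ (by norm_num) hcase 2
      have h3 : 0.27 ≤ Real.sin θ := by
        refine (pow_le_pow_iff_left₀ (by norm_num) hsin.le two_ne_zero).1 ?_
        exact ge_of_mul_one_add_eq (sq_nonneg τ) hsq (by linarith)
      exact h3.trans (Real.sin_le hθ.le)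
    have hgap : ∀ i, w i ≠ 0 → r i ≤ 1 → 0.587 ≤ D i := fun i hi hri => by
      -- `r ≤ 1` means `tan(x/2) ≤ cot θ`, so the phase keeps a distance `2θ ≥ 0.54` from `π`, where
      -- estimates wrap around and the sign is lost.
      have hxθ : x i ≤ Real.pi - 2 * θ := by
        by_contra hcon
        push Not at hcon
        have h1 := Real.tan_lt_tan_of_nonneg_of_lt_pi_div_two (x := Real.pi / 2 - θ)
          (y := x i / 2) (by linarith) (by linarith [(hx i hi).2]) (by linarith)
        rw [Real.tan_pi_div_two_sub] at h1
        have h2 := mul_lt_mul_of_pos_left h1 hτ0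
        rw [← hτdef, mul_inv_cancel₀ hτ0.ne'] at h2
        linarith
      have hv : 2.7 ≤ 2 ^ t * (Real.pi - x i) / (2 * Real.pi) := by
        rw [le_div_iff₀ (by positivity)]
        have := mul_le_mul hN32 (show 2 * 0.27 ≤ Real.pi - x i by linarith) (by norm_num)
          (by positivity)
        linarith
      have hu' := hu (x i) (hx i hi).1
      exact flipProb_gap_ge hK (by norm_num) hN32 (by linarith) (by linarith)
        (tailBound_le_of_sixteen_le hu' hv (by rw [huv]; linarith)) (by norm_num) (by norm_num)
    refine hfin 0.587 0.8 0.0307 (by norm_num) (by norm_num) (by linarith) (fun i hi hi' => ?_)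
      (fun i hi => defect_le_of_large_angle (hr0 i hi) (hD1 i) (hgap i hi)) ?_
    · refine hgap i hi ?_
      simp only [hrdef]
      rw [hi', mul_comm]
      linarith
    · have h1 : Real.sin θ ^ 2 ≤ 1 := Real.sin_sq_le_one θ
      have h3 : (0.004 + 0.0307 * a) * (403 * Real.sin θ ^ 2 + 1 / 200)
          ≤ (0.004 + 0.0307 * a) * 403.005 :=
        mul_le_mul_of_nonneg_left (by linarith) (by positivity)
      linarith

end FinalBound

end QWalk

/-! ### Assembly of the main theorem. -/

theorem mainTheorem5 (C : ℝ) (hC : 0 < C) (ε : ℝ) (hε : 0 < ε) :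
    ∃ c : ℝ, 0 < c ∧
      ∀ (n : Type*) [Fintype n] [DecidableEq n]
        (U₂ : Matrix n n ℝ) (φ₀ μ : n → ℝ) (α₁ θ T : ℝ),
        -- the abstract search algorithm
        U₂ ∈ Matrix.orthogonalGroup n ℝ →
        φ₀ ⬝ᵥ φ₀ = 1 →
        U₂ *ᵥ φ₀ = φ₀ →
        (∀ v : n → ℝ, U₂ *ᵥ v = v → ∃ r : ℝ, v = r • φ₀) →
        (∀ v : n → ℝ, U₂ *ᵥ v = -v → v = 0) →
        μ ⬝ᵥ μ = 1 →
        μ ⬝ᵥ φ₀ ≠ 0 →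
        -- the principal eigenphase and the angle of the modified algorithm
        IsLeast (QWalk.eigenphases (QWalk.searchOp U₂ μ)) α₁ →
        0 ≤ θ → θ < Real.pi / 2 →
        Real.tan θ = (μ ⬝ᵥ φ₀) * Real.cot (α₁ / 2) / 10 →
        -- the projection of the start state onto the principal eigenspace
        1 - ε ≤ QWalk.phaseWeight (QWalk.searchOp U₂ μ)
          (QWalk.cvec (QWalk.startState φ₀ μ)) α₁ →
        ε < QWalk.phaseWeight (QWalk.searchOp U₂ μ)
          (QWalk.cvec (QWalk.startState φ₀ μ)) α₁ →
        QWalk.quantumHittingTime U₂ φ₀ μ ε / 0.78 ≤ T →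
        c ≤ ‖QWalk.braket
          (QWalk.withRegisters (QWalk.tensor (QWalk.ket 1) (QWalk.cvec μ)))
          (QWalk.rotate C
              (QWalk.modifiedSearchOp (QWalk.markedReflection μ) (QWalk.cmat U₂) θ) (1 / T) (1 / 4)
            *ᵥ QWalk.withRegisters
              (QWalk.tensor (QWalk.ketThetaPerp θ) (QWalk.cvec (QWalk.startState φ₀ μ))))‖ := by
  -- The constant is universal: `ε` matters only through a principal weight of at least `1/2` and
  -- the hitting-time bound, and `C` only through having at least one repetition.
  refine ⟨1 / 10000, by norm_num, ?_⟩
  intro n _ _ U₂ φ₀ μ α₁ θ T hU hφ hUφ h1 hneg hμ ha hα hθ hθpi htan hp hp' hT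
  -- The weight is at least `1 - ε` and more than `ε`, so twice the weight exceeds `1`.
  have hhalf : 1 / 2 ≤ QWalk.phaseWeight (QWalk.searchOp U₂ μ)
      (QWalk.cvec (QWalk.startState φ₀ μ)) α₁ := by linarith
  obtain ⟨ha0, ha2, hθ0, hτ, hα0, hαpi, N, w, x, β₁, hw, hw1, hwt, hx, hβ, hβα, hcot, hcot', hS,
    hov⟩ := QWalk.exists_modified_spectrum hU hφ hUφ h1 hneg hμ ha hα hhalf hθ hθpi htan
  rw [hov]
  have hK : 0 < QWalk.repetitions C (1 / 4) :=
    Nat.ceil_pos.2 (mul_pos hC (Real.log_pos (by norm_num)))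
  have hT' : 1 / α₁ / 0.78 ≤ T :=
    (div_le_div_of_nonneg_right (QWalk.one_div_le_quantumHittingTime hε hα hp')
      (by norm_num)).trans hT
  exact QWalk.overlap_ge hK ha0 ha2 hθ0 hθpi htan hτ hα0 hαpi hw hw1 hwt hx hβ hβα hcot hcot' hS
    hT'
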